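/- Let $\Theta=C^{3,\infty}(\mathbb R^d,\mathbb R^d)$ be the Banach space of $C^3$ vector fields $\theta$ with $D^k\theta$ bounded for $0\le k\le 3$, and for $\Omega_1,\Omega_2\subset\mathbb R^d$ put $$d_\Theta(\Omega_1,\Omega_2)=\inf\{\|\theta\|_\Theta+\|(I+\theta)^{-1}-I\|_\Theta:\ \theta\in\Theta,\ I+\theta \text{ a diffeomorphism},\ (I+\theta)(\Omega_1)=\Omega_2\}.$$ Let $\Omega^*\subset\mathbb R^d$ be a bounded open set with boundary of class $C^5$ and outer unit normal $\boldsymbol n$, and let $H^s(\partial\Omega^*)$, $0\le s\le1$, be the usual Sobolev spaces with norm $\|\varphi\|_{H^s}^2=\|\varphi\|_{L^2}^2+|\varphi|_{H^s}^2$, where $|\cdot|_{H^s}$ is $0$ for $s=0$, the Gagliardo seminorm for $0<s<1$ and the $L^2$ norm of the tangential gradient for $s=1$. Let $J$ be a real-valued shape functional that is twice Fréchet differentiable on a neighborhood of $\Omega^*$ for $d_\Theta$, i.e. for every $\Omega$ in such a neighborhood the function $\theta\mapsto J((I+\theta)(\Omega))$ on $\Theta$ is twice Fréchet differentiable at $0$.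 Write $\mathcal J(\theta)=J((I+\theta)(\Omega^*))$. The hessian $\ell_2$ of $J$ at $\Omega^*$ is the bilinear form with $\mathcal J''(0)(\xi,\zeta)=\ell_2(\xi\cdot\boldsymbol n,\zeta\cdot\boldsymbol n)$ for all $\xi,\zeta\in\Theta$ whose tangential components vanish on $\partial\Omega^*$. Assume that there are $0\le s_1<s_2\le1$ such that the following hold. * (Structure of the hessian.) $\ell_2$ extends to a bilinear form on $H^{s_2}(\partial\Omega^*)$ and can be written there as $\ell_2=\ell_m+\ell_r$, where $\varphi\mapsto\ell_m(\varphi,\varphi)$ is lower semicontinuous on $H^{s_2}(\partial\Omega^*)$, $\ell_m(\varphi,\varphi)\ge c_1|\varphi|_{H^{s_2}}^2$ for all $\varphi\in C^\infty(\partial\Omega^*)$ (restrictions to $\partial\Omega^*$ of smooth functions on $\mathbb R^d$) with some $c_1>0$, and $\ell_r$ is continuous for the $H^{s_1}$ norm. * (Condition $C_{H^{s_2}}$.) There are $\eta_0>0$ and $\omega$ with $\omega(r)\to0$ as $r\to0^+$ such that for every $\theta\in\Theta$ with $\|\theta\|_\Theta\le\eta_0$ and $\theta=(\theta\cdot\boldsymbol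 n)\boldsymbol n$ on $\partial\Omega^*$, and for every $t\in[0,1]$, $$|j''(t)-j''(0)|\le\omega(\|\theta\|_\Theta)\,\|\theta\cdot\boldsymbol n\|_{H^{s_2}}^2,\qquad j(t)=J((I+t\theta)(\Omega^*)).$$ * (Criticality.) $\mathcal J'(0)=0$. * (Stability.) $\ell_2(\varphi,\varphi)>0$ for all $\varphi\in H^{s_2}(\partial\Omega^*)\setminus\{0\}$. Then $\Omega^*$ is an $H^{s_2}$-stable local minimum of $J$ in a $\Theta$-neighborhood: there exist $r>0$, $\eta>0$ and $c>0$ such that for every $\Omega$ with $d_\Theta(\Omega^*,\Omega)\le\eta$ there is a unique function $h:\partial\Omega^*\to(-r,r)$ with $\partial\Omega=\{x+h(x)\boldsymbol n(x):x\in\partial\Omega^*\}$, and this $h$ belongs to $H^{s_2}(\partial\Omega^*)$ and satisfies $$J(\Omega)\ge J(\Omega^*)+c\,\|h\|_{H^{s_2}}^2 .$$ -/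

import Mathlib

open MeasureTheory Filter Topology Set
open scoped ENNReal RealInnerProductSpace ContDiff BoundedContinuousFunction

namespace ShapeStability

noncomputable section

/-- The ambient Euclidean space `ℝ^d`. -/
abbrev Euc (d : ℕ) : Type := EuclideanSpace ℝ (Fin d)

/-! ### The Banach space `Θ = C^{3,∞}(ℝ^d, ℝ^d)` -/

/-- The vector space of all `C³` fields on `ℝ^d` whose derivatives of order `0, 1, 2, 3` are
bounded. -/
def thetaSubmodule (d : ℕ) : Submodule ℝ (Euc d → Euc d) where
  carrier := {θ | ContDiff ℝ 3 θ ∧ ∀ k : Fin 4, ∃ C, ∀ x, ‖iteratedFDeriv ℝ k θ x‖ ≤ C}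
  zero_mem' := by
    refine ⟨contDiff_const, fun k => ⟨0, fun x => ?_⟩⟩
    have : (0 : Euc d → Euc d) = fun _ => 0 := rfl
    simp [this]
  add_mem' := by
    rintro f g ⟨hf, hf'⟩ ⟨hg, hg'⟩
    refine ⟨hf.add hg, fun k => ?_⟩
    obtain ⟨C, hC⟩ := hf' k
    obtain ⟨D, hD⟩ := hg' k
    have hk : ((k : ℕ) : WithTop ℕ∞) ≤ 3 := by
      have := k.is_lt
      exact_mod_cast (by omega : (k : ℕ) ≤ 3)
    refine ⟨C + D, fun x => ?_⟩
    rw [iteratedFDeriv_add (hf.of_le hk) (hg.of_le hk)]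
    exact (norm_add_le _ _).trans (add_le_add (hC x) (hD x))
  smul_mem' := by
    rintro c f ⟨hf, hf'⟩
    refine ⟨contDiff_const.smul hf, fun k => ?_⟩
    obtain ⟨C, hC⟩ := hf' k
    have hk : ((k : ℕ) : WithTop ℕ∞) ≤ 3 := by
      have := k.is_lt
      exact_mod_cast (by omega : (k : ℕ) ≤ 3)
    refine ⟨‖c‖ * C, fun x => ?_⟩
    rw [iteratedFDeriv_const_smul_apply (hf.of_le hk).contDiffAt, norm_smul]
    exact mul_le_mul_of_nonneg_left (hC x) (norm_nonneg _)

/-- The space `Θ = C^{3,∞}(ℝ^d, ℝ^d)`. -/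
def Theta (d : ℕ) : Type := thetaSubmodule d

instance (d : ℕ) : AddCommGroup (Theta d) := inferInstanceAs (AddCommGroup (thetaSubmodule d))
instance (d : ℕ) : Module ℝ (Theta d) := inferInstanceAs (Module ℝ (thetaSubmodule d))
instance (d : ℕ) : CoeFun (Theta d) (fun _ => Euc d → Euc d) := ⟨fun θ => θ.1⟩

theorem Theta.le_three (k : Fin 4) : ((k : ℕ) : WithTop ℕ∞) ≤ 3 := by
  have := k.is_lt
  exact_mod_cast (by omega : (k : ℕ) ≤ 3)

/-- The family of derivatives `(θ, Dθ, D²θ, D³θ)`, as bounded continuous functions. -/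
def Theta.derivs (d : ℕ) :
    Theta d →ₗ[ℝ] ((k : Fin 4) → (Euc d →ᵇ (Euc d [×(k : ℕ)]→L[ℝ] Euc d))) where
  toFun θ k := BoundedContinuousFunction.ofNormedAddCommGroup (iteratedFDeriv ℝ k θ.1)
    (θ.2.1.continuous_iteratedFDeriv (Theta.le_three k))
    (θ.2.2 k).choose (θ.2.2 k).choose_spec
  map_add' θ ζ := by
    funext k
    ext1 x
    exact iteratedFDeriv_add_apply (θ.2.1.of_le (Theta.le_three k)).contDiffAt
      (ζ.2.1.of_le (Theta.le_three k)).contDiffAt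
  map_smul' c θ := by
    funext k
    ext1 x
    exact iteratedFDeriv_const_smul_apply (θ.2.1.of_le (Theta.le_three k)).contDiffAt

theorem Theta.derivs_injective (d : ℕ) : Function.Injective (Theta.derivs d) := by
  intro θ ζ h
  apply Subtype.ext
  funext x
  have h0 := congrArg (fun F => F 0 x 0) h
  exact h0

/-- The norm of `Θ`: `‖θ‖ = max_{k ≤ 3} sup_x ‖D^k θ(x)‖`. -/
instance (d : ℕ) : NormedAddCommGroup (Theta d) :=
  NormedAddCommGroup.induced (Theta d) _ (Theta.derivs d) (Theta.derivs_injective d)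

instance (d : ℕ) : NormedSpace ℝ (Theta d) := NormedSpace.induced ℝ (Theta d) _ (Theta.derivs d)

/-- The deformation `I + θ`. -/
def deform {d : ℕ} (θ : Theta d) (x : Euc d) : Euc d := x + θ x

/-- The distance `d_Θ(Ω₁, Ω₂)`: the infimum of `‖θ‖ + ‖(I+θ)⁻¹ - I‖` over all diffeomorphisms
`I + θ` of `ℝ^d`, `θ ∈ Θ`, with `(I+θ)(Ω₁) = Ω₂`. Here `(I+θ)⁻¹ - I = ψ ∈ Θ`; if the inverse is not
of this form the quantity is infinite. -/
def dTheta {d : ℕ} (Ω₁ Ω₂ : Set (Euc d)) : ℝ≥0∞ :=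
  ⨅ (θ : Theta d) (ψ : Theta d) (_ : Function.LeftInverse (deform ψ) (deform θ))
    (_ : Function.RightInverse (deform ψ) (deform θ)) (_ : deform θ '' Ω₁ = Ω₂),
    ENNReal.ofReal (‖θ‖ + ‖ψ‖)

/-! ### Smooth domains, outer normal, surface measure -/

/-- `ρ` is a `C^k` defining function of `Ω` near the boundary point `x`. -/
def IsDefiningFunctionAt {d : ℕ} (k : ℕ) (Ω : Set (Euc d)) (x : Euc d) (ρ : Euc d → ℝ) : Prop :=
  ContDiff ℝ k ρ ∧ ρ x = 0 ∧ gradient ρ x ≠ 0 ∧ ∀ᶠ y in 𝓝 x, (y ∈ Ω ↔ ρ y < 0)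

/-- `Ω` is a bounded open set whose boundary is of class `C^k` (with `Ω` locally on one side). -/
structure IsBoundedDomain {d : ℕ} (k : ℕ) (Ω : Set (Euc d)) : Prop where
  isOpen : IsOpen Ω
  isBounded : Bornology.IsBounded Ω
  boundary : ∀ x ∈ frontier Ω, ∃ ρ, IsDefiningFunctionAt k Ω x ρ

/-- `ν` is the outer unit normal of `Ω` at `x`: the normalized gradient of a defining function. -/
def IsOuterNormal {d : ℕ} (Ω : Set (Euc d)) (x ν : Euc d) : Prop :=
  ∃ ρ, IsDefiningFunctionAt 1 Ω x ρ ∧ ν = ‖gradient ρ x‖⁻¹ • gradient ρ x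

theorem IsDefiningFunctionAt.eventually_neg {d : ℕ} {Ω : Set (Euc d)} {x v : Euc d}
    {ρ : Euc d → ℝ} (h : IsDefiningFunctionAt 1 Ω x ρ) (hv : ⟪gradient ρ x, v⟫ < 0) :
    ∀ᶠ t in 𝓝[>] (0 : ℝ), x + t • v ∈ Ω := by
  obtain ⟨h1, h2, -, h4⟩ := h
  have hc : Tendsto (fun t : ℝ => x + t • v) (𝓝[>] 0) (𝓝 x) := by
    have : Continuous (fun t : ℝ => x + t • v) := by fun_prop
    simpa using (this.tendsto 0).mono_left nhdsWithin_le_nhds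
  have hd : HasDerivAt (fun t : ℝ => ρ (x + t • v)) ⟪gradient ρ x, v⟫ 0 := by
    have hρ : HasFDerivAt ρ (fderiv ℝ ρ x) (x + (0 : ℝ) • v) := by
      simpa using (h1.differentiable (by simp) x).hasFDerivAt
    have hl : HasDerivAt (fun t : ℝ => x + t • v) v 0 := by
      simpa using ((hasDerivAt_id (0 : ℝ)).smul_const v).const_add x
    have e : ⟪gradient ρ x, v⟫ = fderiv ℝ ρ x v := by simp [gradient]
    rw [e]
    exact hρ.comp_hasDerivAt 0 hl
  have hs := (hasDerivAt_iff_tendsto_slope.1 hd).eventually_lt_const hv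
  have hs' : ∀ᶠ t in 𝓝[>] (0 : ℝ), slope (fun t : ℝ => ρ (x + t • v)) 0 t < 0 :=
    hs.filter_mono (nhdsWithin_mono _ fun t ht => ne_of_gt ht)
  filter_upwards [hs', hc.eventually h4, self_mem_nhdsWithin] with t ht1 ht2 ht3
  refine ht2.2 ?_
  have ht3' : (0 : ℝ) < t := ht3
  simp only [slope_def_field, zero_smul, add_zero, h2, sub_zero] at ht1
  exact (div_neg_iff.1 ht1).elim (fun h => absurd h.2 (not_lt.2 ht3'.le)) (fun h => h.1)

theorem IsDefiningFunctionAt.eventually_pos {d : ℕ} {Ω : Set (Euc d)} {x v : Euc d}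
    {ρ : Euc d → ℝ} (h : IsDefiningFunctionAt 1 Ω x ρ) (hv : 0 < ⟪gradient ρ x, v⟫) :
    ∀ᶠ t in 𝓝[>] (0 : ℝ), x + t • v ∉ Ω := by
  obtain ⟨h1, h2, -, h4⟩ := h
  have hc : Tendsto (fun t : ℝ => x + t • v) (𝓝[>] 0) (𝓝 x) := by
    have : Continuous (fun t : ℝ => x + t • v) := by fun_prop
    simpa using (this.tendsto 0).mono_left nhdsWithin_le_nhds
  have hd : HasDerivAt (fun t : ℝ => ρ (x + t • v)) ⟪gradient ρ x, v⟫ 0 := by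
    have hρ : HasFDerivAt ρ (fderiv ℝ ρ x) (x + (0 : ℝ) • v) := by
      simpa using (h1.differentiable (by simp) x).hasFDerivAt
    have hl : HasDerivAt (fun t : ℝ => x + t • v) v 0 := by
      simpa using ((hasDerivAt_id (0 : ℝ)).smul_const v).const_add x
    have e : ⟪gradient ρ x, v⟫ = fderiv ℝ ρ x v := by simp [gradient]
    rw [e]
    exact hρ.comp_hasDerivAt 0 hl
  have hs := (hasDerivAt_iff_tendsto_slope.1 hd).eventually_const_lt hv
  have hs' : ∀ᶠ t in 𝓝[>] (0 : ℝ), 0 < slope (fun t : ℝ => ρ (x + t • v)) 0 t :=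
    hs.filter_mono (nhdsWithin_mono _ fun t ht => ne_of_gt ht)
  filter_upwards [hs', hc.eventually h4, self_mem_nhdsWithin] with t ht1 ht2 ht3
  rw [ht2, not_lt]
  have ht3' : (0 : ℝ) < t := ht3
  simp only [slope_def_field, zero_smul, add_zero, h2, sub_zero] at ht1
  exact ((div_pos_iff_of_pos_right ht3').1 ht1).le

/-- The outer unit normal does not depend on the defining function. -/
theorem IsOuterNormal.unique {d : ℕ} {Ω : Set (Euc d)} {x ν ν' : Euc d}
    (h : IsOuterNormal Ω x ν) (h' : IsOuterNormal Ω x ν') : ν = ν' := by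
  obtain ⟨ρ, hρ, rfl⟩ := h
  obtain ⟨ρ', hρ', rfl⟩ := h'
  set a := gradient ρ x with ha
  set b := gradient ρ' x with hb
  have ha0 : 0 < ‖a‖ := norm_pos_iff.2 hρ.2.2.1
  have hb0 : 0 < ‖b‖ := norm_pos_iff.2 hρ'.2.2.1
  by_contra hne
  have hlt : ⟪a, b⟫ < ‖a‖ * ‖b‖ := by
    refine lt_of_le_of_ne (real_inner_le_norm a b) fun heq => hne ?_
    have := inner_eq_norm_mul_iff_real.1 heq
    rw [inv_smul_eq_iff₀ ha0.ne', smul_comm, eq_inv_smul_iff₀ hb0.ne']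
    exact this
  have hva : ⟪a, ‖a‖ • b - ‖b‖ • a⟫ < 0 := by
    rw [inner_sub_right, real_inner_smul_right, real_inner_smul_right, real_inner_self_eq_norm_sq]
    nlinarith
  have hvb : 0 < ⟪b, ‖a‖ • b - ‖b‖ • a⟫ := by
    rw [inner_sub_right, real_inner_smul_right, real_inner_smul_right, real_inner_self_eq_norm_sq,
      real_inner_comm]
    nlinarith
  obtain ⟨t, h1, h2⟩ := ((hρ.eventually_neg hva).and (hρ'.eventually_pos hvb)).exists
  exact h2 h1

open Classical in
/-- The outer unit normal `n` of `Ω` (zero where there is none). -/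
def outerNormal {d : ℕ} (Ω : Set (Euc d)) (x : Euc d) : Euc d :=
  if h : ∃ ν, IsOuterNormal Ω x ν then h.choose else 0

/-- The surface measure of `∂Ω`. -/
def surf {d : ℕ} (Ω : Set (Euc d)) : Measure (Euc d) := (μHE[d - 1]).restrict (frontier Ω)

/-! ### Sobolev spaces `H^s(∂Ω)`, `0 ≤ s ≤ 1` -/

/-- The tangential gradient `∇_τ f = ∇f - (∇f · n) n` of a function that is smooth near `∂Ω`. -/
def tangentialGradient {d : ℕ} (Ω : Set (Euc d)) (f : Euc d → ℝ) (x : Euc d) : Euc d :=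
  gradient f x - ⟪gradient f x, outerNormal Ω x⟫ • outerNormal Ω x

/-- `g ∈ L²(∂Ω)` is the (generalized) tangential gradient of `φ`: there are smooth `f k` with
`f k → φ` and `∇_τ (f k) → g` in `L²(∂Ω)`. -/
def HasTangentialGradient {d : ℕ} (Ω : Set (Euc d)) (φ : Euc d → ℝ) (g : Euc d → Euc d) : Prop :=
  MemLp g 2 (surf Ω) ∧ ∃ f : ℕ → Euc d → ℝ, (∀ k, ContDiff ℝ ∞ (f k)) ∧
    (∀ k, MemLp (f k) 2 (surf Ω) ∧ MemLp (tangentialGradient Ω (f k)) 2 (surf Ω)) ∧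
    Tendsto (fun k => eLpNorm (f k - φ) 2 (surf Ω)) atTop (𝓝 0) ∧
    Tendsto (fun k => eLpNorm (tangentialGradient Ω (f k) - g) 2 (surf Ω)) atTop (𝓝 0)

/-- The difference quotient whose `L²(∂Ω × ∂Ω)` norm is the Gagliardo seminorm of order `s`. -/
def gagliardoQuotient {d : ℕ} (s : ℝ) (φ : Euc d → ℝ) (p : Euc d × Euc d) : ℝ :=
  (φ p.1 - φ p.2) / ‖p.1 - p.2‖ ^ (((d : ℝ) - 1) / 2 + s)

/-- The seminorm `|φ|_{H^s(∂Ω)}`: zero for `s = 0`, the Gagliardo (Slobodeckij) seminorm for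
`0 < s < 1`, the `L²` norm of the tangential gradient for `s = 1` (infinite if there is none). -/
def sobolevSeminorm {d : ℕ} (Ω : Set (Euc d)) (s : ℝ) (φ : Euc d → ℝ) : ℝ≥0∞ :=
  if s ≤ 0 then 0
  else if s < 1 then eLpNorm (gagliardoQuotient s φ) 2 ((surf Ω).prod (surf Ω))
  else ⨅ (g : Euc d → Euc d) (_ : HasTangentialGradient Ω φ g), eLpNorm g 2 (surf Ω)

/-- The norm of `H^s(∂Ω)`: `‖φ‖² = ‖φ‖²_{L²} + |φ|²_{H^s}`. -/
def sobolevNorm {d : ℕ} (Ω : Set (Euc d)) (s : ℝ) (φ : Euc d → ℝ) : ℝ :=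
  Real.sqrt ((eLpNorm φ 2 (surf Ω)).toReal ^ 2 + (sobolevSeminorm Ω s φ).toReal ^ 2)

/-- `φ ∈ H^s(∂Ω)`: `φ` has finite `H^s` norm and belongs to the closure, in this norm, of
`C^∞(∂Ω)`, the restrictions to `∂Ω` of smooth functions on `ℝ^d`. -/
def MemSobolev {d : ℕ} (Ω : Set (Euc d)) (s : ℝ) (φ : Euc d → ℝ) : Prop :=
  MemLp φ 2 (surf Ω) ∧ sobolevSeminorm Ω s φ < ⊤ ∧
    ∀ ε : ℝ≥0∞, 0 < ε → ∃ f : Euc d → ℝ, ContDiff ℝ ∞ f ∧ MemLp f 2 (surf Ω) ∧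
      eLpNorm (φ - f) 2 (surf Ω) ≤ ε ∧ sobolevSeminorm Ω s (φ - f) ≤ ε

section SobolevLemmas

variable {d : ℕ} {Ω : Set (Euc d)} {s : ℝ}

theorem gagliardoQuotient_congr {φ ψ : Euc d → ℝ} (h : φ =ᵐ[surf Ω] ψ) :
    gagliardoQuotient s φ =ᵐ[(surf Ω).prod (surf Ω)] gagliardoQuotient s ψ := by
  have h1 := (Measure.quasiMeasurePreserving_fst (μ := surf Ω) (ν := surf Ω)).ae h
  have h2 := (Measure.quasiMeasurePreserving_snd (μ := surf Ω) (ν := surf Ω)).ae h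
  filter_upwards [h1, h2] with p hp1 hp2
  simp only [gagliardoQuotient, hp1, hp2]

theorem aestronglyMeasurable_gagliardoQuotient {φ : Euc d → ℝ}
    (h : AEStronglyMeasurable φ (surf Ω)) :
    AEStronglyMeasurable (gagliardoQuotient s φ) ((surf Ω).prod (surf Ω)) := by
  have h1 := h.comp_quasiMeasurePreserving
    (Measure.quasiMeasurePreserving_fst (μ := surf Ω) (ν := surf Ω))
  have h2 := h.comp_quasiMeasurePreserving
    (Measure.quasiMeasurePreserving_snd (μ := surf Ω) (ν := surf Ω))
  have h3 : Measurable (fun p : Euc d × Euc d => ‖p.1 - p.2‖ ^ (((d : ℝ) - 1) / 2 + s)) := by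
    fun_prop
  exact ((h1.sub h2).aemeasurable.div h3.aemeasurable).aestronglyMeasurable

theorem HasTangentialGradient.congr {φ ψ : Euc d → ℝ} {g : Euc d → Euc d}
    (h : φ =ᵐ[surf Ω] ψ) (hg : HasTangentialGradient Ω φ g) : HasTangentialGradient Ω ψ g := by
  obtain ⟨h1, f, h2, h2', h3, h4⟩ := hg
  refine ⟨h1, f, h2, h2', ?_, h4⟩
  refine h3.congr fun k => eLpNorm_congr_ae ?_
  filter_upwards [h] with x hx
  simp [hx]

theorem sobolevSeminorm_congr {φ ψ : Euc d → ℝ} (h : φ =ᵐ[surf Ω] ψ) :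
    sobolevSeminorm Ω s φ = sobolevSeminorm Ω s ψ := by
  unfold sobolevSeminorm
  split_ifs
  · rfl
  · exact eLpNorm_congr_ae (gagliardoQuotient_congr h)
  · refine iInf_congr fun g => iInf_congr_Prop ⟨fun hg => hg.congr h, fun hg => hg.congr h.symm⟩ ?_
    intro _
    rfl

theorem MemSobolev.congr {φ ψ : Euc d → ℝ} (h : φ =ᵐ[surf Ω] ψ) (hφ : MemSobolev Ω s φ) :
    MemSobolev Ω s ψ := by
  obtain ⟨h1, h2, h3⟩ := hφ
  refine ⟨(memLp_congr_ae h).1 h1, sobolevSeminorm_congr (s := s) h ▸ h2, fun ε hε => ?_⟩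
  obtain ⟨f, hf, hf', h4, h5⟩ := h3 ε hε
  have h6 : φ - f =ᵐ[surf Ω] ψ - f := by
    filter_upwards [h] with x hx
    simp [hx]
  exact ⟨f, hf, hf', eLpNorm_congr_ae h6 ▸ h4, sobolevSeminorm_congr (s := s) h6 ▸ h5⟩

theorem tangentialGradient_add {f g : Euc d → ℝ} (hf : ContDiff ℝ ∞ f) (hg : ContDiff ℝ ∞ g) :
    tangentialGradient Ω (f + g) = tangentialGradient Ω f + tangentialGradient Ω g := by
  funext x
  have h : gradient (f + g) x = gradient f x + gradient g x := by
    simp only [gradient]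
    rw [fderiv_add (hf.differentiable (by simp) x) (hg.differentiable (by simp) x), map_add]
  simp only [tangentialGradient, h, inner_add_left, add_smul, Pi.add_apply]
  abel

theorem tangentialGradient_smul {f : Euc d → ℝ} (c : ℝ) (hf : ContDiff ℝ ∞ f) :
    tangentialGradient Ω (c • f) = c • tangentialGradient Ω f := by
  funext x
  have h : gradient (c • f) x = c • gradient f x := by
    simp only [gradient]
    rw [fderiv_const_smul (hf.differentiable (by simp) x), map_smul]
  simp only [tangentialGradient, h, inner_smul_left, Pi.smul_apply, smul_sub, smul_smul]
  simp

theorem HasTangentialGradient.add {φ ψ : Euc d → ℝ} {g g' : Euc d → Euc d}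
    (hφ : MemLp φ 2 (surf Ω)) (hψ : MemLp ψ 2 (surf Ω))
    (h : HasTangentialGradient Ω φ g) (h' : HasTangentialGradient Ω ψ g') :
    HasTangentialGradient Ω (φ + ψ) (g + g') := by
  obtain ⟨h1, f, h2, h3, h4, h5⟩ := h
  obtain ⟨h1', f', h2', h3', h4', h5'⟩ := h'
  refine ⟨h1.add h1', fun k => f k + f' k, fun k => (h2 k).add (h2' k), fun k => ?_, ?_, ?_⟩
  · rw [tangentialGradient_add (h2 k) (h2' k)]
    exact ⟨(h3 k).1.add (h3' k).1, (h3 k).2.add (h3' k).2⟩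
  · refine tendsto_of_tendsto_of_tendsto_of_le_of_le tendsto_const_nhds
      (by simpa using h4.add h4') (fun k => zero_le) fun k => ?_
    have : f k + f' k - (φ + ψ) = (f k - φ) + (f' k - ψ) := by abel
    rw [this]
    exact eLpNorm_add_le ((h3 k).1.sub hφ).1 ((h3' k).1.sub hψ).1 (by norm_num)
  · refine tendsto_of_tendsto_of_tendsto_of_le_of_le tendsto_const_nhds
      (by simpa using h5.add h5') (fun k => zero_le) fun k => ?_
    have : tangentialGradient Ω (f k + f' k) - (g + g') =
        (tangentialGradient Ω (f k) - g) + (tangentialGradient Ω (f' k) - g') := by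
      rw [tangentialGradient_add (h2 k) (h2' k)]
      abel
    rw [this]
    exact eLpNorm_add_le ((h3 k).2.sub h1).1 ((h3' k).2.sub h1').1 (by norm_num)

theorem HasTangentialGradient.smul {φ : Euc d → ℝ} {g : Euc d → Euc d} (c : ℝ)
    (h : HasTangentialGradient Ω φ g) : HasTangentialGradient Ω (c • φ) (c • g) := by
  obtain ⟨h1, f, h2, h3, h4, h5⟩ := h
  refine ⟨h1.const_smul c, fun k => c • f k, fun k => contDiff_const.smul (h2 k), fun k => ?_,
    ?_, ?_⟩
  · rw [tangentialGradient_smul c (h2 k)]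
    exact ⟨(h3 k).1.const_smul c, (h3 k).2.const_smul c⟩
  · have : ∀ k, eLpNorm (c • f k - c • φ) 2 (surf Ω) = ‖c‖ₑ * eLpNorm (f k - φ) 2 (surf Ω) := by
      intro k
      rw [← smul_sub, eLpNorm_const_smul]
    simp only [this]
    simpa using ENNReal.Tendsto.const_mul h4 (Or.inr enorm_ne_top)
  · have : ∀ k, eLpNorm (tangentialGradient Ω (c • f k) - c • g) 2 (surf Ω) =
        ‖c‖ₑ * eLpNorm (tangentialGradient Ω (f k) - g) 2 (surf Ω) := by
      intro k
      rw [tangentialGradient_smul c (h2 k), ← smul_sub, eLpNorm_const_smul]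
    simp only [this]
    simpa using ENNReal.Tendsto.const_mul h5 (Or.inr enorm_ne_top)

theorem hasTangentialGradient_zero : HasTangentialGradient Ω (0 : Euc d → ℝ) 0 := by
  have h : tangentialGradient Ω (0 : Euc d → ℝ) = 0 := by
    funext x
    have : gradient (0 : Euc d → ℝ) x = 0 := by
      simp [gradient]
    simp [tangentialGradient, this]
  refine ⟨MemLp.zero, fun _ => 0, fun _ => contDiff_const, fun _ => ?_, ?_, ?_⟩
  · rw [h]
    exact ⟨MemLp.zero, MemLp.zero⟩
  · simp
  · simp [h]

theorem sobolevSeminorm_zero : sobolevSeminorm Ω s (0 : Euc d → ℝ) = 0 := by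
  unfold sobolevSeminorm
  split_ifs
  · rfl
  · have : gagliardoQuotient s (0 : Euc d → ℝ) = 0 := by
      funext p
      simp [gagliardoQuotient]
    simp [this]
  · exact le_antisymm ((iInf₂_le 0 hasTangentialGradient_zero).trans (by simp)) zero_le

theorem sobolevSeminorm_add_le {φ ψ : Euc d → ℝ}
    (hφ : MemLp φ 2 (surf Ω)) (hψ : MemLp ψ 2 (surf Ω)) :
    sobolevSeminorm Ω s (φ + ψ) ≤ sobolevSeminorm Ω s φ + sobolevSeminorm Ω s ψ := by
  unfold sobolevSeminorm
  split_ifs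
  · simp
  · have : gagliardoQuotient s (φ + ψ) = gagliardoQuotient s φ + gagliardoQuotient s ψ := by
      funext p
      simp only [gagliardoQuotient, Pi.add_apply]
      ring
    rw [this]
    exact eLpNorm_add_le (aestronglyMeasurable_gagliardoQuotient hφ.1)
      (aestronglyMeasurable_gagliardoQuotient hψ.1) (by norm_num)
  · simp_rw [ENNReal.iInf_add, ENNReal.add_iInf]
    refine le_iInf fun g => le_iInf fun hg => le_iInf fun g' => le_iInf fun hg' => ?_
    exact (iInf₂_le (g + g') (hg.add hφ hψ hg')).trans
      (eLpNorm_add_le hg.1.1 hg'.1.1 (by norm_num))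

theorem sobolevSeminorm_smul_le {φ : Euc d → ℝ} (c : ℝ) :
    sobolevSeminorm Ω s (c • φ) ≤ ‖c‖ₑ * sobolevSeminorm Ω s φ := by
  by_cases hc : c = 0
  · simp [hc, sobolevSeminorm_zero]
  unfold sobolevSeminorm
  split_ifs
  · simp
  · have : gagliardoQuotient s (c • φ) = c • gagliardoQuotient s φ := by
      funext p
      simp only [gagliardoQuotient, Pi.smul_apply, smul_eq_mul]
      ring
    rw [this, eLpNorm_const_smul]
  · have hc' : ‖c‖ₑ ≠ 0 := by simpa using hc
    simp_rw [ENNReal.mul_iInf_of_ne hc' enorm_ne_top]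
    refine le_iInf fun g => le_iInf fun hg => ?_
    exact (iInf₂_le (c • g) (hg.smul c)).trans (eLpNorm_const_smul c g 2 (surf Ω)).le

theorem MemSobolev.add {φ ψ : Euc d → ℝ} (hφ : MemSobolev Ω s φ) (hψ : MemSobolev Ω s ψ) :
    MemSobolev Ω s (φ + ψ) := by
  obtain ⟨h1, h2, h3⟩ := hφ
  obtain ⟨h1', h2', h3'⟩ := hψ
  refine ⟨h1.add h1', (sobolevSeminorm_add_le h1 h1').trans_lt (ENNReal.add_lt_top.2 ⟨h2, h2'⟩),
    fun ε hε => ?_⟩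
  obtain ⟨f, hf, hf', h4, h5⟩ := h3 (ε / 2) (ENNReal.half_pos hε.ne')
  obtain ⟨f', hg, hg', h4', h5'⟩ := h3' (ε / 2) (ENNReal.half_pos hε.ne')
  have : φ + ψ - (f + f') = (φ - f) + (ψ - f') := by abel
  refine ⟨f + f', hf.add hg, hf'.add hg', ?_, ?_⟩
  · rw [this, ← ENNReal.add_halves ε]
    exact (eLpNorm_add_le (h1.sub hf').1 (h1'.sub hg').1 (by norm_num)).trans (add_le_add h4 h4')
  · rw [this, ← ENNReal.add_halves ε]
    exact (sobolevSeminorm_add_le (h1.sub hf') (h1'.sub hg')).trans (add_le_add h5 h5')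

theorem memSobolev_zero : MemSobolev Ω s (0 : Euc d → ℝ) := by
  refine ⟨MemLp.zero, by simp [sobolevSeminorm_zero], fun ε _ =>
    ⟨0, contDiff_const, MemLp.zero, by simp, ?_⟩⟩
  simp [sobolevSeminorm_zero]

theorem MemSobolev.smul {φ : Euc d → ℝ} (c : ℝ) (hφ : MemSobolev Ω s φ) :
    MemSobolev Ω s (c • φ) := by
  by_cases hc : c = 0
  · rw [hc, zero_smul]
    exact memSobolev_zero
  obtain ⟨h1, h2, h3⟩ := hφ
  have hc' : ‖c‖ₑ ≠ 0 := by simpa using hc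
  refine ⟨h1.const_smul c, (sobolevSeminorm_smul_le c).trans_lt
    (ENNReal.mul_lt_top enorm_lt_top h2), fun ε hε => ?_⟩
  obtain ⟨f, hf, hf', h4, h5⟩ := h3 (ε / ‖c‖ₑ) (ENNReal.div_pos hε.ne' enorm_ne_top)
  refine ⟨c • f, contDiff_const.smul hf, hf'.const_smul c, ?_, ?_⟩
  · rw [← smul_sub, eLpNorm_const_smul]
    exact (mul_le_mul_right h4 _).trans (ENNReal.mul_div_le)
  · rw [← smul_sub]
    exact ((sobolevSeminorm_smul_le c).trans (mul_le_mul_right h5 _)).trans (ENNReal.mul_div_le)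

end SobolevLemmas

/-- The Sobolev space `H^s(∂Ω)`, as a space of classes of functions in `L²(∂Ω)`. -/
def sobolevSpace {d : ℕ} (Ω : Set (Euc d)) (s : ℝ) : Submodule ℝ (Lp ℝ 2 (surf Ω)) where
  carrier := {φ | MemSobolev Ω s φ}
  zero_mem' := memSobolev_zero.congr (Lp.coeFn_zero ℝ 2 (surf Ω)).symm
  add_mem' {φ ψ} hφ hψ := (MemSobolev.add hφ hψ).congr (Lp.coeFn_add φ ψ).symm
  smul_mem' c φ hφ := (MemSobolev.smul c hφ).congr (Lp.coeFn_smul c φ).symm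

/-- The underlying function (up to null sets) of an element of `H^s(∂Ω)`. -/
abbrev toFun {d : ℕ} {Ω : Set (Euc d)} {s : ℝ} (φ : sobolevSpace Ω s) : Euc d → ℝ :=
  (φ : Lp ℝ 2 (surf Ω))

/-- `φ ↦ b(φ, φ)` is lower semicontinuous in `H^s(∂Ω)`. -/
def IsLSC {d : ℕ} {Ω : Set (Euc d)} {s : ℝ} (b : LinearMap.BilinForm ℝ (sobolevSpace Ω s)) :
    Prop :=
  ∀ φ : sobolevSpace Ω s, ∀ ε > 0, ∃ δ > 0, ∀ ψ : sobolevSpace Ω s,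
    sobolevNorm Ω s (toFun (ψ - φ)) < δ → b φ φ - ε < b ψ ψ

/-- The bilinear form `b` on `H^s(∂Ω)` is continuous for the norm of `H^r(∂Ω)`. -/
def IsContinuousIn {d : ℕ} {Ω : Set (Euc d)} {s : ℝ} (r : ℝ)
    (b : LinearMap.BilinForm ℝ (sobolevSpace Ω s)) : Prop :=
  ∃ C : ℝ, ∀ φ ψ : sobolevSpace Ω s,
    |b φ ψ| ≤ C * sobolevNorm Ω r (toFun φ) * sobolevNorm Ω r (toFun ψ)

/-! ### Shape derivatives -/

/-- The function `𝒥(θ) = J((I+θ)(Ω))` on `Θ`. -/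
def shapeFun {d : ℕ} (J : Set (Euc d) → ℝ) (Ω : Set (Euc d)) (θ : Theta d) : ℝ :=
  J (deform θ '' Ω)

/-- `J` is twice Fréchet shape differentiable at `Ω`: `θ ↦ J((I+θ)(Ω))` is twice Fréchet
differentiable at `0`. -/
def IsTwiceShapeDifferentiableAt {d : ℕ} (J : Set (Euc d) → ℝ) (Ω : Set (Euc d)) : Prop :=
  (∀ᶠ θ in 𝓝 (0 : Theta d), DifferentiableAt ℝ (shapeFun J Ω) θ) ∧
    DifferentiableAt ℝ (fderiv ℝ (shapeFun J Ω)) 0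

/-- The shape gradient of `J` vanishes at `Ω`. -/
def IsCritical {d : ℕ} (J : Set (Euc d) → ℝ) (Ω : Set (Euc d)) : Prop :=
  HasFDerivAt (shapeFun J Ω) (0 : Theta d →L[ℝ] ℝ) 0

/-- The normal component `θ · n` of a field on `∂Ω`. -/
def normalTrace {d : ℕ} (Ω : Set (Euc d)) (θ : Theta d) (x : Euc d) : ℝ :=
  ⟪θ x, outerNormal Ω x⟫

/-- The field `θ` is normal on `∂Ω`: its tangential component vanishes there. -/
def IsNormalField {d : ℕ} (Ω : Set (Euc d)) (θ : Theta d) : Prop :=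
  ∀ x ∈ frontier Ω, θ x = normalTrace Ω θ x • outerNormal Ω x

/-- `b` is the shape hessian `ℓ₂` of `J` at `Ω`, extended to `H^s(∂Ω)`: the second derivative of
`θ ↦ J((I+θ)(Ω))` at `0` is `(ξ, ζ) ↦ b(ξ · n, ζ · n)` on fields without tangential component on
`∂Ω`. (The normal components of such fields are all `C³` functions on `∂Ω`. For general fields the
second derivative contains further terms, which involve the tangential components of the fields
and the shape gradient only.) -/
def IsShapeHessian {d : ℕ} (J : Set (Euc d) → ℝ) (Ω : Set (Euc d)) {s : ℝ}
    (b : LinearMap.BilinForm ℝ (sobolevSpace Ω s)) : Prop :=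
  ∀ ξ ζ : Theta d, IsNormalField Ω ξ → IsNormalField Ω ζ →
    ∀ φ ψ : sobolevSpace Ω s, toFun φ =ᵐ[surf Ω] normalTrace Ω ξ →
      toFun ψ =ᵐ[surf Ω] normalTrace Ω ζ →
        fderiv ℝ (fderiv ℝ (shapeFun J Ω)) 0 ξ ζ = b φ ψ

/-- The condition `C_{H^s}` at `Ω`. For a small field `θ` that is normal on `∂Ω` one has
`(I+θ)(Ω) = Ω₁` and `(I+tθ)(Ω) = Ω_t`, the domain with boundary `{x + t h(x) n(x) | x ∈ ∂Ω}`,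
where `h = θ · n`; and `j(t) = J(Ω_t)`. -/
def ConditionC {d : ℕ} (J : Set (Euc d) → ℝ) (Ω : Set (Euc d)) (s : ℝ) : Prop :=
  ∃ η > 0, ∃ m : ℝ → ℝ, Tendsto m (𝓝[>] 0) (𝓝 0) ∧
    ∀ θ : Theta d, ‖θ‖ ≤ η → IsNormalField Ω θ → ∀ t ∈ Icc (0 : ℝ) 1,
      |iteratedDeriv 2 (fun τ : ℝ => J (deform (τ • θ) '' Ω)) t -
        iteratedDeriv 2 (fun τ : ℝ => J (deform (τ • θ) '' Ω)) 0| ≤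
          m ‖θ‖ * sobolevNorm Ω s (normalTrace Ω θ) ^ 2

/-- `∂Ω₂ = {x + h(x) n(x) | x ∈ ∂Ω₁}` with `|h| < r` on `∂Ω₁`. -/
def IsNormalGraph {d : ℕ} (Ω₁ Ω₂ : Set (Euc d)) (r : ℝ) (h : Euc d → ℝ) : Prop :=
  (∀ x ∈ frontier Ω₁, |h x| < r) ∧
    frontier Ω₂ = (fun x => x + h x • outerNormal Ω₁ x) '' frontier Ω₁

end

end ShapeStability

open ShapeStability

/-! The theorem follows from a second order Taylor expansion along a path of normal deformations,
once positivity of the hessian has been upgraded to coercivity.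

Normal graphs (`IsCollar.exists_normal_graph`). Let the new domain be the image of the old one under
I + θ, with inverse I + ψ, and let ρ be a defining function of the old domain. The point x + t n(x)
lies on the new boundary exactly when ρ vanishes at its image under I + ψ. Hadamard's lemma writes
ρ(x + t n) = t q(x, t) with q bounded below; dividing by q turns the condition into t + E(x, t) = 0
with E small in C³. A quantitative implicit function theorem solves this by a unique t = g(x), small
in C³. So ζ = g N, where N extends n, is a small field of Θ, normal on the boundary, and I + ζ
produces the same new domain.

Taylor (`exists_shape_taylor`). For j(τ) = J((I + τζ)(Ω)), criticality gives j'(0) = 0, the hessian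
gives j''(0) = ℓ₂(g, g), and condition C bounds the oscillation of j'' on [0, 1] by a small multiple
of ‖g‖² in H^{s₂}. It remains to bound ℓ₂(g, g) below by a fixed multiple of ‖g‖².

Coercivity (`IsCollar.exists_coercive`). By Baire, a lower semicontinuous quadratic form on a
Hilbert space is bounded, so the inequality for ℓm passes from smooth functions to all of H^{s₂} by
density. Interpolation bounds ℓr by a small multiple of the squared H^{s₂} norm plus a multiple of
the squared L² norm, and the L² norm is small relative to the H^{s₂} norm up to finitely many
functionals. This gives a Gårding inequality modulo finitely many functionals. If coercivity failed,
unit vectors x_n with ℓ₂(x_n, x_n) → 0 would have a weak limit a; Gårding for x_n - a forces ℓ₂(a,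
a) ≤ 0, so a = 0, which contradicts Gårding for the unit vectors x_n themselves
(`coercive_of_garding`).

The Sobolev theory this needs is built from bi-Lipschitz charts: H^s is the norm-preserving image of
a closed subspace of a product of L² spaces, H¹ embeds in the fractional spaces, and compactness is
expressed by inequalities obtained by splitting Gagliardo integrals at a small distance and by
averaging over small balls. -/

/-! ### Coercivity of quadratic forms on Hilbert spaces -/

section AbstractCoercivity

/-- A bilinear form with bounded diagonal has a bounded symmetrization. -/
theorem exists_symmetrization {H : Type*} [NormedAddCommGroup H] [InnerProductSpace ℝ H]
    (b : LinearMap.BilinForm ℝ H) (M : ℝ)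
    (hM : ∀ x, |b x x| ≤ M * ‖x‖ ^ 2) :
    ∃ B : H →L[ℝ] H →L[ℝ] ℝ, (∀ x, B x x = b x x) ∧ ∀ x y, B x y = B y x := by
  let s : LinearMap.BilinForm ℝ H := (1 / 2 : ℝ) • (b + b.flip)
  have hs : ∀ x y, s x y = (1 / 2) * (b x y + b y x) := fun x y => by
    simp [s]
    ring
  have h1 : ∀ x y, |s x y| ≤ M / 2 * (‖x‖ ^ 2 + ‖y‖ ^ 2) := by
    intro x y
    -- Polarization expresses the symmetrized form by diagonal values, the only ones that are
    -- controlled.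
    have e : s x y = (1 / 4) * (b (x + y) (x + y) - b (x - y) (x - y)) := by
      rw [hs]
      simp only [map_add, map_sub, LinearMap.add_apply, LinearMap.sub_apply]
      ring
    have p := parallelogram_law_with_norm ℝ x y
    have h3 := abs_le.1 (hM (x + y))
    have h4 := abs_le.1 (hM (x - y))
    have p' : M * ‖x + y‖ ^ 2 + M * ‖x - y‖ ^ 2 = 2 * M * (‖x‖ ^ 2 + ‖y‖ ^ 2) := by
      linear_combination M * p
    rw [e, abs_le]
    constructor <;> linarith [h3.1, h3.2, h4.1, h4.2]
  have h2 : ∀ x y, ‖s x y‖ ≤ M * ‖x‖ * ‖y‖ := by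
    intro x y
    rcases eq_or_ne x 0 with rfl | hx
    · simp
    rcases eq_or_ne y 0 with rfl | hy
    · simp
    have hx' : 0 < ‖x‖ := norm_pos_iff.2 hx
    have hy' : 0 < ‖y‖ := norm_pos_iff.2 hy
    -- At unit vectors the sum of squares in `h1` is 2, so the bound there is exactly M.
    have h := h1 (‖x‖⁻¹ • x) (‖y‖⁻¹ • y)
    rw [norm_smul, norm_smul, norm_inv, norm_inv, norm_norm, norm_norm, inv_mul_cancel₀ hx'.ne',
      inv_mul_cancel₀ hy'.ne'] at h
    simp only [map_smul, LinearMap.smul_apply, smul_eq_mul, abs_mul, abs_inv, abs_norm] at h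
    rw [Real.norm_eq_abs]
    have e : |s x y| = ‖x‖ * ‖y‖ * (‖y‖⁻¹ * (‖x‖⁻¹ * |s x y|)) := by
      field_simp
    rw [e]
    have h' : ‖y‖⁻¹ * (‖x‖⁻¹ * |s x y|) ≤ M := by linarith
    nlinarith [mul_le_mul_of_nonneg_left h' (mul_pos hx' hy').le]
  refine ⟨LinearMap.mkContinuous₂ s M h2, fun x => ?_, fun x y => ?_⟩
  · rw [LinearMap.mkContinuous₂_apply, hs]
    ring
  · rw [LinearMap.mkContinuous₂_apply, LinearMap.mkContinuous₂_apply, hs, hs]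
    ring

variable {H : Type*} [NormedAddCommGroup H] [InnerProductSpace ℝ H] [CompleteSpace H]

/-- Bounded sequences in a Hilbert space converge weakly along an ultrafilter. -/
theorem exists_weak_limit_hyperfilter (x : ℕ → H) (hx : ∀ n, ‖x n‖ ≤ 1) :
    ∃ a : H, ∀ f : H →L[ℝ] ℝ,
      Tendsto (fun n => f (x n)) (hyperfilter ℕ : Filter ℕ) (𝓝 (f a)) := by
  let y : ℕ → WeakDual ℝ H := fun n => StrongDual.toWeakDual (InnerProductSpace.toDual ℝ H (x n))
  -- Banach–Alaoglu in the dual, carried to H by the Riesz isomorphism. Following an ultrafilter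
  -- instead of a subsequence makes separability of H irrelevant.
  have hK := WeakDual.isCompact_closedBall (𝕜 := ℝ) (E := H) 0 1
  have hy : ∀ n, y n ∈ WeakDual.toStrongDual ⁻¹' Metric.closedBall (0 : StrongDual ℝ H) 1 := by
    intro n
    simpa [y] using hx n
  obtain ⟨φ, -, hφ⟩ := isCompact_iff_ultrafilter_le_nhds.1 hK ((hyperfilter ℕ).map y)
    (by
      rw [Ultrafilter.coe_map, le_principal_iff]
      exact Filter.mem_map.2 (Filter.univ_mem' hy))
  have hφ' : Tendsto y (hyperfilter ℕ : Filter ℕ) (𝓝 φ) := by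
    simpa [Tendsto] using hφ
  refine ⟨(InnerProductSpace.toDual ℝ H).symm (WeakDual.toStrongDual φ), fun f => ?_⟩
  set v := (InnerProductSpace.toDual ℝ H).symm f with hv
  have hf : ∀ z, f z = ⟪z, v⟫ := by
    intro z
    rw [real_inner_comm, hv, InnerProductSpace.toDual_symm_apply]
  have h1 := ((WeakDual.eval_continuous v).tendsto φ).comp hφ'
  have h2 : (fun n => f (x n)) = (fun ψ : WeakDual ℝ H => ψ v) ∘ y := by
    funext n
    simp [y, hf]
  rw [h2, hf, InnerProductSpace.toDual_symm_apply]
  exact h1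

/-- A lower semicontinuous quadratic form on a Hilbert space is bounded. -/
theorem bounded_of_lsc (m : LinearMap.BilinForm ℝ H)
    (hlsc : ∀ x, ∀ ε > 0, ∃ δ > 0, ∀ y, ‖y - x‖ < δ → m x x - ε < m y y) :
    ∃ M, ∀ x, |m x x| ≤ M * ‖x‖ ^ 2 := by
  have hsc : ∀ (t : ℝ) x, m (t • x) (t • x) = t ^ 2 * m x x := by
    intro t x
    simp only [map_smul, LinearMap.smul_apply, smul_eq_mul]
    ring
  -- By homogeneity, a bound on a ball gives a quadratic bound; rescaling to norm δ / 2 produces the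
  -- factor 4.
  have hscale : ∀ (g : H → ℝ) (δ K : ℝ), 0 < δ → (∀ (t : ℝ) x, g (t • x) = t ^ 2 * g x) →
      (∀ x, ‖x‖ < δ → g x ≤ K) → ∀ x, g x ≤ (4 * K / δ ^ 2) * ‖x‖ ^ 2 := by
    intro g δ K hδ hg h x
    rcases eq_or_ne x 0 with rfl | hx
    · have := hg 0 0
      simp at this
      simp [this]
    have hx' : 0 < ‖x‖ := norm_pos_iff.2 hx
    have h1 := h ((δ / 2 * ‖x‖⁻¹) • x) (by
      rw [norm_smul, norm_mul, norm_inv, norm_norm, Real.norm_of_nonneg (by positivity), mul_assoc,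
        inv_mul_cancel₀ hx'.ne']
      linarith)
    rw [hg] at h1
    have e : g x = 4 * ((δ / 2 * ‖x‖⁻¹) ^ 2 * g x) / δ ^ 2 * ‖x‖ ^ 2 := by
      field_simp
      ring
    rw [e]
    gcongr
  obtain ⟨δ, hδ, h0⟩ := hlsc 0 1 one_pos
  have hlow : ∀ x, -(m x x) ≤ (4 * 1 / δ ^ 2) * ‖x‖ ^ 2 := by
    refine hscale (fun x => -(m x x)) δ 1 hδ (fun t x => by simp only [hsc]; ring) ?_
    intro x hx
    have := h0 x (by simpa using hx)
    simp at this
    linarith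
  have hclosed : ∀ k : ℕ, IsClosed {x | m x x ≤ k} := by
    intro k
    rw [← isOpen_compl_iff, Metric.isOpen_iff]
    intro x hx
    have hx' : (k : ℝ) < m x x := by simpa using hx
    obtain ⟨δ', hδ', h⟩ := hlsc x (m x x - k) (by linarith)
    refine ⟨δ', hδ', fun y hy => ?_⟩
    have := h y (by simpa [dist_eq_norm] using hy)
    simp only [mem_compl_iff, mem_ofPred_eq, not_le]
    linarith
  -- Baire: the closed sublevel sets exhaust H, so one of them contains a ball.
  obtain ⟨k, x₀, hx₀⟩ := nonempty_interior_of_iUnion_of_closed hclosed (by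
    ext x
    simp only [mem_iUnion, mem_ofPred_eq, mem_univ, iff_true]
    exact exists_nat_ge _)
  obtain ⟨δ', hδ', hball⟩ := Metric.isOpen_iff.1 isOpen_interior x₀ hx₀
  set A := 4 * 1 / δ ^ 2
  have hup : ∀ x, m x x ≤ (4 * (k + A * ‖x₀‖ ^ 2) / δ' ^ 2) * ‖x‖ ^ 2 := by
    refine hscale (fun x => m x x) δ' _ hδ' hsc ?_
    intro y hy
    have h1 : m (x₀ + y) (x₀ + y) ≤ k := by
      have : x₀ + y ∈ Metric.ball x₀ δ' := by simpa [dist_eq_norm] using hy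
      have h := interior_subset (hball this)
      exact h
    have h2 : m (x₀ - y) (x₀ - y) ≤ k := by
      have : x₀ - y ∈ Metric.ball x₀ δ' := by simpa [dist_eq_norm] using hy
      have h := interior_subset (hball this)
      exact h
    have h3 := hlow x₀
    -- The parallelogram identity moves the upper bound from a ball at x₀ to one at the origin; the
    -- lower bound already obtained controls the value at x₀.
    have e : m (x₀ + y) (x₀ + y) + m (x₀ - y) (x₀ - y) = 2 * m x₀ x₀ + 2 * m y y := by
      simp only [map_add, map_sub, LinearMap.add_apply, LinearMap.sub_apply]
      ring
    linarith
  refine ⟨max A (4 * (k + A * ‖x₀‖ ^ 2) / δ' ^ 2), fun x => abs_le.2 ⟨?_, ?_⟩⟩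
  · have := hlow x
    have := mul_le_mul_of_nonneg_right (le_max_left A (4 * (k + A * ‖x₀‖ ^ 2) / δ' ^ 2))
      (sq_nonneg ‖x‖)
    linarith
  · exact (hup x).trans (mul_le_mul_of_nonneg_right (le_max_right _ _) (sq_nonneg _))

/-- A bounded quadratic form that is positive off `0` and coercive up to finitely many functionals
is coercive. -/
theorem coercive_of_garding (B : H →L[ℝ] H →L[ℝ] ℝ) (hsymm : ∀ x y, B x y = B y x)
    (c : ℝ) (hc : 0 < c) {k : ℕ} (f : Fin k → H →L[ℝ] ℝ)
    (hG : ∀ x, c * ‖x‖ ^ 2 ≤ B x x + ∑ i, (f i x) ^ 2) (hpos : ∀ x, x ≠ 0 → 0 < B x x) :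
    ∃ c' > 0, ∀ x, c' * ‖x‖ ^ 2 ≤ B x x := by
  by_contra! hcon
  have h1 : ∀ n : ℕ, ∃ x : H, ‖x‖ = 1 ∧ B x x < 1 / ((n : ℝ) + 1) := by
    intro n
    obtain ⟨x, hx⟩ := hcon (1 / ((n : ℝ) + 1)) (by positivity)
    have hx0 : x ≠ 0 := by
      rintro rfl
      simp at hx
    have hx' : 0 < ‖x‖ := norm_pos_iff.2 hx0
    refine ⟨‖x‖⁻¹ • x, norm_smul_inv_norm (𝕜 := ℝ) hx0, ?_⟩
    simp only [map_smul, smul_apply, smul_eq_mul]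
    rw [← mul_assoc, ← mul_inv, ← sq, inv_mul_lt_iff₀ (by positivity)]
    linarith
  choose x hx1 hxB using h1
  obtain ⟨a, ha⟩ := exists_weak_limit_hyperfilter x (fun n => (hx1 n).le)
  have hle : (hyperfilter ℕ : Filter ℕ) ≤ atTop := Nat.hyperfilter_le_atTop
  -- The inequality is applied to x_n - a, not x_n: the terms linear in x_n then pass to the weak
  -- limit, and weak lower semicontinuity of B is not needed.
  have hexp : ∀ n, c * ‖x n - a‖ ^ 2 ≤
      1 / ((n : ℝ) + 1) - 2 * B a (x n) + B a a + ∑ i, (f i (x n) - f i a) ^ 2 := by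
    intro n
    have := hG (x n - a)
    simp only [map_sub, sub_apply] at this
    rw [hsymm (x n) a] at this
    linarith [hxB n]
  have hlim : Tendsto (fun n : ℕ => 1 / ((n : ℝ) + 1) - 2 * B a (x n) + B a a +
      ∑ i, (f i (x n) - f i a) ^ 2) (hyperfilter ℕ : Filter ℕ) (𝓝 (-(B a a))) := by
    have t1 := (tendsto_one_div_add_atTop_nhds_zero_nat (𝕜 := ℝ)).mono_left hle
    have t2 := ((ha (B a)).const_mul 2)
    have t3 : Tendsto (fun n => ∑ i, (f i (x n) - f i a) ^ 2) (hyperfilter ℕ : Filter ℕ)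
        (𝓝 (∑ _i : Fin k, (0 : ℝ))) := by
      refine tendsto_finsetSum _ fun i _ => ?_
      have := ((ha (f i)).sub_const (f i a)).pow 2
      simpa using this
    have := ((t1.sub t2).add_const (B a a)).add t3
    convert! this using 2
    simp
    ring
  have hBa : B a a ≤ 0 := by
    have : 0 ≤ -(B a a) := ge_of_tendsto' hlim fun n => le_trans (by positivity) (hexp n)
    linarith
  have ha0 : a = 0 := by
    by_contra h
    exact absurd (hpos a h) (not_lt.2 hBa)
  -- With a = 0 the left side of `hexp` stays equal to c, since the x_n are unit vectors.
  have : c ≤ -(B a a) := by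
    refine ge_of_tendsto' hlim fun n => ?_
    have := hexp n
    rw [ha0, sub_zero, hx1 n] at this
    rw [ha0]
    linarith
  rw [ha0] at this
  simp at this
  linarith

/-- Coercivity of a positive form `m + r` with `m` lower semicontinuous and coercive up to a compact
perturbation, and `r` compact. -/
theorem coercive_of_lsc_add_compact {L : Type*} [NormedAddCommGroup L] [NormedSpace ℝ L]
    (ι : H →L[ℝ] L) (m r : LinearMap.BilinForm ℝ H)
    (hlsc : ∀ x, ∀ ε > 0, ∃ δ > 0, ∀ y, ‖y - x‖ < δ → m x x - ε < m y y)
    (D : Set H) (hD : Dense D) (c : ℝ) (hc : 0 < c)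
    (hm : ∀ x ∈ D, c * (‖x‖ ^ 2 - ‖ι x‖ ^ 2) ≤ m x x)
    (hr : ∀ ε > 0, ∃ K, ∀ x, |r x x| ≤ ε * ‖x‖ ^ 2 + K * ‖ι x‖ ^ 2)
    (hι : ∀ ε > 0, ∃ (k : ℕ) (f : Fin k → H →L[ℝ] ℝ), ∀ x,
      ‖ι x‖ ^ 2 ≤ ε * ‖x‖ ^ 2 + ∑ i, (f i x) ^ 2)
    (hpos : ∀ x, x ≠ 0 → 0 < (m + r) x x) :
    ∃ c' > 0, ∀ x, c' * ‖x‖ ^ 2 ≤ (m + r) x x := by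
  obtain ⟨M, hM⟩ := bounded_of_lsc m hlsc
  obtain ⟨Bm, hBm, -⟩ := exists_symmetrization m M hM
  -- Boundedness of m is what makes the inequality a closed condition, so that it extends from the
  -- dense set.
  have hm' : ∀ x, c * (‖x‖ ^ 2 - ‖ι x‖ ^ 2) ≤ m x x := by
    intro x
    have hcl : IsClosed {x | c * (‖x‖ ^ 2 - ‖ι x‖ ^ 2) ≤ Bm x x} :=
      isClosed_le (by fun_prop) (by fun_prop)
    have := hcl.closure_subset_iff.2 (fun y hy => by
      simpa [hBm] using hm y hy : D ⊆ _) (hD x)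
    simpa [hBm] using this
  have hιb : ∀ x, ‖ι x‖ ^ 2 ≤ ‖ι‖ ^ 2 * ‖x‖ ^ 2 := fun x => by
    rw [← mul_pow]
    exact pow_le_pow_left₀ (norm_nonneg _) (ι.le_opNorm x) 2
  -- Budget: m provides c‖x‖², half of which absorbs r. What is left is c/2 ‖x‖² minus (c + |K|)‖ι
  -- x‖².
  obtain ⟨K, hK⟩ := hr (c / 2) (by positivity)
  have hK' : ∀ x, |r x x| ≤ c / 2 * ‖x‖ ^ 2 + |K| * ‖ι x‖ ^ 2 := fun x =>
    (hK x).trans (by gcongr; exact le_abs_self K)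
  obtain ⟨B, hB, hBs⟩ := exists_symmetrization (m + r) (M + (c / 2 + |K| * ‖ι‖ ^ 2)) (by
    intro x
    have h1 := hM x
    have h2 := hK' x
    have h3 := mul_le_mul_of_nonneg_left (hιb x) (abs_nonneg K)
    have h4 : |(m + r) x x| ≤ |m x x| + |r x x| := by
      simpa using abs_add_le (m x x) (r x x)
    nlinarith)
  -- After multiplication by c + |K| the error is c/4 ‖x‖², so c/4 survives in the Gårding
  -- inequality; the square root below puts the same factor into the functionals.
  obtain ⟨k, f, hs⟩ := hι (c / (4 * (c + |K|))) (by positivity)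
  have hcK : 0 < c + |K| := by positivity
  have hS : ∀ x, ∑ i, ((Real.sqrt (c + |K|) • f i) x) ^ 2 = (c + |K|) * ∑ i, (f i x) ^ 2 := by
    intro x
    rw [Finset.mul_sum]
    refine Finset.sum_congr rfl fun i _ => ?_
    simp only [smul_apply, smul_eq_mul, mul_pow, Real.sq_sqrt hcK.le]
  obtain ⟨c', hc', h⟩ := coercive_of_garding B hBs (c / 4) (by positivity)
    (fun i => Real.sqrt (c + |K|) • f i) (by
    intro x
    rw [hS, hB]
    have h1 := hm' x
    have h2 := (abs_le.1 (hK' x)).1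
    have h3 := mul_le_mul_of_nonneg_left (hs x) hcK.le
    have h4 : (c + |K|) * (c / (4 * (c + |K|)) * ‖x‖ ^ 2 + ∑ i, (f i x) ^ 2) =
        c / 4 * ‖x‖ ^ 2 + (c + |K|) * ∑ i, (f i x) ^ 2 := by
      field_simp
    rw [h4] at h3
    have h5 : (m + r) x x = m x x + r x x := rfl
    rw [h5]
    nlinarith) (fun x hx => by rw [hB]; exact hpos x hx)
  exact ⟨c', hc', fun x => by rw [← hB]; exact h x⟩

end AbstractCoercivity

/-! ### Quantitative C^k calculus and the implicit function theorem -/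

section BoundedDerivatives

universe u

variable {E F G V : Type*} [NormedAddCommGroup V] [NormedSpace ℝ V]
  [NormedAddCommGroup E] [NormedSpace ℝ E] [NormedAddCommGroup F]
  [NormedSpace ℝ F] [NormedAddCommGroup G] [NormedSpace ℝ G]

/-- `f` is of class `C^k`, with all derivatives of order at most `k` bounded by `C`. -/
def CkBounded (k : ℕ) (C : ℝ) (f : E → F) : Prop :=
  ContDiff ℝ k f ∧ ∀ i ≤ k, ∀ x, ‖iteratedFDeriv ℝ i f x‖ ≤ C

/-- `f` is of class `C^k`, with all derivatives of positive order at most `k` bounded by `C`. -/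
def DerivBounded (k : ℕ) (C : ℝ) (f : E → F) : Prop :=
  ContDiff ℝ k f ∧ ∀ i, 1 ≤ i → i ≤ k → ∀ x, ‖iteratedFDeriv ℝ i f x‖ ≤ C

theorem CkBounded.derivBounded {k : ℕ} {C : ℝ} {f : E → F} (h : CkBounded k C f) :
    DerivBounded k C f := ⟨h.1, fun i _ hi => h.2 i hi⟩

theorem CkBounded.mono {k : ℕ} {C C' : ℝ} {f : E → F} (h : CkBounded k C f) (hC : C ≤ C') :
    CkBounded k C' f := ⟨h.1, fun i hi x => (h.2 i hi x).trans hC⟩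

theorem CkBounded.of_le {k l : ℕ} {C : ℝ} {f : E → F} (h : CkBounded k C f) (hl : l ≤ k) :
    CkBounded l C f := ⟨h.1.of_le (by exact_mod_cast hl), fun i hi x => h.2 i (hi.trans hl) x⟩

theorem DerivBounded.of_le {k l : ℕ} {C : ℝ} {f : E → F} (h : DerivBounded k C f) (hl : l ≤ k) :
    DerivBounded l C f :=
  ⟨h.1.of_le (by exact_mod_cast hl), fun i hi hi' x => h.2 i hi (hi'.trans hl) x⟩

theorem DerivBounded.mono {k : ℕ} {C C' : ℝ} {f : E → F} (h : DerivBounded k C f) (hC : C ≤ C') :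
    DerivBounded k C' f := ⟨h.1, fun i hi hi' x => (h.2 i hi hi' x).trans hC⟩

theorem CkBounded.norm_le {k : ℕ} {C : ℝ} {f : E → F} (h : CkBounded k C f) (x : E) :
    ‖f x‖ ≤ C := by
  simpa using h.2 0 (Nat.zero_le k) x

theorem CkBounded.nonneg {k : ℕ} {C : ℝ} {f : E → F} (h : CkBounded k C f) : 0 ≤ C :=
  (norm_nonneg _).trans (h.norm_le 0)

theorem CkBounded.norm_fderiv_le {k : ℕ} {C : ℝ} {f : E → F} (h : CkBounded (k + 1) C f) (x : E) :
    ‖fderiv ℝ f x‖ ≤ C := by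
  have := h.2 1 (by omega) x
  rwa [norm_iteratedFDeriv_one] at this

theorem ckBounded_zero_iff {C : ℝ} {f : E → F} :
    CkBounded 0 C f ↔ Continuous f ∧ ∀ x, ‖f x‖ ≤ C := by
  constructor
  · intro h
    exact ⟨h.1.continuous, h.norm_le⟩
  · rintro ⟨h1, h2⟩
    refine ⟨by simpa using h1, fun i hi x => ?_⟩
    obtain rfl : i = 0 := by omega
    simpa using h2 x

/-- D^{i+1} f and D^i (D f) have equal norms, so the same constant serves on both sides; the
inductions on k run on this equivalence. -/
theorem ckBounded_succ_iff {k : ℕ} {C : ℝ} {f : E → F} :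
    CkBounded (k + 1) C f ↔
      (∀ x, ‖f x‖ ≤ C) ∧ Differentiable ℝ f ∧ CkBounded k C (fderiv ℝ f) := by
  constructor
  · intro h
    have h1 : ContDiff ℝ ((k : WithTop ℕ∞) + 1) f := by exact_mod_cast h.1
    rw [contDiff_succ_iff_fderiv] at h1
    exact ⟨h.norm_le, h1.1, h1.2.2, fun i hi x => by
      rw [norm_iteratedFDeriv_fderiv]
      exact h.2 (i + 1) (by omega) x⟩
  · rintro ⟨h1, h2, h3⟩
    have h4 : ContDiff ℝ ((k : WithTop ℕ∞) + 1) f := by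
      rw [contDiff_succ_iff_fderiv]
      exact ⟨h2, by simp, h3.1⟩
    refine ⟨by exact_mod_cast h4, fun i hi x => ?_⟩
    rcases i with _ | i
    · simpa using h1 x
    · rw [← norm_iteratedFDeriv_fderiv]
      exact h3.2 i (by omega) x

/-- Inner maps of compositions, such as I + ψ, are unbounded, but their derivative is bounded. -/
theorem DerivBounded.fderiv {k : ℕ} {C : ℝ} {f : E → F} (h : DerivBounded (k + 1) C f) :
    CkBounded k C (fderiv ℝ f) := by
  have h1 : ContDiff ℝ ((k : WithTop ℕ∞) + 1) f := by exact_mod_cast h.1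
  rw [contDiff_succ_iff_fderiv] at h1
  exact ⟨h1.2.2, fun i hi x => by
    rw [norm_iteratedFDeriv_fderiv]
    exact h.2 (i + 1) (by omega) (by omega) x⟩

theorem CkBounded.add {k : ℕ} {C D : ℝ} {f g : E → F} (hf : CkBounded k C f)
    (hg : CkBounded k D g) : CkBounded k (C + D) (f + g) := by
  refine ⟨hf.1.add hg.1, fun i hi x => ?_⟩
  have hi' : ((i : ℕ) : WithTop ℕ∞) ≤ k := by exact_mod_cast hi
  rw [iteratedFDeriv_add (hf.1.of_le hi') (hg.1.of_le hi')]
  exact (norm_add_le _ _).trans (add_le_add (hf.2 i hi x) (hg.2 i hi x))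

theorem DerivBounded.add {k : ℕ} {C D : ℝ} {f g : E → F} (hf : DerivBounded k C f)
    (hg : DerivBounded k D g) : DerivBounded k (C + D) (f + g) := by
  refine ⟨hf.1.add hg.1, fun i hi0 hi x => ?_⟩
  have hi' : ((i : ℕ) : WithTop ℕ∞) ≤ k := by exact_mod_cast hi
  rw [iteratedFDeriv_add (hf.1.of_le hi') (hg.1.of_le hi')]
  exact (norm_add_le _ _).trans (add_le_add (hf.2 i hi0 hi x) (hg.2 i hi0 hi x))

/-- Leibniz's formula; the binomial coefficients of order i sum to 2^i ≤ 2^k. -/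
theorem CkBounded.bilinear {k : ℕ} {C D : ℝ}
    (B : E →L[ℝ] F →L[ℝ] G) (hB : ‖B‖ ≤ 1) {f : V → E} {g : V → F} (hf : CkBounded k C f)
    (hg : CkBounded k D g) : CkBounded k (2 ^ k * (C * D)) (fun x => B (f x) (g x)) := by
  refine ⟨(B.contDiff.comp hf.1).clm_apply hg.1, fun i hi x => ?_⟩
  refine (B.norm_iteratedFDeriv_le_of_bilinear_of_le_one hf.1 hg.1 x (by exact_mod_cast hi)
    hB).trans ?_
  have hC := hf.nonneg
  have hD := hg.nonneg
  calc ∑ j ∈ Finset.range (i + 1),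
        (i.choose j : ℝ) * ‖iteratedFDeriv ℝ j f x‖ * ‖iteratedFDeriv ℝ (i - j) g x‖
      ≤ ∑ j ∈ Finset.range (i + 1), (i.choose j : ℝ) * (C * D) := by
        refine Finset.sum_le_sum fun j hj => ?_
        rw [Finset.mem_range] at hj
        rw [mul_assoc]
        gcongr
        · exact hf.2 j (by omega) x
        · exact hg.2 (i - j) (by omega) x
    _ = 2 ^ i * (C * D) := by
        rw [← Finset.sum_mul]
        congr 1
        exact_mod_cast Nat.sum_range_choose i
    _ ≤ 2 ^ k * (C * D) := by
        gcongr
        norm_num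

theorem CkBounded.smul {k : ℕ} {C D : ℝ} {f : E → ℝ} {g : E → F} (hf : CkBounded k C f)
    (hg : CkBounded k D g) : CkBounded k (2 ^ k * (C * D)) (fun x => f x • g x) :=
  CkBounded.bilinear (ContinuousLinearMap.lsmul ℝ ℝ) ContinuousLinearMap.opNorm_lsmul_le hf hg

/-- Faà di Bruno. The underlying estimate asks for the j-th derivative of the inner map to be at
most D^j; a single bound D suffices because D ≥ 1. -/
theorem CkBounded.comp {k : ℕ} {C D : ℝ} {g : F → G} {f : E → F} (hg : CkBounded k C g)
    (hf : DerivBounded k D f) (hD : 1 ≤ D) :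
    CkBounded k (k.factorial * C * D ^ k) (g ∘ f) := by
  refine ⟨hg.1.comp hf.1, fun i hi x => ?_⟩
  have hC := hg.nonneg
  refine (norm_iteratedFDeriv_comp_le hg.1 hf.1 (by exact_mod_cast hi) x
    (C := C) (D := D) (fun j hj => hg.2 j (hj.trans hi) _) (fun j h1 hj => ?_)).trans ?_
  · exact (hf.2 j h1 (hj.trans hi) x).trans (le_self_pow₀ hD (by omega))
  · gcongr

theorem derivBounded_of_hasFDerivAt_const {k : ℕ} {C : ℝ} {f : E → F} (L : E →L[ℝ] F)
    (hL : ‖L‖ ≤ C) (hf : ∀ x, HasFDerivAt f L x) : DerivBounded k C f := by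
  have h : fderiv ℝ f = fun _ => L := funext fun x => (hf x).fderiv
  have hd : Differentiable ℝ f := fun x => (hf x).differentiableAt
  have hc : ContDiff ℝ ((k : WithTop ℕ∞) + 1) f := by
    rw [contDiff_succ_iff_fderiv, h]
    exact ⟨hd, by simp, contDiff_const⟩
  refine ⟨hc.of_le (by simp), fun i hi _ x => ?_⟩
  obtain ⟨j, rfl⟩ : ∃ j, i = j + 1 := ⟨i - 1, by omega⟩
  rw [← norm_iteratedFDeriv_fderiv, h]
  rcases j with _ | j
  · simpa using hL
  · rw [iteratedFDeriv_const_of_ne (by omega)]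
    simpa using (norm_nonneg L).trans hL

theorem ContinuousLinearMap.derivBounded {k : ℕ} {C : ℝ} (L : E →L[ℝ] F) (hL : ‖L‖ ≤ C) :
    DerivBounded k C L :=
  derivBounded_of_hasFDerivAt_const L hL fun _ => L.hasFDerivAt

theorem ckBounded_clm_comp {k : ℕ} {C : ℝ} {f : E → F} (L : F →L[ℝ] G) (hL : ‖L‖ ≤ 1)
    (hf : CkBounded k C f) : CkBounded k C (fun x => L (f x)) := by
  refine ⟨L.contDiff.comp hf.1, fun i hi x => ?_⟩
  refine (L.norm_iteratedFDeriv_comp_left hf.1.contDiffAt (by exact_mod_cast hi)).trans ?_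
  have := hf.2 i hi x
  nlinarith [norm_nonneg (iteratedFDeriv ℝ i f x), norm_nonneg L]

/-- Perturbing the inner function by a `C^k`-small map changes a composition by a `C^k`-small
map. -/
theorem exists_ckBounded_comp_add_sub (k : ℕ) (C D : ℝ) (hC : 0 ≤ C) (hD : 1 ≤ D) :
    ∃ M, 0 ≤ M ∧ ∀ {E F G : Type u} [NormedAddCommGroup E] [NormedSpace ℝ E] [NormedAddCommGroup F]
      [NormedSpace ℝ F] [NormedAddCommGroup G] [NormedSpace ℝ G] (g : F → G) (f φ : E → F) (ε : ℝ),
      CkBounded (k + 1) C g → DerivBounded k D f → CkBounded k ε φ → ε ≤ 1 →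
      CkBounded k (M * ε) (fun x => g (f x + φ x) - g (f x)) := by
  -- The induction applies the statement to the derivative of g, with values in another space; hence
  -- M is chosen before the spaces.
  induction k with
  | zero =>
    refine ⟨C, hC, fun {E F G} _ _ _ _ _ _ g f φ ε hg hf hφ _ => ?_⟩
    rw [ckBounded_zero_iff]
    have hgc := hg.1.continuous
    have hfc := hf.1.continuous
    have hφc := hφ.1.continuous
    refine ⟨by fun_prop, fun x => ?_⟩
    have := Convex.norm_image_sub_le_of_norm_fderiv_le (f := g) (C := C) (s := univ)
      (x := f x) (y := f x + φ x)
      (fun y _ => hg.1.differentiable (by simp) y) (fun y _ => hg.norm_fderiv_le y) convex_univ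
      (mem_univ _) (mem_univ _)
    refine this.trans ?_
    rw [add_sub_cancel_left]
    exact mul_le_mul_of_nonneg_left (hφ.norm_le x) hC
  | succ k ih =>
    obtain ⟨M, hM, h⟩ := ih
    refine ⟨C + (2 ^ k * (M * D) + 2 ^ k * (k.factorial * C * (D + 1) ^ k)), by positivity,
      fun {E F G} _ _ _ _ _ _ g f φ ε hg hf hφ hε => ?_⟩
    have hε0 := hφ.nonneg
    have hgd : Differentiable ℝ g := hg.1.differentiable (by simp)
    have hfd : Differentiable ℝ f := hf.1.differentiable (by simp)
    have hφd : Differentiable ℝ φ := hφ.1.differentiable (by simp)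
    have hg' := (ckBounded_succ_iff.1 hg).2.2
    have hφ' := (ckBounded_succ_iff.1 hφ).2.2
    have hd : ∀ x, HasFDerivAt (fun x => g (f x + φ x) - g (f x))
        ((fderiv ℝ g (f x + φ x)).comp (fderiv ℝ f x + fderiv ℝ φ x) -
          (fderiv ℝ g (f x)).comp (fderiv ℝ f x)) x := fun x =>
      ((hgd _).hasFDerivAt.comp x ((hfd x).hasFDerivAt.add (hφd x).hasFDerivAt)).sub
        ((hgd _).hasFDerivAt.comp x (hfd x).hasFDerivAt)
    have key : CkBounded k (2 ^ k * (M * ε * D) + 2 ^ k * (k.factorial * C * (D + 1) ^ k * ε))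
        (fderiv ℝ (fun x => g (f x + φ x) - g (f x))) := by
      -- Chain rule, regrouped as (Dg(f + φ) - Dg(f)) Df + Dg(f + φ) Dφ. The first factor is small
      -- by induction, which costs one derivative of g; in the second term Dφ is small.
      have e : fderiv ℝ (fun x => g (f x + φ x) - g (f x)) =
          (fun x => ContinuousLinearMap.compL ℝ E F G
            (fderiv ℝ g (f x + φ x) - fderiv ℝ g (f x)) (fderiv ℝ f x)) +
          (fun x => ContinuousLinearMap.compL ℝ E F G
            (((fderiv ℝ g) ∘ (f + φ)) x) (fderiv ℝ φ x)) := by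
        funext x
        rw [(hd x).fderiv]
        ext v
        simp
        abel
      rw [e]
      refine CkBounded.add ?_ ?_
      · exact CkBounded.bilinear _ (ContinuousLinearMap.norm_compL_le ℝ E F G)
          (h (fderiv ℝ g) f φ ε hg' (hf.of_le (by omega)) (hφ.of_le (by omega)) hε) hf.fderiv
      · refine CkBounded.bilinear _ (ContinuousLinearMap.norm_compL_le ℝ E F G)
          (CkBounded.comp (hg'.of_le (by omega)) ?_ (by linarith)) hφ'
        exact (hf.of_le (by omega)).add ((hφ.of_le (by omega)).derivBounded.mono hε)
    rw [ckBounded_succ_iff]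
    refine ⟨fun x => ?_, fun x => (hd x).differentiableAt, key.mono ?_⟩
    · have := Convex.norm_image_sub_le_of_norm_fderiv_le (f := g) (C := C) (s := univ)
        (x := f x) (y := f x + φ x)
        (fun y _ => hgd y) (fun y _ => hg.norm_fderiv_le y) convex_univ
        (mem_univ _) (mem_univ _)
      rw [add_sub_cancel_left] at this
      refine this.trans ((mul_le_mul_of_nonneg_left (hφ.norm_le x) hC).trans ?_)
      have : 0 ≤ (2 ^ k * (M * D) + 2 ^ k * (k.factorial * C * (D + 1) ^ k)) * ε := by positivity
      linarith
    · have : 0 ≤ C * ε := by positivity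
      linarith

/-- The map `p ↦ (p.1, p.2 + e p)` is a homeomorphism when `e` is a contraction. -/
theorem exists_homeomorph_add_snd {X Y : Type*} [NormedAddCommGroup X] [NormedSpace ℝ X]
    [NormedAddCommGroup Y] [NormedSpace ℝ Y] [CompleteSpace X] [CompleteSpace Y] {n : ℕ}
    (e : X × Y → Y) (he : CkBounded (n + 1) (1 / 4) e) :
    ∃ T : X × Y ≃ₜ X × Y, (∀ p, T p = (p.1, p.2 + e p)) ∧ ContDiff ℝ (n + 1 : ℕ) T.symm := by
  have hed : Differentiable ℝ e := he.1.differentiable (by simp)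
  have hlip : ∀ p q, ‖e p - e q‖ ≤ 1 / 4 * ‖p - q‖ := fun p q =>
    Convex.norm_image_sub_le_of_norm_fderiv_le (s := univ) (fun y _ => hed y)
      (fun y _ => he.norm_fderiv_le y) convex_univ (mem_univ _) (mem_univ _)
  let f : X × Y → X × Y := fun p => (p.1, p.2 + e p)
  -- The map differs from the identity by a 1/4-Lipschitz map, so it is a homeomorphism of the whole
  -- space.
  have happ : ApproximatesLinearOn f
      ((ContinuousLinearEquiv.refl ℝ (X × Y) : (X × Y) ≃L[ℝ] (X × Y)) : X × Y →L[ℝ] X × Y) univ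
      (1 / 4) := by
    intro p _ q _
    have : f p - f q - (p - q) = (0, e p - e q) := by
      ext <;> simp [f]
      abel
    have h2 := hlip p q
    simp only [ContinuousLinearEquiv.coe_refl, ContinuousLinearMap.coe_id', id_eq, this,
      Prod.norm_def, norm_zero] at h2 ⊢
    simpa using h2
  have hN : Subsingleton (X × Y) ∨ (1 / 4 : NNReal) <
      ‖((ContinuousLinearEquiv.refl ℝ (X × Y)).symm : X × Y →L[ℝ] X × Y)‖₊⁻¹ := by
    rcases subsingleton_or_nontrivial (X × Y) with h | h
    · exact Or.inl h
    · right
      have : ‖((ContinuousLinearEquiv.refl ℝ (X × Y)).symm : X × Y →L[ℝ] X × Y)‖₊ = 1 := by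
        ext
        simp
      rw [this, inv_one]
      rw [div_lt_one (by norm_num)]
      norm_num
  let T := happ.toHomeomorph f hN
  have hT : ∀ p, T p = f p := fun p => rfl
  let L : X × Y → (X × Y →L[ℝ] X × Y) := fun p => -(ContinuousLinearMap.inr ℝ X Y).comp (fderiv ℝ e p)
  have hL : ∀ p, ‖L p‖ < 1 := by
    intro p
    rw [norm_neg]
    refine lt_of_le_of_lt (ContinuousLinearMap.opNorm_comp_le _ _) ?_
    have h1 := ContinuousLinearMap.norm_inr_le_one ℝ X Y
    have h2 := he.norm_fderiv_le p
    nlinarith [norm_nonneg (fderiv ℝ e p)]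
  -- Neumann series: the derivative is 1 - L p with ‖L p‖ < 1, hence invertible, and the inverse map
  -- inherits the smoothness.
  let D : X × Y → ((X × Y) ≃L[ℝ] (X × Y)) := fun p =>
    ContinuousLinearEquiv.unitsEquiv ℝ (X × Y) (Units.oneSub (L p) (hL p))
  have hD : ∀ p, HasFDerivAt T (D p : X × Y →L[ℝ] X × Y) p := by
    intro p
    have h1 : HasFDerivAt f ((ContinuousLinearMap.fst ℝ X Y).prod
        (ContinuousLinearMap.snd ℝ X Y + fderiv ℝ e p)) p :=
      hasFDerivAt_fst.prodMk (hasFDerivAt_snd.add (hed p).hasFDerivAt)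
    convert! h1 using 1
    ext v <;> simp [D, L]
  refine ⟨T, hT, T.contDiff_symm hD ?_⟩
  have : ContDiff ℝ (n + 1 : ℕ) f := contDiff_fst.prodMk (contDiff_snd.add he.1)
  exact this

/-- A quantitative implicit function theorem: the solution `y = h x` of `y + e (x, y) = 0` is
`C^n`-small if `e` is. -/
theorem exists_implicit_ckBounded (n : ℕ) : ∃ M, 0 ≤ M ∧ ∀ {X Y : Type u}
    [NormedAddCommGroup X] [NormedSpace ℝ X]
    [NormedAddCommGroup Y] [NormedSpace ℝ Y] [CompleteSpace X] [CompleteSpace Y]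
    (e : X × Y → Y) (ε : ℝ), CkBounded (n + 1) ε e → ε ≤ 1 / 4 →
    ∃ h : X → Y, (∀ x y, y + e (x, y) = 0 ↔ y = h x) ∧ CkBounded (n + 1) (M * ε) h := by
  -- A priori estimate: the solution is assumed smooth, and its derivatives are bounded one order at
  -- a time. Smoothness itself comes at the end from the homeomorphism above.
  have step : ∀ k ≤ n + 1, ∃ M, 0 ≤ M ∧ ∀ {X Y : Type u} [NormedAddCommGroup X] [NormedSpace ℝ X]
      [NormedAddCommGroup Y] [NormedSpace ℝ Y] [CompleteSpace X] [CompleteSpace Y]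
      (e : X × Y → Y) (ε : ℝ) (h : X → Y), CkBounded (n + 1) ε e → ε ≤ 1 / 4 →
      ContDiff ℝ (n + 1 : ℕ) h → (∀ x, h x = - e (x, h x)) → CkBounded k (M * ε) h := by
    intro k
    induction k with
    | zero =>
      intro _
      refine ⟨1, zero_le_one, fun {X Y} _ _ _ _ _ _ e ε h he _ hh heq => ?_⟩
      rw [ckBounded_zero_iff]
      refine ⟨hh.continuous, fun x => ?_⟩
      rw [heq, norm_neg, one_mul]
      exact he.norm_le _
    | succ k ih =>
      intro hk
      obtain ⟨M, hM, ih⟩ := ih (by omega)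
      -- The constant of `CkBounded.comp` for De along the graph x ↦ (x, h x).
      set U : ℝ := k.factorial * (2 + M) ^ k with hU
      have hU0 : 0 ≤ U := by positivity
      refine ⟨1 + 2 * U * (1 + 2 ^ k * M), by positivity,
        fun {X Y} _ _ _ _ _ _ e ε h he hε hh heq => ?_⟩
      have hε0 := he.nonneg
      have hk' := ih e ε h he hε hh heq
      have hed : Differentiable ℝ e := he.1.differentiable (by simp)
      have hhd : Differentiable ℝ h := hh.differentiable (by simp)
      have hf : DerivBounded k (2 + M) (fun x => (x, h x)) := by
        have h1 : DerivBounded k 1 (ContinuousLinearMap.inl ℝ X Y) :=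
          ContinuousLinearMap.derivBounded _ (ContinuousLinearMap.norm_inl_le_one ℝ X Y)
        have h2 := (ckBounded_clm_comp (ContinuousLinearMap.inr ℝ X Y)
          (ContinuousLinearMap.norm_inr_le_one ℝ X Y) hk').derivBounded
        have h3 := h1.add h2
        have e3 : (fun x => (x, h x)) = (ContinuousLinearMap.inl ℝ X Y : X → X × Y) +
            fun x => ContinuousLinearMap.inr ℝ X Y (h x) := by
          funext x
          simp
        rw [e3]
        exact h3.mono (by nlinarith)
      have he' := (ckBounded_succ_iff.1 he).2.2
      have hu : CkBounded k (U * ε) (fderiv ℝ e ∘ fun x => (x, h x)) :=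
        ((he'.of_le (by omega)).comp hf (by linarith)).mono (le_of_eq (by rw [hU]; ring))
      set u := fderiv ℝ e ∘ fun x => (x, h x) with hu_def
      have hA : CkBounded k (U * ε) (fun x => (u x).comp (ContinuousLinearMap.inl ℝ X Y)) := by
        have := ckBounded_clm_comp ((ContinuousLinearMap.compL ℝ X (X × Y) Y).flip
          (ContinuousLinearMap.inl ℝ X Y)) ?_ hu
        · simpa using! this
        · refine ContinuousLinearMap.opNorm_le_bound _ zero_le_one fun v => ?_
          simp only [ContinuousLinearMap.flip_apply, ContinuousLinearMap.compL_apply, one_mul]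
          refine (ContinuousLinearMap.opNorm_comp_le _ _).trans ?_
          exact mul_le_of_le_one_right (norm_nonneg _) (ContinuousLinearMap.norm_inl_le_one ℝ X Y)
      have hB : CkBounded k (U * ε) (fun x => (u x).comp (ContinuousLinearMap.inr ℝ X Y)) := by
        have := ckBounded_clm_comp ((ContinuousLinearMap.compL ℝ Y (X × Y) Y).flip
          (ContinuousLinearMap.inr ℝ X Y)) ?_ hu
        · simpa using! this
        · refine ContinuousLinearMap.opNorm_le_bound _ zero_le_one fun v => ?_
          simp only [ContinuousLinearMap.flip_apply, ContinuousLinearMap.compL_apply, one_mul]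
          refine (ContinuousLinearMap.opNorm_comp_le _ _).trans ?_
          exact mul_le_of_le_one_right (norm_nonneg _) (ContinuousLinearMap.norm_inr_le_one ℝ X Y)
      have hB0 : ∀ x, ‖(u x).comp (ContinuousLinearMap.inr ℝ X Y)‖ ≤ 1 / 4 := by
        intro x
        refine (ContinuousLinearMap.opNorm_comp_le _ _).trans ?_
        have h1 := he'.norm_le (x, h x)
        have h2 := ContinuousLinearMap.norm_inr_le_one ℝ X Y
        have h3 : ‖u x‖ ≤ ε := h1
        nlinarith [norm_nonneg (u x), norm_nonneg (ContinuousLinearMap.inr ℝ X Y)]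
      set A := fun x => (u x).comp (ContinuousLinearMap.inl ℝ X Y) with hA_def
      set B := fun x => (u x).comp (ContinuousLinearMap.inr ℝ X Y) with hB_def
      -- Implicit differentiation: Dh = -(A + B Dh), with A and B the partial derivatives of e along
      -- the graph.
      have hrel : fderiv ℝ h = -(A + fun x =>
          ContinuousLinearMap.compL ℝ X Y Y (B x) (fderiv ℝ h x)) := by
        funext x
        have h1 : HasFDerivAt (fun x => - e (x, h x))
            (-((fderiv ℝ e (x, h x)).comp ((ContinuousLinearMap.id ℝ X).prod (fderiv ℝ h x)))) x :=
          ((hed _).hasFDerivAt.comp x ((hasFDerivAt_id x).prodMk (hhd x).hasFDerivAt)).neg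
        have h2 : h = fun x => - e (x, h x) := funext heq
        have h3 : fderiv ℝ h x = -((fderiv ℝ e (x, h x)).comp
            ((ContinuousLinearMap.id ℝ X).prod (fderiv ℝ h x))) := by
          conv_lhs => rw [h2]
          exact h1.fderiv
        ext v
        conv_lhs => rw [h3]
        have h4 : (v, fderiv ℝ h x v) = ((v, 0) + (0, fderiv ℝ h x v) : X × Y) := by simp
        have h5 : fderiv ℝ e (x, h x) (v, fderiv ℝ h x v) =
            fderiv ℝ e (x, h x) (v, 0) + fderiv ℝ e (x, h x) (0, fderiv ℝ h x v) := by
          rw [h4, map_add]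
        simp [A, B, u, h5]
      have hw : ContDiff ℝ k (fderiv ℝ h) := hh.fderiv_right (by exact_mod_cast hk)
      have hBw : ContDiff ℝ k (fun x => ContinuousLinearMap.compL ℝ X Y Y (B x) (fderiv ℝ h x)) :=
        hB.1.clm_comp hw
      have hlow : ∀ j < k, ∀ x, ‖iteratedFDeriv ℝ j (fderiv ℝ h) x‖ ≤ M := by
        intro j hj x
        rw [norm_iteratedFDeriv_fderiv]
        refine (hk'.2 (j + 1) (by omega) x).trans ?_
        nlinarith
      have hbound : ∀ i ≤ k, ∀ x,
          ‖iteratedFDeriv ℝ i (fderiv ℝ h) x‖ ≤ 2 * U * (1 + 2 ^ k * M) * ε := by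
        intro i hi x
        have hi' : ((i : ℕ) : WithTop ℕ∞) ≤ k := by exact_mod_cast hi
        have h1 : ‖iteratedFDeriv ℝ i (fderiv ℝ h) x‖ ≤ ‖iteratedFDeriv ℝ i A x‖ +
            ‖iteratedFDeriv ℝ i (fun x =>
              ContinuousLinearMap.compL ℝ X Y Y (B x) (fderiv ℝ h x)) x‖ := by
          conv_lhs => rw [hrel]
          rw [iteratedFDeriv_neg_apply, norm_neg, iteratedFDeriv_add (hA.1.of_le hi')
            (hBw.of_le hi')]
          exact norm_add_le _ _
        have h2 := (ContinuousLinearMap.compL ℝ X Y Y).norm_iteratedFDeriv_le_of_bilinear_of_le_one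
          hB.1 hw x hi' (ContinuousLinearMap.norm_compL_le ℝ X Y Y)
        -- The term with B undifferentiated carries the top derivative of Dh. Since ‖B‖ ≤ 1/4 it can
        -- be absorbed in the left side; all other terms involve lower orders, already bounded.
        rw [Finset.sum_range_succ'] at h2
        have h3 : ∑ j ∈ Finset.range i, (i.choose (j + 1) : ℝ) * ‖iteratedFDeriv ℝ (j + 1) B x‖ *
            ‖iteratedFDeriv ℝ (i - (j + 1)) (fderiv ℝ h) x‖ ≤ 2 ^ k * (U * ε * M) := by
          calc _ ≤ ∑ j ∈ Finset.range i, (i.choose (j + 1) : ℝ) * (U * ε * M) := by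
                refine Finset.sum_le_sum fun j hj => ?_
                rw [Finset.mem_range] at hj
                rw [mul_assoc]
                gcongr
                · exact hB.2 (j + 1) (by omega) x
                · exact hlow _ (by omega) x
            _ ≤ ∑ j ∈ Finset.range (i + 1), (i.choose j : ℝ) * (U * ε * M) := by
                rw [Finset.sum_range_succ']
                have : 0 ≤ (i.choose 0 : ℝ) * (U * ε * M) := by positivity
                linarith
            _ = 2 ^ i * (U * ε * M) := by
                rw [← Finset.sum_mul]
                congr 1
                exact_mod_cast Nat.sum_range_choose i
            _ ≤ 2 ^ k * (U * ε * M) := by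
                gcongr
                norm_num
        have h4 := hA.2 i hi x
        simp only [Nat.choose_zero_right, Nat.cast_one, one_mul, norm_iteratedFDeriv_zero,
          Nat.sub_zero] at h2
        have h5 := mul_le_mul_of_nonneg_right (hB0 x)
          (norm_nonneg (iteratedFDeriv ℝ i (fderiv ℝ h) x))
        have h6 : 0 ≤ U * ε := by positivity
        have h7 : 0 ≤ 2 ^ k * (U * ε * M) := by positivity
        linarith
      rw [ckBounded_succ_iff]
      have h7 : 0 ≤ 2 * U * (1 + 2 ^ k * M) * ε := by positivity
      refine ⟨fun x => ?_, hhd, hw, fun i hi x => (hbound i hi x).trans (by linarith)⟩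
      rw [heq, norm_neg]
      exact (he.norm_le _).trans (by linarith)
  obtain ⟨M, hM, hstep⟩ := step (n + 1) le_rfl
  refine ⟨M, hM, fun {X Y} _ _ _ _ _ _ e ε he hε => ?_⟩
  obtain ⟨T, hT, hTs⟩ := exists_homeomorph_add_snd e (he.mono hε)
  have hfst : ∀ p, (T.symm p).1 = p.1 := fun p => by
    conv_rhs => rw [← T.apply_symm_apply p, hT]
  -- The equation says T (x, y) = (x, 0), and T is bijective and preserves the first coordinate.
  have huniq : ∀ x y, y + e (x, y) = 0 ↔ y = (T.symm (x, 0)).2 := by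
    intro x y
    constructor
    · intro hy
      have : T (x, y) = (x, 0) := by rw [hT]; simp [hy]
      rw [← this, T.symm_apply_apply]
    · rintro rfl
      have h1 := T.apply_symm_apply (x, 0)
      have h2 : T.symm (x, 0) = (x, (T.symm (x, 0)).2) := by
        ext
        · exact hfst (x, 0)
        · rfl
      rw [hT] at h1
      have h3 := congrArg Prod.snd h1
      simp only at h3
      rwa [h2] at h3
  refine ⟨fun x => (T.symm (x, 0)).2, huniq, hstep e ε _ he hε ?_ fun x => ?_⟩
  · exact contDiff_snd.comp (hTs.comp (contDiff_id.prodMk contDiff_const))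
  · exact eq_neg_of_add_eq_zero_left ((huniq x _).2 rfl)

end BoundedDerivatives

/-! ### Cutoffs, parametric integrals, connected sets and frontiers -/

section CutoffAndParametric

variable {E F : Type*} [NormedAddCommGroup E] [NormedSpace ℝ E] [FiniteDimensional ℝ E]
  [NormedAddCommGroup F] [NormedSpace ℝ F]

/-- There is a smooth compactly supported cutoff between a compact set and an open
neighbourhood. -/
theorem exists_smooth_cutoff {K U : Set E} (hK : IsCompact K) (hU : IsOpen U) (hKU : K ⊆ U) :
    ∃ χ : E → ℝ, ContDiff ℝ ∞ χ ∧ HasCompactSupport χ ∧ tsupport χ ⊆ U ∧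
      (∀ᶠ x in 𝓝ˢ K, χ x = 1) ∧ ∀ x, χ x ∈ Icc (0 : ℝ) 1 := by
  obtain ⟨L, hL, hKL, hLU⟩ := exists_compact_between hK hU hKU
  obtain ⟨χ, h1, h0, h01⟩ := exists_contMDiffMap_one_nhds_of_subset_interior (n := (⊤ : ℕ∞))
    (modelWithCornersSelf ℝ E) hK.isClosed hKL
  have hsub : tsupport χ ⊆ L := by
    refine closure_minimal (fun x hx => ?_) hL.isClosed
    by_contra h
    exact hx (h0 x h)
  exact ⟨χ, χ.contMDiff.contDiff, HasCompactSupport.of_support_subset_isCompact hL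
    (subset_closure.trans hsub), hsub.trans hLU, h1, h01⟩

/-- A function of class `C^n` near a compact set agrees there with a compactly supported one. -/
theorem exists_contDiff_extension {n : ℕ} {K U : Set E} (hK : IsCompact K) (hU : IsOpen U)
    (hKU : K ⊆ U) {f : E → F} (hf : ContDiffOn ℝ n f U) :
    ∃ g : E → F, ContDiff ℝ n g ∧ HasCompactSupport g ∧ ∀ᶠ x in 𝓝ˢ K, g x = f x := by
  obtain ⟨χ, hχ, hc, hs, h1, -⟩ := exists_smooth_cutoff hK hU hKU
  refine ⟨fun x => χ x • f x, ?_, hc.smul_right, ?_⟩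
  · have hopen : IsOpen (tsupport χ)ᶜ := (isClosed_tsupport χ).isOpen_compl
    refine contDiff_iff_contDiffAt.2 fun x => ?_
    by_cases hx : x ∈ tsupport χ
    · exact (hχ.contDiffAt.of_le (by exact_mod_cast le_top)).smul
        (hf.contDiffAt (hU.mem_nhds (hs hx)))
    · have : (fun x => χ x • f x) =ᶠ[𝓝 x] fun _ => 0 := by
        filter_upwards [hopen.mem_nhds hx] with y hy
        rw [image_eq_zero_of_notMem_tsupport hy, zero_smul]
      exact contDiffAt_const.congr_of_eventuallyEq this
  · filter_upwards [h1] with x hx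
    rw [hx, one_smul]

end CutoffAndParametric

theorem exists_ckBounded_of_hasCompactSupport {E F : Type*} [NormedAddCommGroup E]
    [NormedSpace ℝ E] [NormedAddCommGroup F] [NormedSpace ℝ F] {n : ℕ} {f : E → F} (hf : ContDiff ℝ n f)
    (hc : HasCompactSupport f) : ∃ C, CkBounded n C f := by
  have h : ∀ i : ℕ, ∃ C, i ≤ n → ∀ x, ‖iteratedFDeriv ℝ i f x‖ ≤ C := by
    intro i
    by_cases hi : i ≤ n
    · obtain ⟨C, hC⟩ := (hf.continuous_iteratedFDeriv (m := i)
        (by exact_mod_cast hi)).bounded_above_of_compact_support (hc.iteratedFDeriv i)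
      exact ⟨C, fun _ => hC⟩
    · exact ⟨0, fun h => absurd h hi⟩
  choose C hC using h
  refine ⟨∑ i ∈ Finset.range (n + 1), |C i|, hf, fun i hi x => ?_⟩
  refine (hC i hi x).trans ((le_abs_self _).trans ?_)
  exact Finset.single_le_sum (f := fun i => |C i|) (fun _ _ => abs_nonneg _)
    (Finset.mem_range.2 (by omega))

/-- Parametric integrals of `C^n` functions over `[0, 1]` are `C^n`. -/
theorem contDiff_parametric_integral {E F : Type} [NormedAddCommGroup E] [NormedSpace ℝ E]
    [FiniteDimensional ℝ E] [NormedAddCommGroup F] [NormedSpace ℝ F] [CompleteSpace F] (n : ℕ)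
    (f : E × ℝ → F) (hf : ContDiff ℝ n f) :
    ContDiff ℝ n (fun x => ∫ s in (0 : ℝ)..1, f (x, s)) := by
  -- Differentiating under the integral produces an integrand with values in linear maps, so the
  -- codomain must vary.
  induction n generalizing F with
  | zero =>
    have hf' : Continuous f := hf.continuous
    simp only [CharP.cast_eq_zero, contDiff_zero]
    exact intervalIntegral.continuous_parametric_intervalIntegral_of_continuous'
      (f := fun x s => f (x, s)) hf' 0 1
  | succ n ih =>
    have hf1 : ContDiff ℝ ((n : WithTop ℕ∞) + 1) f := by exact_mod_cast hf
    have hfc : Continuous f := hf.continuous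
    have hfd : Differentiable ℝ f := hf.differentiable (by simp)
    let f' : E × ℝ → (E →L[ℝ] F) := fun p => (fderiv ℝ f p).comp (ContinuousLinearMap.inl ℝ E ℝ)
    have hf' : ContDiff ℝ n f' := (contDiff_succ_iff_fderiv.1 hf1).2.2.clm_comp contDiff_const
    have hf'c : Continuous f' := hf'.continuous
    have hgoal : ContDiff ℝ ((n : WithTop ℕ∞) + 1) (fun x => ∫ s in (0 : ℝ)..1, f (x, s)) := by
      rw [contDiff_succ_iff_hasFDerivAt]
      refine ⟨fun x => ∫ s in (0 : ℝ)..1, f' (x, s), ih f' hf', fun x => ?_⟩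
      obtain ⟨C, hC⟩ := ((isCompact_closedBall x 1).prod (isCompact_Icc (a := (0 : ℝ))
        (b := 1))).exists_bound_of_continuousOn hf'c.continuousOn
      refine intervalIntegral.hasFDerivAt_integral_of_dominated_of_fderiv_le
        (F := fun x s => f (x, s)) (F' := fun x s => f' (x, s)) (bound := fun _ => C)
        (s := Metric.closedBall x 1)
        (Metric.closedBall_mem_nhds x one_pos) ?_ ?_ ?_ ?_ ?_ ?_
      · exact Eventually.of_forall fun y =>
          (by fun_prop : Continuous fun s => f (y, s)).aestronglyMeasurable
      · exact (by fun_prop : Continuous fun s => f (x, s)).intervalIntegrable _ _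
      · exact (by fun_prop : Continuous fun s => f' (x, s)).aestronglyMeasurable
      · refine Eventually.of_forall fun s hs y hy => hC (y, s) ⟨hy, ?_⟩
        rw [uIoc_of_le zero_le_one] at hs
        exact ⟨hs.1.le, hs.2⟩
      · exact intervalIntegrable_const
      · refine Eventually.of_forall fun s _ y _ => ?_
        exact (hfd (y, s)).hasFDerivAt.comp y (hasFDerivAt_prodMk_left y s)
    exact_mod_cast hgoal

/-- A preconnected set that misses the frontier of `s` lies on one side of it. -/
theorem IsPreconnected.mem_iff_of_inter_frontier_eq_empty {X : Type*} [TopologicalSpace X]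
    {s t : Set X} (ht : IsPreconnected t) (h : t ∩ frontier s = ∅) {x y : X} (hx : x ∈ t)
    (hy : y ∈ t) : x ∈ s ↔ y ∈ s := by
  have key : ∀ {x y : X}, x ∈ t → y ∈ t → x ∈ s → y ∈ s := by
    intro x y hx hy hxs
    by_contra hys
    have hcov : t ⊆ interior s ∪ (closure s)ᶜ := by
      intro z hz
      by_cases hzi : z ∈ interior s
      · exact Or.inl hzi
      · refine Or.inr fun hzc => ?_
        have : z ∈ t ∩ frontier s := ⟨hz, hzc, hzi⟩
        simp [h] at this
    have hxi : x ∈ interior s := (hcov hx).resolve_right fun h' => h' (subset_closure hxs)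
    have hyi : y ∈ (closure s)ᶜ := (hcov hy).resolve_left fun h' => hys (interior_subset h')
    obtain ⟨z, -, hz1, hz2⟩ := ht _ _ isOpen_interior isClosed_closure.isOpen_compl hcov
      ⟨x, hx, hxi⟩ ⟨y, hy, hyi⟩
    exact hz2 (interior_subset_closure hz1)
  exact ⟨key hx hy, key hy hx⟩

/-! ### The space Θ and inversion of small deformations -/

section ThetaSpace

variable {d : ℕ}

/-- Translates the norm of Θ into the derivative bounds in which the calculus above is phrased. -/
theorem ShapeStability.Theta.norm_le_iff (θ : Theta d) {C : ℝ} (hC : 0 ≤ C) : ‖θ‖ ≤ C ↔ CkBounded 3 C θ := by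
  have h : ‖θ‖ = ‖Theta.derivs d θ‖ := rfl
  rw [h, pi_norm_le_iff_of_nonneg hC]
  constructor
  · intro h
    refine ⟨θ.2.1, fun i hi x => ?_⟩
    exact (BoundedContinuousFunction.norm_le hC).1 (h ⟨i, by omega⟩) x
  · intro h k
    exact (BoundedContinuousFunction.norm_le hC).2 fun x => h.2 k (by omega) x

theorem ShapeStability.Theta.ckBounded (θ : Theta d) : CkBounded 3 ‖θ‖ θ :=
  (θ.norm_le_iff (norm_nonneg θ)).1 le_rfl

/-- A `C^3` field with bounded derivatives as an element of `Θ`. -/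
def CkBounded.toTheta {C : ℝ} {f : Euc d → Euc d} (h : CkBounded 3 C f) : Theta d :=
  ⟨f, h.1, fun k => ⟨C, fun x => h.2 k (by omega) x⟩⟩

theorem CkBounded.coe_toTheta {C : ℝ} {f : Euc d → Euc d} (h : CkBounded 3 C f) (x : Euc d) :
    h.toTheta x = f x := rfl

theorem CkBounded.norm_toTheta_le {C : ℝ} {f : Euc d → Euc d} (h : CkBounded 3 C f) :
    ‖h.toTheta‖ ≤ C :=
  (h.toTheta.norm_le_iff h.nonneg).2 h

theorem ShapeStability.Theta.continuous (θ : Theta d) : Continuous θ := θ.2.1.continuous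

theorem ShapeStability.Theta.differentiable (θ : Theta d) : Differentiable ℝ θ := θ.2.1.differentiable (by simp)

theorem ShapeStability.Theta.norm_apply_le (θ : Theta d) (x : Euc d) : ‖θ x‖ ≤ ‖θ‖ := θ.ckBounded.norm_le x

theorem ShapeStability.Theta.norm_fderiv_le (θ : Theta d) (x : Euc d) : ‖fderiv ℝ θ x‖ ≤ ‖θ‖ :=
  (θ.ckBounded.of_le (l := 0 + 1) (by omega)).norm_fderiv_le x

theorem ShapeStability.Theta.smul_apply (c : ℝ) (θ : Theta d) (x : Euc d) : (c • θ) x = c • θ x := rfl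

theorem ShapeStability.Theta.zero_apply (x : Euc d) : (0 : Theta d) x = 0 := rfl

theorem deform_zero (s : Set (Euc d)) : deform (0 : Theta d) '' s = s := by
  have : deform (0 : Theta d) = id := by
    funext x
    simp [deform, Theta.zero_apply]
  rw [this, image_id]

theorem continuous_deform (θ : Theta d) : Continuous (deform θ) :=
  continuous_id.add θ.continuous

/-- Small fields have an inverse deformation in `Θ`. -/
theorem exists_inverse_deform (d : ℕ) : ∃ M, 0 ≤ M ∧ ∃ η > 0, ∀ θ : Theta d, ‖θ‖ ≤ η →
    ∃ ψ : Theta d, Function.LeftInverse (deform ψ) (deform θ) ∧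
      Function.RightInverse (deform ψ) (deform θ) ∧ ‖ψ‖ ≤ M * ‖θ‖ := by
  obtain ⟨M, hM, h⟩ := exists_implicit_ckBounded.{0} 2
  refine ⟨M * (Nat.factorial 3 * 2 ^ 3), by positivity, 1 / (4 * (Nat.factorial 3 * 2 ^ 3)),
    by positivity, fun θ hθ => ?_⟩
  -- I + ψ is a right inverse of I + θ exactly when y = ψ x solves y + θ (x + y) = 0. The sum map L
  -- has norm at most 2, whence the factor 3! · 2³ in the constants.
  let L : Euc d × Euc d →L[ℝ] Euc d :=
    ContinuousLinearMap.fst ℝ _ _ + ContinuousLinearMap.snd ℝ _ _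
  have hL : DerivBounded 3 2 L := by
    refine ContinuousLinearMap.derivBounded L ((norm_add_le _ _).trans ?_)
    have h1 := ContinuousLinearMap.norm_fst_le ℝ (Euc d) (Euc d)
    have h2 := ContinuousLinearMap.norm_snd_le ℝ (Euc d) (Euc d)
    linarith
  have he : CkBounded 3 (Nat.factorial 3 * ‖θ‖ * 2 ^ 3) (θ ∘ L) := θ.ckBounded.comp hL one_le_two
  obtain ⟨g, hg, hgb⟩ := h (θ ∘ L) _ he (by
    rw [le_div_iff₀ (by positivity)] at hθ
    norm_num at hθ ⊢
    linarith)
  refine ⟨hgb.toTheta, fun x => ?_, fun x => ?_, hgb.norm_toTheta_le.trans (le_of_eq (by ring))⟩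
  · have h1 := (hg (deform θ x) (-θ x)).1 (by simp [L, deform])
    simp only [deform, hgb.coe_toTheta]
    rw [deform] at h1
    rw [← h1]
    simp
  · have h1 := (hg x (g x)).2 rfl
    simp only [deform, hgb.coe_toTheta]
    simp only [Function.comp_apply, L, add_apply, ContinuousLinearMap.coe_fst',
      ContinuousLinearMap.coe_snd'] at h1
    rw [add_assoc, h1, add_zero]

end ThetaSpace

/-! ### Global defining function and collar of the boundary -/

section Collar

variable {d : ℕ} {Ω : Set (Euc d)}

theorem fderiv_apply_eq_inner_gradient (ρ : Euc d → ℝ) (x v : Euc d) :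
    fderiv ℝ ρ x v = ⟪gradient ρ x, v⟫ := by
  simp [gradient]

theorem contDiff_gradient {n : ℕ} {ρ : Euc d → ℝ} (h : ContDiff ℝ (n + 1 : ℕ) ρ) :
    ContDiff ℝ n (gradient ρ) := by
  have : ContDiff ℝ n (fderiv ℝ ρ) := h.fderiv_right (by exact_mod_cast le_rfl)
  exact (InnerProductSpace.toDual ℝ (Euc d)).symm.contDiff.comp this

/-- By uniqueness of the outer normal the choice in its definition is harmless. -/
theorem outerNormal_eq {x : Euc d} {ρ : Euc d → ℝ} (h : IsDefiningFunctionAt 1 Ω x ρ) :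
    outerNormal Ω x = ‖gradient ρ x‖⁻¹ • gradient ρ x := by
  have hex : ∃ ν, IsOuterNormal Ω x ν := ⟨_, ρ, h, rfl⟩
  have : IsOuterNormal Ω x (outerNormal Ω x) := by
    rw [outerNormal, dif_pos hex]
    exact hex.choose_spec
  exact this.unique ⟨ρ, h, rfl⟩

theorem ShapeStability.IsDefiningFunctionAt.le_one {k : ℕ} (hk : 1 ≤ k) {x : Euc d} {ρ : Euc d → ℝ}
    (h : IsDefiningFunctionAt k Ω x ρ) : IsDefiningFunctionAt 1 Ω x ρ :=
  ⟨h.1.of_le (by exact_mod_cast hk), h.2⟩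

/-- An open set misses its frontier, so ρ x ≥ 0; were ρ x positive, it would be positive nearby and
x would not be a limit of points of Ω. -/
theorem eq_zero_of_mem_frontier (hΩ : IsOpen Ω) {x : Euc d} (hx : x ∈ frontier Ω) {ρ : Euc d → ℝ}
    (hρ : Continuous ρ) (h : ∀ᶠ y in 𝓝 x, (y ∈ Ω ↔ ρ y < 0)) : ρ x = 0 := by
  have hx' : x ∉ Ω := fun h' => by
    have := hΩ.inter_frontier_eq
    have h2 : x ∈ Ω ∩ frontier Ω := ⟨h', hx⟩
    rw [this] at h2
    exact h2
  refine le_antisymm ?_ (not_lt.1 fun h' => hx' (h.self_of_nhds.2 h'))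
  have hfr : ∃ᶠ y in 𝓝 x, y ∈ Ω := mem_closure_iff_frequently.1 hx.1
  by_contra hlt
  rw [not_le] at hlt
  have h2 : ∀ᶠ y in 𝓝 x, 0 < ρ y := hρ.continuousAt.eventually (lt_mem_nhds hlt)
  obtain ⟨y, hy, hy1, hy2⟩ := (hfr.and_eventually (h.and h2)).exists
  exact absurd (hy1.1 hy) (not_lt.2 hy2.le)

/-- Moving from x along -∇ρ enters Ω, while ρ x = 0 keeps x itself outside. -/
theorem ShapeStability.IsDefiningFunctionAt.mem_frontier {x : Euc d} {ρ : Euc d → ℝ}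
    (h : IsDefiningFunctionAt 1 Ω x ρ) : x ∈ frontier Ω := by
  have hx : x ∉ Ω := fun h' => absurd (h.2.2.2.self_of_nhds.1 h') (by simp [h.2.1])
  refine ⟨?_, fun h' => hx (interior_subset h')⟩
  have h1 := h.eventually_neg (v := -gradient ρ x) (by
    rw [inner_neg_right, real_inner_self_eq_norm_sq]
    have := norm_pos_iff.2 h.2.2.1
    nlinarith)
  have hc : Tendsto (fun t : ℝ => x + t • -gradient ρ x) (𝓝[>] 0) (𝓝 x) := by
    have : Continuous (fun t : ℝ => x + t • -gradient ρ x) := by fun_prop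
    simpa using (this.tendsto 0).mono_left nhdsWithin_le_nhds
  exact mem_closure_of_tendsto hc h1

theorem isCompact_frontier_of_isBoundedDomain {k : ℕ} (hΩ : IsBoundedDomain k Ω) :
    IsCompact (frontier Ω) :=
  Metric.isCompact_of_isClosed_isBounded isClosed_frontier
    (hΩ.isBounded.closure.subset frontier_subset_closure)

/-- A bounded domain of class `C^k` has a global defining function of class `C^k`. -/
theorem exists_global_definingFunction {k : ℕ} (hk : 1 ≤ k) (hΩ : IsBoundedDomain k Ω) :
    ∃ ρ : Euc d → ℝ, HasCompactSupport ρ ∧ ∀ x ∈ frontier Ω, IsDefiningFunctionAt k Ω x ρ := by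
  have hK := isCompact_frontier_of_isBoundedDomain hΩ
  choose! ρ hρ using hΩ.boundary
  let W : Euc d → Set (Euc d) := fun x =>
    {y | ∀ᶠ z in 𝓝 y, (z ∈ Ω ↔ ρ x z < 0)} ∩ {y | gradient (ρ x) y ≠ 0}
  have hWx : ∀ x ∈ frontier Ω, W x ∈ 𝓝 x := by
    intro x hx
    obtain ⟨h1, -, h3, h4⟩ := hρ x hx
    have hg : Continuous (gradient (ρ x)) := by
      obtain ⟨l, rfl⟩ : ∃ l, k = l + 1 := ⟨k - 1, by omega⟩
      exact (contDiff_gradient h1).continuous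
    exact inter_mem h4.eventually_nhds (hg.continuousAt.eventually_ne h3)
  have hbump : ∀ x, ∃ χ : Euc d → ℝ, x ∈ frontier Ω → (tsupport χ ⊆ W x ∧ HasCompactSupport χ ∧
      ContDiff ℝ k χ ∧ range χ ⊆ Icc 0 1 ∧ χ x = 1) := by
    intro x
    by_cases hx : x ∈ frontier Ω
    · obtain ⟨χ, h⟩ := exists_contDiff_tsupport_subset (n := (k : ℕ∞)) (hWx x hx)
      exact ⟨χ, fun _ => h⟩
    · exact ⟨0, fun h => absurd h hx⟩
  choose χ hχ using hbump
  obtain ⟨t, ht, hcov⟩ := hK.elim_nhds_subcover (fun x => {y | x ∈ frontier Ω → 0 < χ x y})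
    (fun x hx => by
      filter_upwards [((hχ x hx).2.2.1.continuous.continuousAt).eventually
        (lt_mem_nhds (by rw [(hχ x hx).2.2.2.2]; exact zero_lt_one))] with y hy _ using hy)
  have hcov' : ∀ y ∈ frontier Ω, ∃ x ∈ t, 0 < χ x y := by
    intro y hy
    obtain ⟨x, hx, hxy⟩ := mem_iUnion₂.1 (hcov hy)
    exact ⟨x, hx, hxy (ht x hx)⟩
  have hnonneg : ∀ x ∈ t, ∀ y, 0 ≤ χ x y := fun x hx y =>
    ((hχ x (ht x hx)).2.2.2.1 (mem_range_self y)).1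
  have hmemW : ∀ x ∈ t, ∀ y, χ x y ≠ 0 → y ∈ W x := fun x hx y hy =>
    (hχ x (ht x hx)).1 (subset_tsupport _ hy)
  have hdiff : ∀ x ∈ t, ContDiff ℝ k (fun y => χ x y * ρ x y) := fun x hx =>
    (hχ x (ht x hx)).2.2.1.mul (hρ x (ht x hx)).1
  -- Local defining functions are glued with nonnegative weights. The weights need not sum to one:
  -- only a common sign and a nonzero normal derivative matter.
  let R : Euc d → ℝ := fun y => ∑ x ∈ t, χ x y * ρ x y
  have hR : ContDiff ℝ k R := ContDiff.sum fun x hx => hdiff x hx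
  have hk0 : (k : WithTop ℕ∞) ≠ 0 := by exact_mod_cast (by omega : k ≠ 0)
  refine ⟨R, ?_, fun y hy => ?_⟩
  · have hc : HasCompactSupport (∑ x ∈ t, fun y => χ x y * ρ x y) := by
      refine Finset.sum_induction _ HasCompactSupport (fun f g hf hg => hf.add hg)
        HasCompactSupport.zero fun x hx => ?_
      exact (hχ x (ht x hx)).2.1.mul_right
    convert hc using 1
    funext y
    simp [R]
  have hdef : ∀ x ∈ t, y ∈ W x → IsDefiningFunctionAt k Ω y (ρ x) := fun x hx hyW =>
    ⟨(hρ x (ht x hx)).1, eq_zero_of_mem_frontier hΩ.isOpen hy (hρ x (ht x hx)).1.continuous hyW.1,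
      hyW.2, hyW.1⟩
  have hR0 : R y = 0 := Finset.sum_eq_zero fun x hx => by
    by_cases h : χ x y = 0
    · rw [h, zero_mul]
    · rw [(hdef x hx (hmemW x hx y h)).2.1, mul_zero]
  -- At a boundary point the relevant local functions vanish, so derivatives of the weights drop
  -- out, and their gradients are all positive multiples of the same normal. No cancellation can
  -- occur.
  have hderiv : fderiv ℝ R y (outerNormal Ω y) = ∑ x ∈ t, χ x y * ‖gradient (ρ x) y‖ := by
    have h1 : HasFDerivAt R (∑ x ∈ t, fderiv ℝ (fun y => χ x y * ρ x y) y) y :=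
      HasFDerivAt.fun_sum fun x hx => ((hdiff x hx).differentiable hk0 y).hasFDerivAt
    rw [h1.fderiv, sum_apply]
    refine Finset.sum_congr rfl fun x hx => ?_
    have hχd : DifferentiableAt ℝ (χ x) y := (hχ x (ht x hx)).2.2.1.differentiable hk0 y
    have hρd : DifferentiableAt ℝ (ρ x) y := (hρ x (ht x hx)).1.differentiable hk0 y
    rw [fderiv_fun_mul hχd hρd]
    simp only [add_apply, smul_apply, smul_eq_mul]
    by_cases hyt : y ∈ tsupport (χ x)
    · have hd := hdef x hx ((hχ x (ht x hx)).1 hyt)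
      rw [hd.2.1, zero_mul, add_zero, outerNormal_eq (hd.le_one hk),
        fderiv_apply_eq_inner_gradient, inner_smul_right, real_inner_self_eq_norm_sq]
      have := norm_ne_zero_iff.2 hd.2.2.1
      field_simp
    · have h0 : χ x y = 0 := image_eq_zero_of_notMem_tsupport hyt
      have h0' : fderiv ℝ (χ x) y = 0 := by
        have : χ x =ᶠ[𝓝 y] fun _ => 0 := by
          filter_upwards [(isClosed_tsupport (χ x)).isOpen_compl.mem_nhds hyt] with z hz
          exact image_eq_zero_of_notMem_tsupport hz
        rw [this.fderiv_eq]
        simp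
      rw [h0, h0']
      simp
  obtain ⟨x₀, hx₀, hpos₀⟩ := hcov' y hy
  refine ⟨hR, hR0, ?_, ?_⟩
  · intro h0
    have h1 : 0 < ∑ x ∈ t, χ x y * ‖gradient (ρ x) y‖ :=
      Finset.sum_pos' (fun x hx => mul_nonneg (hnonneg x hx y) (norm_nonneg _))
        ⟨x₀, hx₀, mul_pos hpos₀ (norm_pos_iff.2 (hmemW x₀ hx₀ y hpos₀.ne').2)⟩
    rw [← hderiv, fderiv_apply_eq_inner_gradient, h0, inner_zero_left] at h1
    exact lt_irrefl _ h1
  · have hev : ∀ᶠ z in 𝓝 y, 0 < χ x₀ z :=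
      ((hχ x₀ (ht x₀ hx₀)).2.2.1.continuous.continuousAt).eventually (lt_mem_nhds hpos₀)
    filter_upwards [hev] with z hz
    constructor
    · intro hzΩ
      refine Finset.sum_neg' (fun x hx => ?_) ⟨x₀, hx₀, ?_⟩
      · by_cases h : χ x z = 0
        · rw [h, zero_mul]
        · exact mul_nonpos_of_nonneg_of_nonpos (hnonneg x hx z)
            ((hmemW x hx z h).1.self_of_nhds.1 hzΩ).le
      · exact mul_neg_of_pos_of_neg hz ((hmemW x₀ hx₀ z hz.ne').1.self_of_nhds.1 hzΩ)
    · intro hzR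
      by_contra hzΩ
      refine absurd hzR (not_lt.2 (Finset.sum_nonneg fun x hx => ?_))
      by_cases h : χ x z = 0
      · rw [h, zero_mul]
      · refine mul_nonneg (hnonneg x hx z) (not_lt.1 fun h' => hzΩ ?_)
        exact (hmemW x hx z h).1.self_of_nhds.2 h'

/-- `ρ` and `N` describe a collar of width `2r` around the boundary: `ρ` is a defining function,
increasing at rate at least `a` along the normals, and `N` extends the outer normal. -/
structure IsCollar (Ω : Set (Euc d)) (ρ : Euc d → ℝ) (N : Euc d → Euc d) (r a : ℝ) : Prop where
  contDiff_rho : ContDiff ℝ 5 ρ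
  hasCompactSupport_rho : HasCompactSupport ρ
  contDiff_normal : ContDiff ℝ 4 N
  hasCompactSupport_normal : HasCompactSupport N
  r_pos : 0 < r
  a_pos : 0 < a
  isCompact_frontier : IsCompact (frontier Ω)
  defining : ∀ x ∈ frontier Ω, IsDefiningFunctionAt 5 Ω x ρ
  outerNormal_eq : ∀ x ∈ frontier Ω, outerNormal Ω x = N x
  norm_normal : ∀ x ∈ frontier Ω, ‖N x‖ = 1
  mem_iff : ∀ x ∈ frontier Ω, ∀ y, ‖y - x‖ ≤ 2 * r → (y ∈ Ω ↔ ρ y < 0)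
  mem_frontier_iff : ∀ x ∈ frontier Ω, ∀ y, ‖y - x‖ ≤ 2 * r → (y ∈ frontier Ω ↔ ρ y = 0)
  le_fderiv : ∀ x ∈ frontier Ω, ∀ y, ‖y - x‖ ≤ 2 * r → a ≤ fderiv ℝ ρ y (N x)

theorem exists_isCollar (hΩ : IsBoundedDomain 5 Ω) : ∃ ρ N r a, IsCollar Ω ρ N r a := by
  have hK := isCompact_frontier_of_isBoundedDomain hΩ
  obtain ⟨ρ, hρc, hρ⟩ := exists_global_definingFunction (by norm_num) hΩ
  rcases (frontier Ω).eq_empty_or_nonempty with hemp | ⟨x₀, hx₀⟩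
  · refine ⟨0, 0, 1, 1, contDiff_const, HasCompactSupport.zero, contDiff_const,
      HasCompactSupport.zero, one_pos, one_pos, hK, ?_, ?_, ?_, ?_, ?_, ?_⟩ <;>
    simp [hemp]
  have hρ5 : ContDiff ℝ 5 ρ := (hρ x₀ hx₀).1
  have hgrad : ContDiff ℝ 4 (gradient ρ) := contDiff_gradient (n := 4) hρ5
  have hopen : IsOpen {y | gradient ρ y ≠ 0} := isOpen_ne_fun hgrad.continuous continuous_const
  -- The normalized gradient loses one derivative and is defined only where ∇ρ ≠ 0; a cutoff makes
  -- it a global C⁴ field.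
  obtain ⟨N, hN, hNc, hNeq⟩ := exists_contDiff_extension (n := 4)
    (f := fun y => ‖gradient ρ y‖⁻¹ • gradient ρ y) hK hopen (fun x hx => (hρ x hx).2.2.1) (by
      refine ContDiffOn.smul (ContDiffOn.inv (hgrad.contDiffOn.norm ℝ fun x hx => hx) ?_)
        hgrad.contDiffOn
      exact fun x hx => norm_ne_zero_iff.2 hx)
  have hNn : ∀ x ∈ frontier Ω, N x = ‖gradient ρ x‖⁻¹ • gradient ρ x := fun x hx =>
    hNeq.self_of_nhdsSet x hx
  have hfd : Continuous (fderiv ℝ ρ) := hρ5.continuous_fderiv (by simp)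
  let m : Euc d × Euc d → ℝ := fun p => fderiv ℝ ρ (p.1 + p.2) (N p.1)
  have hm : Continuous m := by
    have := hN.continuous
    fun_prop
  have hm0 : ∀ x ∈ frontier Ω, 0 < m (x, 0) := by
    intro x hx
    have h1 : 0 < ‖gradient ρ x‖ := norm_pos_iff.2 (hρ x hx).2.2.1
    simp only [m, add_zero, fderiv_apply_eq_inner_gradient, hNn x hx, inner_smul_right,
      real_inner_self_eq_norm_sq]
    positivity
  obtain ⟨x₁, hx₁, hmin⟩ := hK.exists_isMinOn ⟨x₀, hx₀⟩
    (f := fun x => m (x, 0)) (by fun_prop : Continuous fun x => m (x, 0)).continuousOn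
  -- Half of the minimal normal derivative on the boundary, so that the lower bound persists
  -- strictly on a neighbourhood.
  set a := m (x₁, 0) / 2 with ha
  have ha0 : 0 < a := half_pos (hm0 x₁ hx₁)
  have hnear : ∀ x ∈ frontier Ω, ∀ᶠ y in 𝓝 x, ((y ∈ Ω ↔ ρ y < 0) ∧ (y ∈ frontier Ω ↔ ρ y = 0)) := by
    intro x hx
    have h1 := (hρ x hx).2.2.2.eventually_nhds
    filter_upwards [h1, hopen.mem_nhds (hρ x hx).2.2.1] with y hy hy'
    refine ⟨hy.self_of_nhds, fun h => eq_zero_of_mem_frontier hΩ.isOpen h hρ5.continuous hy,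
      fun h => IsDefiningFunctionAt.mem_frontier (ρ := ρ) ⟨hρ5.of_le (by norm_num), h, hy', hy⟩⟩
  obtain ⟨U, hUo, hU⟩ : ∃ U : Set (Euc d), IsOpen U ∧ frontier Ω ⊆ U ∧
      ∀ y ∈ U, ((y ∈ Ω ↔ ρ y < 0) ∧ (y ∈ frontier Ω ↔ ρ y = 0)) := by
    refine ⟨interior {y | (y ∈ Ω ↔ ρ y < 0) ∧ (y ∈ frontier Ω ↔ ρ y = 0)}, isOpen_interior,
      fun x hx => mem_interior_iff_mem_nhds.2 (hnear x hx), fun y hy => ?_⟩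
    have := interior_subset hy
    exact this
  have hopen2 : IsOpen {p : Euc d × Euc d | p.1 + p.2 ∈ U ∧ a < m p} :=
    (hUo.preimage (by fun_prop : Continuous fun p : Euc d × Euc d => p.1 + p.2)).inter
      (isOpen_lt continuous_const hm)
  obtain ⟨δ, hδ, hthick⟩ := (hK.prod (isCompact_singleton (x := (0 : Euc d)))).exists_thickening_subset_open
    hopen2 (by
      rintro ⟨x, v⟩ ⟨hx, hv⟩
      obtain rfl : v = 0 := hv
      refine ⟨by simpa using hU.1 hx, ?_⟩
      have h1 : m (x₁, 0) ≤ m (x, 0) := hmin hx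
      have := hm0 x₁ hx₁
      simp only [ha]
      linarith)
  -- With r = δ / 4 the distance 2r equals δ / 2, strictly inside the thickening.
  have hin : ∀ x ∈ frontier Ω, ∀ y, ‖y - x‖ ≤ 2 * (δ / 4) → y ∈ U ∧ a < fderiv ℝ ρ y (N x) := by
    intro x hx y hy
    have h1 : (x, y - x) ∈ Metric.thickening δ (frontier Ω ×ˢ {(0 : Euc d)}) := by
      rw [Metric.mem_thickening_iff]
      refine ⟨(x, 0), ⟨hx, rfl⟩, ?_⟩
      rw [Prod.dist_eq, dist_self, dist_zero_right, max_lt_iff]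
      exact ⟨hδ, by linarith⟩
    have h2 := hthick h1
    simpa [m] using! h2
  refine ⟨ρ, N, δ / 4, a, hρ5, hρc, hN, hNc, by positivity, ha0, hK, hρ, ?_, ?_,
    fun x hx y hy => (hU.2 y (hin x hx y hy).1).1, fun x hx y hy => (hU.2 y (hin x hx y hy).1).2,
    fun x hx y hy => (hin x hx y hy).2.le⟩
  · intro x hx
    rw [hNn x hx, outerNormal_eq ((hρ x hx).le_one (by norm_num))]
  · intro x hx
    rw [hNn x hx, norm_smul, norm_inv, norm_norm]
    exact inv_mul_cancel₀ (norm_ne_zero_iff.2 (hρ x hx).2.2.1)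

namespace IsCollar

variable {ρ : Euc d → ℝ} {N : Euc d → Euc d} {r a : ℝ}

theorem rho_eq_zero (h : IsCollar Ω ρ N r a) {x : Euc d} (hx : x ∈ frontier Ω) : ρ x = 0 :=
  (h.defining x hx).2.1

theorem gradient_eq (h : IsCollar Ω ρ N r a) {x : Euc d} (hx : x ∈ frontier Ω) :
    gradient ρ x = ‖gradient ρ x‖ • N x := by
  have hd := h.defining x hx
  rw [← h.outerNormal_eq x hx, _root_.outerNormal_eq (hd.le_one (by norm_num)), smul_smul,
    mul_inv_cancel₀ (norm_ne_zero_iff.2 hd.2.2.1), one_smul]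

/-- Points close to the boundary lie on a normal through their nearest boundary point. -/
theorem exists_eq_add_smul_normal (h : IsCollar Ω ρ N r a) {y z : Euc d} (hz : z ∈ frontier Ω)
    {s : ℝ} (hyz : ‖y - z‖ < s) : ∃ x ∈ frontier Ω, ∃ t : ℝ, |t| < s ∧ y = x + t • N x := by
  obtain ⟨x, hx, hmin⟩ := h.isCompact_frontier.exists_isMinOn ⟨z, hz⟩
    (f := fun x => ‖x - y‖ ^ 2) (by fun_prop : Continuous fun x => ‖x - y‖ ^ 2).continuousOn
  have hxy : ‖y - x‖ < s := by
    have h1 : ‖x - y‖ ^ 2 ≤ ‖z - y‖ ^ 2 := hmin hz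
    have h2 := (sq_le_sq₀ (norm_nonneg _) (norm_nonneg _)).1 h1
    rw [norm_sub_rev]
    rw [norm_sub_rev] at hyz
    linarith
  have hd := h.defining x hx
  -- Near x the boundary is the zero set of ρ, so the nearest point is a constrained minimum, and
  -- Lagrange multipliers make x - y parallel to ∇ρ.
  have hext : IsLocalExtrOn (fun x => ‖x - y‖ ^ 2) {w | ρ w = ρ x} x := by
    refine Or.inl ?_
    have hball : Metric.ball x (2 * r) ∈ 𝓝 x := Metric.ball_mem_nhds x (by linarith [h.r_pos])
    filter_upwards [mem_nhdsWithin_of_mem_nhds hball, self_mem_nhdsWithin] with w hw hw'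
    have hw'' : ρ w = 0 := by
      have : ρ w = ρ x := hw'
      rw [this, h.rho_eq_zero hx]
    exact hmin ((h.mem_frontier_iff x hx w (by
      rw [← dist_eq_norm]
      exact (Metric.mem_ball.1 hw).le)).2 hw'')
  have hρs : HasStrictFDerivAt ρ (fderiv ℝ ρ x) x :=
    h.contDiff_rho.contDiffAt.hasStrictFDerivAt (by simp)
  have hφs : HasStrictFDerivAt (fun x => ‖x - y‖ ^ 2) (2 • innerSL ℝ (x - y)) x := by
    have h1 := (hasStrictFDerivAt_norm_sq (x - y)).comp x
      ((hasStrictFDerivAt_id x).sub_const y)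
    rw [ContinuousLinearMap.comp_id] at h1
    exact h1
  obtain ⟨α, β, hαβ, hrel⟩ := hext.exists_multipliers_of_hasStrictFDerivAt_1d hρs hφs
  have hrel' : ∀ v, α * ⟪gradient ρ x, v⟫ + β * (2 * ⟪x - y, v⟫) = 0 := by
    intro v
    have h1 : α * fderiv ℝ ρ x v + β * (2 • ⟪x - y, v⟫) = 0 := DFunLike.congr_fun hrel v
    rwa [fderiv_apply_eq_inner_gradient, nsmul_eq_mul] at h1
  -- With β = 0 the relation would give α ∇ρ = 0, hence α = 0, and both multipliers would vanish.
  have hβ : β ≠ 0 := by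
    rintro rfl
    have h1 := hrel' (gradient ρ x)
    rw [zero_mul, add_zero, real_inner_self_eq_norm_sq] at h1
    have h2 : ‖gradient ρ x‖ ^ 2 ≠ 0 := pow_ne_zero 2 (norm_ne_zero_iff.2 hd.2.2.1)
    have h3 : α = 0 := by simpa [h2] using h1
    exact hαβ (by simp [h3])
  have hyx : y = x + (α / (2 * β) * ‖gradient ρ x‖) • N x := by
    rw [← smul_smul, ← h.gradient_eq hx]
    rw [← sub_eq_zero]
    refine ext_inner_right ℝ fun v => ?_
    have := hrel' v
    rw [inner_sub_left, inner_add_left, inner_smul_left, inner_zero_left]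
    rw [inner_sub_left] at this
    simp only [conj_trivial]
    field_simp
    linarith
  refine ⟨x, hx, _, ?_, hyx⟩
  have h3 : ‖y - x‖ = |α / (2 * β) * ‖gradient ρ x‖| := by
    conv_lhs => rw [hyx]
    rw [add_sub_cancel_left, norm_smul, h.norm_normal x hx, mul_one, Real.norm_eq_abs]
  rw [← h3]
  exact hxy

/-- A `C^1`-small deformation that maps the boundary into itself preserves the sign of the
coordinate along the normals. -/
theorem deformed_mem_iff_neg (h : IsCollar Ω ρ N r a) {C : ℝ} (hC : ∀ y, ‖fderiv ℝ ρ y‖ ≤ C)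
    {F : Euc d → Euc d} (hF : Differentiable ℝ F) (hF0 : ∀ z, ‖F z - z‖ ≤ r)
    (hF1 : ∀ z, C * ‖fderiv ℝ F z - ContinuousLinearMap.id ℝ (Euc d)‖ < a)
    (hFb : ∀ x ∈ frontier Ω, F x ∈ frontier Ω)
    {x : Euc d} (hx : x ∈ frontier Ω) {t : ℝ} (ht : |t| ≤ r) :
    F (x + t • N x) ∈ Ω ↔ t < 0 := by
  have hr := h.r_pos
  have hclose : ∀ τ ∈ Icc (-r) r, ‖F (x + τ • N x) - x‖ ≤ 2 * r := by
    intro τ hτ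
    have e : F (x + τ • N x) - x = (F (x + τ • N x) - (x + τ • N x)) + τ • N x := by abel
    rw [e]
    refine (norm_add_le _ _).trans ?_
    rw [norm_smul, h.norm_normal x hx, mul_one, Real.norm_eq_abs]
    linarith [hF0 (x + τ • N x), abs_le.2 hτ]
  let g : ℝ → ℝ := fun τ => ρ (F (x + τ • N x))
  have hρd : Differentiable ℝ ρ := h.contDiff_rho.differentiable (by simp)
  have hg : ∀ τ, HasDerivAt g (fderiv ℝ ρ (F (x + τ • N x)) (fderiv ℝ F (x + τ • N x) (N x))) τ := by
    intro τ
    have h1 : HasDerivAt (fun τ : ℝ => x + τ • N x) (N x) τ := by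
      simpa using ((hasDerivAt_id τ).smul_const (N x)).const_add x
    exact ((hρd _).hasFDerivAt.comp _ (hF _).hasFDerivAt).comp_hasDerivAt τ h1
  -- The derivative of g is at least a - C ‖DF - I‖ > 0; together with g 0 = 0 this ties the sign of
  -- g to that of t.
  have hmono : StrictMonoOn g (Icc (-r) r) := by
    refine strictMonoOn_of_deriv_pos (convex_Icc _ _)
      (fun τ _ => (hg τ).continuousAt.continuousWithinAt) fun τ hτ => ?_
    rw [interior_Icc] at hτ
    rw [(hg τ).deriv]
    set z := x + τ • N x
    have h1 := h.le_fderiv x hx (F z) (hclose τ ⟨hτ.1.le, hτ.2.le⟩)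
    have e : fderiv ℝ ρ (F z) (fderiv ℝ F z (N x)) = fderiv ℝ ρ (F z) (N x) +
        fderiv ℝ ρ (F z) ((fderiv ℝ F z - ContinuousLinearMap.id ℝ (Euc d)) (N x)) := by
      simp
    have h2 : ‖fderiv ℝ ρ (F z) ((fderiv ℝ F z - ContinuousLinearMap.id ℝ (Euc d)) (N x))‖ ≤
        C * ‖fderiv ℝ F z - ContinuousLinearMap.id ℝ (Euc d)‖ := by
      refine (ContinuousLinearMap.le_opNorm _ _).trans ?_
      gcongr
      · exact (norm_nonneg _).trans (hC 0)
      · exact hC _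
      · refine (ContinuousLinearMap.le_opNorm _ _).trans ?_
        rw [h.norm_normal x hx, mul_one]
    have h3 := (abs_le.1 (Real.norm_eq_abs _ ▸ h2)).1
    rw [e]
    linarith [hF1 z]
  have hg0 : g 0 = 0 := by
    simp only [g, zero_smul, add_zero]
    exact h.rho_eq_zero (hFb x hx)
  have ht' := abs_le.1 ht
  have h00 : (0 : ℝ) ∈ Icc (-r) r := ⟨by linarith, hr.le⟩
  rw [h.mem_iff x hx _ (hclose t ht')]
  have := hmono.lt_iff_lt (a := t) (b := 0) ht' h00
  rw [hg0] at this
  exact this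

/-- A `C^1`-small deformation that maps the boundary into itself maps the inside to the inside and
the outside to the outside. -/
theorem deformed_mem_iff (h : IsCollar Ω ρ N r a) {C : ℝ} (hC : ∀ y, ‖fderiv ℝ ρ y‖ ≤ C)
    {F : Euc d → Euc d} (hF : Differentiable ℝ F) (hF0 : ∀ z, ‖F z - z‖ < r)
    (hF1 : ∀ z, C * ‖fderiv ℝ F z - ContinuousLinearMap.id ℝ (Euc d)‖ < a)
    (hFb : ∀ x ∈ frontier Ω, F x ∈ frontier Ω) (z : Euc d) : z ∈ Ω ↔ F z ∈ Ω := by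
  by_cases hz : ∃ x ∈ frontier Ω, ‖z - x‖ < r
  · obtain ⟨x', hx', hzx'⟩ := hz
    obtain ⟨x, hx, t, ht, rfl⟩ := h.exists_eq_add_smul_normal hx' hzx'
    -- Both memberships reduce to t < 0: for F z by the lemma applied to F, for z by the same lemma
    -- applied to the identity.
    rw [h.deformed_mem_iff_neg hC hF (fun z => (hF0 z).le) hF1 hFb hx ht.le]
    refine h.deformed_mem_iff_neg (F := id) hC differentiable_id ?_ ?_ (fun x hx => hx) hx ht.le
    · simpa using h.r_pos.le
    · simpa [fderiv_id] using h.a_pos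
  -- Away from the boundary, z and F z lie in a ball of radius r that does not meet it.
  · refine IsPreconnected.mem_iff_of_inter_frontier_eq_empty
      (convex_ball z r).isPreconnected ?_ (Metric.mem_ball_self h.r_pos) ?_
    · rw [eq_empty_iff_forall_notMem]
      rintro x ⟨hx, hx'⟩
      refine hz ⟨x, hx', ?_⟩
      rw [← dist_eq_norm, dist_comm]
      exact hx
    · rw [Metric.mem_ball, dist_eq_norm]
      exact hF0 z

end IsCollar

end Collar

/-! ### Nearby domains as normal graphs -/

section NormalGraph

/-- Intersecting such events meets finitely many linear smallness conditions on η at once. -/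
theorem eventually_const_mul_lt {A B : ℝ} (hB : 0 < B) : ∀ᶠ η in 𝓝[>] (0 : ℝ), A * η < B := by
  have h : Tendsto (fun η : ℝ => A * η) (𝓝[>] 0) (𝓝 0) := by
    have : Continuous fun η : ℝ => A * η := by fun_prop
    simpa using (this.tendsto 0).mono_left nhdsWithin_le_nhds
  exact h.eventually (gt_mem_nhds hB)

variable {d : ℕ} {Ω : Set (Euc d)}

/-- The homeomorphism given by an invertible deformation. -/
def deformHomeomorph (θ ψ : Theta d) (h1 : Function.LeftInverse (deform ψ) (deform θ))
    (h2 : Function.RightInverse (deform ψ) (deform θ)) : Euc d ≃ₜ Euc d where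
  toFun := deform θ
  invFun := deform ψ
  left_inv := h1
  right_inv := h2
  continuous_toFun := continuous_deform θ
  continuous_invFun := continuous_deform ψ

theorem mem_frontier_deform_image_iff {θ ψ : Theta d}
    (h1 : Function.LeftInverse (deform ψ) (deform θ))
    (h2 : Function.RightInverse (deform ψ) (deform θ)) (y : Euc d) :
    y ∈ frontier (deform θ '' Ω) ↔ deform ψ y ∈ frontier Ω := by
  have e : frontier (deform θ '' Ω) = deform θ '' frontier Ω :=
    ((deformHomeomorph θ ψ h1 h2).image_frontier Ω).symm
  rw [e]
  constructor
  · rintro ⟨x, hx, rfl⟩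
    rwa [h1 x]
  · intro hy
    exact ⟨_, hy, h2 y⟩

theorem mem_deform_image_iff {θ ψ : Theta d}
    (h1 : Function.LeftInverse (deform ψ) (deform θ))
    (h2 : Function.RightInverse (deform ψ) (deform θ)) (y : Euc d) :
    y ∈ deform θ '' Ω ↔ deform ψ y ∈ Ω := by
  constructor
  · rintro ⟨x, hx, rfl⟩
    rwa [h1 x]
  · intro hy
    exact ⟨_, hy, h2 y⟩

theorem hasFDerivAt_deform (θ : Theta d) (x : Euc d) :
    HasFDerivAt (deform θ) (ContinuousLinearMap.id ℝ (Euc d) + fderiv ℝ θ x) x :=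
  (hasFDerivAt_id x).add (θ.differentiable x).hasFDerivAt

namespace IsCollar

variable {ρ : Euc d → ℝ} {N : Euc d → Euc d} {r a : ℝ}

/-- The difference quotient of the defining function along the normals, as a smooth function. -/
theorem exists_quotient (h : IsCollar Ω ρ N r a) : ∃ q : Euc d × ℝ → ℝ, ContDiff ℝ 3 q ∧
    (∀ x ∈ frontier Ω, ∀ t, ρ (x + t • N x) = t * q (x, t)) ∧
    ∀ x ∈ frontier Ω, ∀ t, |t| ≤ r → a ≤ q (x, t) := by
  have hρ' : ContDiff ℝ 3 (fderiv ℝ ρ) := h.contDiff_rho.fderiv_right (by norm_num)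
  have hN : ContDiff ℝ 3 N := h.contDiff_normal.of_le (by norm_num)
  have hρd : Differentiable ℝ ρ := h.contDiff_rho.differentiable (by simp)
  -- Hadamard's lemma: the integral of this function over [0, 1] is ρ(x + t N) divided by t, and it
  -- is smooth across t = 0.
  let f : (Euc d × ℝ) × ℝ → ℝ := fun p => fderiv ℝ ρ (p.1.1 + (p.2 * p.1.2) • N p.1.1) (N p.1.1)
  have hf : ContDiff ℝ (3 : ℕ) f := by
    have h1 : ContDiff ℝ 3 (fun p : (Euc d × ℝ) × ℝ => N p.1.1) :=
      hN.comp (contDiff_fst.comp contDiff_fst)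
    have h2 : ContDiff ℝ 3 (fun p : (Euc d × ℝ) × ℝ => p.1.1 + (p.2 * p.1.2) • N p.1.1) :=
      (contDiff_fst.comp contDiff_fst).add
        ((contDiff_snd.mul (contDiff_snd.comp contDiff_fst)).smul h1)
    exact (hρ'.comp h2).clm_apply h1
  have hline : ∀ (x : Euc d) (t : ℝ), Continuous fun s : ℝ => f ((x, t), s) := fun x t =>
    hf.continuous.comp (by fun_prop)
  refine ⟨fun p => ∫ s in (0 : ℝ)..1, f (p, s), contDiff_parametric_integral 3 f hf, ?_, ?_⟩
  · intro x hx t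
    have hd : ∀ s : ℝ, HasDerivAt (fun s : ℝ => ρ (x + (s * t) • N x)) (t * f ((x, t), s)) s := by
      intro s
      have h1 : HasDerivAt (fun s : ℝ => x + (s * t) • N x) (t • N x) s := by
        have := (((hasDerivAt_id s).mul_const t).smul_const (N x)).const_add x
        simpa using this
      have h2 := (hρd (x + (s * t) • N x)).hasFDerivAt.comp_hasDerivAt s h1
      rw [map_smul, smul_eq_mul] at h2
      exact h2
    have h3 := intervalIntegral.integral_eq_sub_of_hasDerivAt (a := 0) (b := 1)
      (fun s _ => hd s) (((hline x t).const_mul t).intervalIntegrable _ _)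
    rw [intervalIntegral.integral_const_mul] at h3
    rw [h3]
    simp [h.rho_eq_zero hx]
  · intro x hx t ht
    have h1 : ∫ _ in (0 : ℝ)..1, a ≤ ∫ s in (0 : ℝ)..1, f ((x, t), s) := by
      refine intervalIntegral.integral_mono_on zero_le_one intervalIntegrable_const
        ((hline x t).intervalIntegrable _ _) fun s hs => ?_
      refine h.le_fderiv x hx _ ?_
      rw [add_sub_cancel_left, norm_smul, h.norm_normal x hx, mul_one, Real.norm_eq_abs, abs_mul,
        abs_of_nonneg hs.1]
      have := h.r_pos
      nlinarith [hs.2, abs_nonneg t, hs.1]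
    simpa using h1

/-- Deformations of a collared domain by a small field are normal deformations by a small field. -/
theorem exists_normal_graph (h : IsCollar Ω ρ N r a) : ∃ M, 0 ≤ M ∧ ∃ η > 0, ∀ θ ψ : Theta d,
    Function.LeftInverse (deform ψ) (deform θ) → Function.RightInverse (deform ψ) (deform θ) →
    ‖θ‖ ≤ η → ‖ψ‖ ≤ η → ∃ (ζ : Theta d) (g : Euc d → ℝ), ContDiff ℝ 3 g ∧
      (∀ x, ζ x = g x • N x) ∧ ‖ζ‖ ≤ M * ‖ψ‖ ∧ (∀ x, |g x| < r) ∧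
      (∀ x ∈ frontier Ω, ∀ t, |t| < r → (x + t • N x ∈ frontier (deform θ '' Ω) ↔ t = g x)) ∧
      frontier (deform θ '' Ω) = (fun x => x + g x • N x) '' frontier Ω ∧
      deform ζ '' Ω = deform θ '' Ω := by
  have hr := h.r_pos
  have ha := h.a_pos
  obtain ⟨q, hq, hρq, hqa⟩ := h.exists_quotient
  have hK : IsCompact (frontier Ω ×ˢ Icc (-r) r) := h.isCompact_frontier.prod isCompact_Icc
  obtain ⟨C, hC⟩ := exists_ckBounded_of_hasCompactSupport (n := 4)
    (h.contDiff_rho.of_le (by norm_num)) h.hasCompactSupport_rho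
  obtain ⟨CN, hCN⟩ := exists_ckBounded_of_hasCompactSupport (n := 3)
    (h.contDiff_normal.of_le (by norm_num)) h.hasCompactSupport_normal
  -- The expressions t N(x) and 1/q(x, t) matter only for x on the boundary and |t| ≤ r. They are
  -- replaced by compactly supported Q and c, to obtain global derivative bounds.
  obtain ⟨Q, hQ, hQc, hQeq⟩ := exists_contDiff_extension (n := 3) hK isOpen_univ (subset_univ _)
    (f := fun p : Euc d × ℝ => p.2 • N p.1)
    ((contDiff_snd.smul (hCN.1.comp contDiff_fst)).contDiffOn)
  obtain ⟨CQ, hCQ⟩ := exists_ckBounded_of_hasCompactSupport hQ hQc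
  obtain ⟨c, hc, hcc, hceq⟩ := exists_contDiff_extension (n := 3) hK
    (isOpen_ne_fun hq.continuous continuous_const : IsOpen {p | q p ≠ 0})
    (by
      rintro ⟨x, t⟩ ⟨hx, ht⟩
      exact (lt_of_lt_of_le ha (hqa x hx t (abs_le.2 ht))).ne')
    (f := fun p : Euc d × ℝ => (q p)⁻¹) (hq.contDiffOn.inv fun p hp => hp)
  obtain ⟨Cc, hCc⟩ := exists_ckBounded_of_hasCompactSupport hc hcc
  obtain ⟨M1, hM1, hcomp⟩ := exists_ckBounded_comp_add_sub.{0} 3 C 1 hC.nonneg le_rfl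
  obtain ⟨M3, hM3, himp⟩ := exists_implicit_ckBounded.{0} 2
  obtain ⟨M4, hM4, η4, hη4, hinv⟩ := exists_inverse_deform d
  have hCQ0 := hCQ.nonneg
  have hCc0 := hCc.nonneg
  have hCN0 := hCN.nonneg
  have hC0 := hC.nonneg
  set M2 : ℝ := 2 ^ 3 * (Cc * (Nat.factorial 3 * M1 * (1 + CQ) ^ 3)) with hM2
  have hM20 : 0 ≤ M2 := by positivity
  set M : ℝ := 2 ^ 3 * (M3 * M2 * CN) with hM
  have hM0 : 0 ≤ M := by positivity
  -- In order: ‖ψ‖ ≤ 1 for the composition estimate, E at most 1/4 for the implicit function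
  -- theorem, |g| < r, ‖ψ‖ < r, invertibility of I + ζ, displacement of (I + ψ)(I + ζ) below r, and
  -- its derivative close to I.
  obtain ⟨η, h1, h2, h3, h4, h5, h6, h7, hη0⟩ := (((eventually_const_mul_lt (A := 1) one_pos).and <|
    (eventually_const_mul_lt (A := M2) (by norm_num : (0 : ℝ) < 1 / 4)).and <|
    (eventually_const_mul_lt (A := M3 * M2) hr).and <|
    (eventually_const_mul_lt (A := 1) hr).and <|
    (eventually_const_mul_lt (A := M) hη4).and <|
    (eventually_const_mul_lt (A := M + 1) hr).and <|
    (eventually_const_mul_lt (A := C * (1 + 2 * M)) ha).and self_mem_nhdsWithin)).exists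
  replace hη0 : 0 < η := hη0
  rw [one_mul] at h1 h4
  refine ⟨M, hM0, η, hη0, fun θ ψ hl hrinv hθ hψ => ?_⟩
  have hψ0 := norm_nonneg ψ
  have hφ : CkBounded 3 (M1 * ‖ψ‖) (fun y => ρ (y + ψ y) - ρ y) :=
    hcomp ρ (fun y => y) ψ ‖ψ‖ hC
      (derivBounded_of_hasFDerivAt_const (ContinuousLinearMap.id ℝ (Euc d))
        ContinuousLinearMap.norm_id_le fun x => hasFDerivAt_id x)
      ψ.ckBounded (hψ.trans h1.le)
  have hY : DerivBounded 3 (1 + CQ) (fun p : Euc d × ℝ => p.1 + Q p) :=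
    (ContinuousLinearMap.derivBounded (ContinuousLinearMap.fst ℝ (Euc d) ℝ)
      (ContinuousLinearMap.norm_fst_le ℝ _ _)).add hCQ.derivBounded
  have hE := hCc.smul (hφ.comp hY (by linarith))
  -- The increment of ρ under I + ψ at x + t N, divided by q.
  set E : Euc d × ℝ → ℝ :=
    fun p => c p • ((fun y => ρ (y + ψ y) - ρ y) ∘ fun p : Euc d × ℝ => p.1 + Q p) p with hEdef
  have hE' : CkBounded 3 (M2 * ‖ψ‖) E := hE.mono (le_of_eq (by rw [hM2]; ring))
  obtain ⟨g, hg, hgb⟩ := himp E (M2 * ‖ψ‖) hE'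
    ((mul_le_mul_of_nonneg_left hψ hM20).trans h2.le)
  have hζ := hgb.smul hCN
  have hζ' : CkBounded 3 (M * ‖ψ‖) (fun x => g x • N x) := hζ.mono (le_of_eq (by rw [hM]; ring))
  set ζ : Theta d := hζ'.toTheta with hζdef
  have hζN : ∀ x, ζ x = g x • N x := fun x => rfl
  have hζn : ‖ζ‖ ≤ M * ‖ψ‖ := hζ'.norm_toTheta_le
  have hMη : M * ‖ψ‖ ≤ M * η := mul_le_mul_of_nonneg_left hψ hM0
  have hgr : ∀ x, |g x| < r := by
    intro x
    have h8 := hgb.norm_le x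
    rw [Real.norm_eq_abs] at h8
    have h9 := mul_le_mul_of_nonneg_left hψ (mul_nonneg hM3 hM20)
    linarith
  have hfr : ∀ x ∈ frontier Ω, ∀ t, |t| < r →
      (x + t • N x ∈ frontier (deform θ '' Ω) ↔ t = g x) := by
    intro x hx t ht
    have hmem : (x, t) ∈ frontier Ω ×ˢ Icc (-r) r := ⟨hx, abs_le.1 ht.le⟩
    have hQx : Q (x, t) = t • N x := hQeq.self_of_nhdsSet _ hmem
    have hcx : c (x, t) = (q (x, t))⁻¹ := hceq.self_of_nhdsSet _ hmem
    have hq0 : q (x, t) ≠ 0 := (lt_of_lt_of_le ha (hqa x hx t ht.le)).ne'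
    rw [mem_frontier_deform_image_iff hl hrinv, ← hg x t, deform,
      h.mem_frontier_iff x hx _ ?_]
    -- Since q ≠ 0 here, ρ vanishes at the pulled back point if and only if t + E(x, t) = 0.
    · have e : ρ (x + t • N x + ψ (x + t • N x)) = q (x, t) * (t + E (x, t)) := by
        simp only [hEdef, Function.comp_apply, hQx, hcx, smul_eq_mul]
        rw [mul_add, mul_inv_cancel_left₀ hq0, mul_comm (q (x, t)) t, ← hρq x hx t]
        ring
      rw [e]
      simp [hq0]
    · have e : x + t • N x + ψ (x + t • N x) - x = t • N x + ψ (x + t • N x) := by abel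
      rw [e]
      refine (norm_add_le _ _).trans ?_
      rw [norm_smul, h.norm_normal x hx, mul_one, Real.norm_eq_abs]
      linarith [ψ.norm_apply_le (x + t • N x)]
  have hfr_eq : frontier (deform θ '' Ω) = (fun x => x + g x • N x) '' frontier Ω := by
    ext y
    constructor
    · intro hy
      have hz := (mem_frontier_deform_image_iff hl hrinv y).1 hy
      -- Every point of the new boundary is within r of the old one, hence lies on some normal
      -- segment; none escapes the graph.
      have hyz : ‖y - deform ψ y‖ < r := by
        have : y - deform ψ y = -ψ y := by simp [deform]
        rw [this, norm_neg]
        linarith [ψ.norm_apply_le y]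
      obtain ⟨x, hx, t, ht, rfl⟩ := h.exists_eq_add_smul_normal hz hyz
      refine ⟨x, hx, ?_⟩
      rw [(hfr x hx t ht).1 hy]
    · rintro ⟨x, hx, rfl⟩
      exact (hfr x hx (g x) (hgr x)).2 rfl
  refine ⟨ζ, g, hgb.1, hζN, hζn, hgr, hfr, hfr_eq, ?_⟩
  -- Surjectivity of I + ζ, used for the inclusion of the given domain in the image.
  obtain ⟨ψ', -, hψ', -⟩ := hinv ζ (by linarith)
  have hFd : ∀ z, HasFDerivAt (fun z => deform ψ (deform ζ z))
      ((ContinuousLinearMap.id ℝ (Euc d) + fderiv ℝ ψ (deform ζ z)).comp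
        (ContinuousLinearMap.id ℝ (Euc d) + fderiv ℝ ζ z)) z := fun z =>
    (hasFDerivAt_deform ψ (deform ζ z)).comp z (hasFDerivAt_deform ζ z)
  -- Equal boundaries do not by themselves give equal domains. The composition (I + ψ)(I + ζ) is
  -- C¹-close to the identity and maps the boundary into itself, so it also preserves the sides.
  have hside : ∀ z, z ∈ Ω ↔ deform ψ (deform ζ z) ∈ Ω := by
    refine h.deformed_mem_iff (C := C)
      (fun y => (hC.of_le (l := 0 + 1) (by omega)).norm_fderiv_le y)
      (fun z => (hFd z).differentiableAt) ?_ ?_ ?_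
    · intro z
      have e : deform ψ (deform ζ z) - z = ζ z + ψ (deform ζ z) := by
        simp only [deform]
        abel
      rw [e]
      refine lt_of_le_of_lt (norm_add_le _ _) ?_
      linarith [ζ.norm_apply_le z, ψ.norm_apply_le (deform ζ z)]
    · intro z
      rw [(hFd z).fderiv]
      have e : (ContinuousLinearMap.id ℝ (Euc d) + fderiv ℝ ψ (deform ζ z)).comp
          (ContinuousLinearMap.id ℝ (Euc d) + fderiv ℝ ζ z) - ContinuousLinearMap.id ℝ (Euc d) =
          fderiv ℝ ζ z + (fderiv ℝ ψ (deform ζ z) +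
            (fderiv ℝ ψ (deform ζ z)).comp (fderiv ℝ ζ z)) := by
        ext1 v
        simp
        abel
      rw [e]
      have h8 : ‖fderiv ℝ ζ z‖ ≤ M * η := (ζ.norm_fderiv_le z).trans (hζn.trans hMη)
      have h9 : ‖fderiv ℝ ψ (deform ζ z)‖ ≤ η := (ψ.norm_fderiv_le _).trans hψ
      have h10 : ‖(fderiv ℝ ψ (deform ζ z)).comp (fderiv ℝ ζ z)‖ ≤ 1 * (M * η) :=
        (ContinuousLinearMap.opNorm_comp_le _ _).trans
          (mul_le_mul (h9.trans h1.le) h8 (norm_nonneg _) zero_le_one)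
      have h11 := norm_add_le (fderiv ℝ ζ z) (fderiv ℝ ψ (deform ζ z) +
            (fderiv ℝ ψ (deform ζ z)).comp (fderiv ℝ ζ z))
      have h12 := norm_add_le (fderiv ℝ ψ (deform ζ z))
            ((fderiv ℝ ψ (deform ζ z)).comp (fderiv ℝ ζ z))
      refine lt_of_le_of_lt (mul_le_mul_of_nonneg_left (b := _) (c := (1 + 2 * M) * η) ?_ hC0) ?_
      · linarith
      · linarith
    · intro x hx
      rw [← mem_frontier_deform_image_iff hl hrinv]
      exact (hfr x hx (g x) (hgr x)).2 rfl
  ext y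
  rw [mem_deform_image_iff hl hrinv]
  constructor
  · rintro ⟨z, hz, rfl⟩
    exact (hside z).1 hz
  · intro hy
    refine ⟨deform ψ' y, (hside _).2 ?_, hψ' y⟩
    rwa [hψ' y]

end IsCollar

end NormalGraph

/-! ### Taylor expansion of the shape functional along a ray -/

section ShapeDerivative

variable {d : ℕ} {Ω : Set (Euc d)} {J : Set (Euc d) → ℝ}

theorem dTheta_le_of_inverse {θ ψ : Theta d} (h1 : Function.LeftInverse (deform ψ) (deform θ))
    (h2 : Function.RightInverse (deform ψ) (deform θ)) :
    dTheta Ω (deform θ '' Ω) ≤ ENNReal.ofReal (‖θ‖ + ‖ψ‖) :=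
  iInf_le_of_le θ <| iInf_le_of_le ψ <| iInf_le_of_le h1 <| iInf_le_of_le h2 <| iInf_le _ rfl

/-- The second derivative of a shape functional along a ray of deformations. -/
theorem ray_derivatives (hJ : IsTwiceShapeDifferentiableAt J Ω) (ξ : Theta d) :
    (∀ᶠ s in 𝓝 (0 : ℝ), HasDerivAt (fun s : ℝ => J (deform (s • ξ) '' Ω))
      (fderiv ℝ (shapeFun J Ω) (s • ξ) ξ) s) ∧
    HasDerivAt (deriv fun s : ℝ => J (deform (s • ξ) '' Ω))
      (fderiv ℝ (fderiv ℝ (shapeFun J Ω)) 0 ξ ξ) 0 := by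
  have hline : ∀ s : ℝ, HasDerivAt (fun s : ℝ => s • ξ) ξ s := fun s => by
    simpa using (hasDerivAt_id s).smul_const ξ
  have hc : Tendsto (fun s : ℝ => s • ξ) (𝓝 0) (𝓝 0) := by
    have : Continuous fun s : ℝ => s • ξ := by fun_prop
    simpa using this.tendsto 0
  have h1 : ∀ᶠ s in 𝓝 (0 : ℝ), HasDerivAt (fun s : ℝ => J (deform (s • ξ) '' Ω))
      (fderiv ℝ (shapeFun J Ω) (s • ξ) ξ) s := by
    filter_upwards [hc.eventually hJ.1] with s hs
    exact hs.hasFDerivAt.comp_hasDerivAt s (hline s)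
  refine ⟨h1, ?_⟩
  have h2 : HasDerivAt (fun s : ℝ => fderiv ℝ (shapeFun J Ω) (s • ξ))
      (fderiv ℝ (fderiv ℝ (shapeFun J Ω)) 0 ξ) 0 := by
    have h3 : HasFDerivAt (fderiv ℝ (shapeFun J Ω)) (fderiv ℝ (fderiv ℝ (shapeFun J Ω)) 0)
        ((0 : ℝ) • ξ) := by
      rw [zero_smul]
      exact hJ.2.hasFDerivAt
    exact h3.comp_hasDerivAt 0 (hline 0)
  have h4 : HasDerivAt (fun s : ℝ => fderiv ℝ (shapeFun J Ω) (s • ξ) ξ)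
      (fderiv ℝ (fderiv ℝ (shapeFun J Ω)) 0 ξ ξ) 0 := by
    have := h2.clm_apply (hasDerivAt_const (0 : ℝ) ξ)
    simpa using this
  exact h4.congr_of_eventuallyEq (h1.mono fun s hs => hs.deriv)

/-- The deformation by `(t + s) θ` is the deformation by `t θ` followed by that by `s ξ`, where
`ξ = θ ∘ (I + t θ)⁻¹`. -/
theorem exists_transported_field {θ ψ : Theta d} {t : ℝ}
    (h1 : Function.LeftInverse (deform ψ) (deform (t • θ))) :
    ∃ ξ : Theta d, ∀ s : ℝ, deform ((t + s) • θ) '' Ω = deform (s • ξ) '' (deform (t • θ) '' Ω) := by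
  have hψ : DerivBounded 3 (1 + ‖ψ‖) (deform ψ) :=
    (derivBounded_of_hasFDerivAt_const (ContinuousLinearMap.id ℝ (Euc d))
      ContinuousLinearMap.norm_id_le fun x => hasFDerivAt_id x).add ψ.ckBounded.derivBounded
  have hξ := θ.ckBounded.comp hψ (by linarith [norm_nonneg ψ])
  refine ⟨hξ.toTheta, fun s => ?_⟩
  rw [image_image]
  refine image_congr fun x _ => ?_
  simp only [deform, Theta.smul_apply, hξ.coe_toTheta, Function.comp_apply]
  have h2 := h1 x
  simp only [deform, Theta.smul_apply] at h2
  rw [h2, add_smul, add_assoc]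

/-- Differentiability is known for each shape only at the zero field. Transporting θ to the shape at
time t makes the ray near t a ray issuing from that shape. -/
theorem ray_derivatives_along {θ ψ : Theta d} {t : ℝ}
    (h1 : Function.LeftInverse (deform ψ) (deform (t • θ)))
    (hJ : IsTwiceShapeDifferentiableAt J (deform (t • θ) '' Ω)) :
    (∀ᶠ τ in 𝓝 t, DifferentiableAt ℝ (fun τ : ℝ => J (deform (τ • θ) '' Ω)) τ) ∧
      DifferentiableAt ℝ (deriv fun τ : ℝ => J (deform (τ • θ) '' Ω)) t := by
  obtain ⟨ξ, hξ⟩ := exists_transported_field (Ω := Ω) h1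
  obtain ⟨h2, h3⟩ := ray_derivatives hJ ξ
  obtain ⟨f, hf⟩ : ∃ f : ℝ → ℝ, f = fun s => J (deform (s • ξ) '' (deform (t • θ) '' Ω)) :=
    ⟨_, rfl⟩
  rw [← hf] at h2 h3
  have e : (fun τ : ℝ => J (deform (τ • θ) '' Ω)) = fun τ => f (τ - t) := by
    funext τ
    simp only [hf]
    rw [← hξ (τ - t), add_sub_cancel]
  have hsub : Tendsto (fun τ : ℝ => τ - t) (𝓝 t) (𝓝 0) := by
    have : Continuous fun τ : ℝ => τ - t := by fun_prop
    simpa using this.tendsto t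
  rw [e]
  clear e hξ
  have hs : ∀ τ, DifferentiableAt ℝ (fun τ : ℝ => τ - t) τ := fun τ => by fun_prop
  constructor
  · filter_upwards [hsub.eventually h2] with τ hτ
    exact DifferentiableAt.comp τ (g := f) (f := fun τ => τ - t) hτ.differentiableAt (hs τ)
  · have e' : deriv (fun τ => f (τ - t)) = fun τ => deriv f (τ - t) := by
      funext τ
      exact deriv_comp_sub_const f t τ
    rw [e']
    have h4 : DifferentiableAt ℝ (deriv f) (t - t) := by
      rw [sub_self]
      exact h3.differentiableAt
    exact DifferentiableAt.comp t (g := deriv f) (f := fun τ => τ - t) h4 (hs t)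

/-- A second-order Taylor inequality. -/
theorem taylor_lower_bound {j : ℝ → ℝ} {κ : ℝ}
    (h1 : ∀ t ∈ Icc (0 : ℝ) 1, DifferentiableAt ℝ j t)
    (h2 : ∀ t ∈ Icc (0 : ℝ) 1, DifferentiableAt ℝ (deriv j) t) (h0 : deriv j 0 = 0)
    (h3 : ∀ t ∈ Icc (0 : ℝ) 1, κ ≤ deriv (deriv j) t) : j 0 + κ / 2 ≤ j 1 := by
  -- Monotonicity is used twice instead of an integral remainder, since j'' need not be integrable.
  have hm1 : ∀ t ∈ Icc (0 : ℝ) 1, κ * t ≤ deriv j t := by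
    have hmono : MonotoneOn (fun t => deriv j t - κ * t) (Icc 0 1) := by
      have hd : ∀ t ∈ Icc (0 : ℝ) 1, HasDerivAt (fun t => deriv j t - κ * t)
          (deriv (deriv j) t - κ) t := fun t ht => by
        have h4 := (h2 t ht).hasDerivAt.sub ((hasDerivAt_id t).const_mul κ)
        rw [mul_one] at h4
        exact h4
      refine monotoneOn_of_deriv_nonneg (convex_Icc 0 1)
        (fun t ht => (hd t ht).continuousAt.continuousWithinAt)
        (fun t ht => (hd t (interior_subset ht)).differentiableAt.differentiableWithinAt)
        fun t ht => ?_
      rw [(hd t (interior_subset ht)).deriv]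
      linarith [h3 t (interior_subset ht)]
    intro t ht
    have := hmono (left_mem_Icc.2 zero_le_one) ht ht.1
    simp only [h0, mul_zero, sub_zero] at this
    linarith
  have hmono : MonotoneOn (fun t => j t - κ / 2 * t ^ 2) (Icc 0 1) := by
    have hd : ∀ t ∈ Icc (0 : ℝ) 1, HasDerivAt (fun t => j t - κ / 2 * t ^ 2)
        (deriv j t - κ * t) t := fun t ht => by
      convert! (h1 t ht).hasDerivAt.sub ((hasDerivAt_pow 2 t).const_mul (κ / 2)) using 1
      simp
      ring
    refine monotoneOn_of_deriv_nonneg (convex_Icc 0 1)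
      (fun t ht => (hd t ht).continuousAt.continuousWithinAt)
      (fun t ht => (hd t (interior_subset ht)).differentiableAt.differentiableWithinAt)
      fun t ht => ?_
    rw [(hd t (interior_subset ht)).deriv]
    linarith [hm1 t (interior_subset ht)]
  have := hmono (left_mem_Icc.2 zero_le_one) (right_mem_Icc.2 zero_le_one) zero_le_one
  simp only at this
  linarith

/-- At a critical shape, the second derivative of the shape functional bounds its variation from
below along small rays, up to the oscillation of the second derivative. -/
theorem exists_shape_taylor
    (hJ : ∃ ρ > 0, ∀ Ω' : Set (Euc d), dTheta Ω Ω' < ρ → IsTwiceShapeDifferentiableAt J Ω')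
    (hcrit : IsCritical J Ω) :
    ∃ η > 0, ∀ θ : Theta d, ‖θ‖ ≤ η → ∀ m : ℝ,
      (∀ t ∈ Icc (0 : ℝ) 1, |iteratedDeriv 2 (fun τ : ℝ => J (deform (τ • θ) '' Ω)) t -
        iteratedDeriv 2 (fun τ : ℝ => J (deform (τ • θ) '' Ω)) 0| ≤ m) →
      J Ω + (fderiv ℝ (fderiv ℝ (shapeFun J Ω)) 0 θ θ - m) / 2 ≤ J (deform θ '' Ω) := by
  obtain ⟨ρ, hρ, hJ⟩ := hJ
  obtain ⟨M, hM, η₀, hη₀, hinv⟩ := exists_inverse_deform d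
  obtain ⟨ε, hε, hερ⟩ := ENNReal.lt_iff_exists_nnreal_btwn.1 hρ
  replace hε : 0 < (ε : ℝ) := by exact_mod_cast hε
  -- On the whole ray the field and its inverse have norms summing to at most (1 + M)‖θ‖ ≤ ε, so
  -- every shape on it lies in the region of differentiability.
  refine ⟨min η₀ (ε / (1 + M)), lt_min hη₀ (by positivity), fun θ hθ m hm => ?_⟩
  have hray : ∀ t ∈ Icc (0 : ℝ) 1, ∃ ψ : Theta d,
      Function.LeftInverse (deform ψ) (deform (t • θ)) ∧
      IsTwiceShapeDifferentiableAt J (deform (t • θ) '' Ω) := by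
    intro t ht
    have h1 : ‖t • θ‖ ≤ ‖θ‖ := by
      rw [norm_smul, Real.norm_of_nonneg ht.1]
      exact mul_le_of_le_one_left (norm_nonneg _) ht.2
    obtain ⟨ψ, hl, hr, hψ⟩ := hinv (t • θ) (h1.trans (hθ.trans (min_le_left _ _)))
    refine ⟨ψ, hl, hJ _ ((dTheta_le_of_inverse hl hr).trans_lt (lt_of_le_of_lt ?_ hερ))⟩
    rw [← ENNReal.ofReal_coe_nnreal]
    refine ENNReal.ofReal_le_ofReal ?_
    have h2 : ‖θ‖ ≤ ε / (1 + M) := hθ.trans (min_le_right _ _)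
    rw [le_div_iff₀ (by positivity)] at h2
    nlinarith
  set j : ℝ → ℝ := fun τ => J (deform (τ • θ) '' Ω) with hj
  have hd : ∀ t ∈ Icc (0 : ℝ) 1, (∀ᶠ τ in 𝓝 t, DifferentiableAt ℝ j τ) ∧
      DifferentiableAt ℝ (deriv j) t := fun t ht => by
    obtain ⟨ψ, hl, hJt⟩ := hray t ht
    exact ray_derivatives_along hl hJt
  have hit : iteratedDeriv 2 j = deriv (deriv j) := by
    rw [iteratedDeriv_succ, iteratedDeriv_one]
  have hΩ : IsTwiceShapeDifferentiableAt J Ω := by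
    obtain ⟨ψ, -, h⟩ := hray 0 (left_mem_Icc.2 zero_le_one)
    rwa [zero_smul, deform_zero] at h
  obtain ⟨h0, h00⟩ := ray_derivatives hΩ θ
  have hj0 : deriv j 0 = 0 := by
    have h1 := h0.self_of_nhds
    rw [zero_smul, hcrit.fderiv] at h1
    simpa using h1.deriv
  have key := taylor_lower_bound (j := j)
    (κ := fderiv ℝ (fderiv ℝ (shapeFun J Ω)) 0 θ θ - m)
    (fun t ht => (hd t ht).1.self_of_nhds) (fun t ht => (hd t ht).2) hj0 (fun t ht => by
      have h1 := (abs_le.1 (hm t ht)).1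
      rw [hit, h00.deriv] at h1
      linarith)
  simpa [hj, deform_zero] using key

end ShapeDerivative

/-! ### Bi-Lipschitz charts and the surface measure -/

section BoundaryCharts

variable {d : ℕ} {Ω : Set (Euc d)}

/-- A bi-Lipschitz parametrization of a piece of the boundary by a ball. -/
structure BoundaryChart (Ω : Set (Euc d)) where
  toFun : Euc (d - 1) → Euc d
  proj : Euc d → Euc (d - 1)
  R : ℝ
  L : NNReal
  R_pos : 0 < R
  contDiffOn : ContDiffOn ℝ 1 toFun (Metric.ball 0 (2 * R))
  lipschitzOn : LipschitzOnWith L toFun (Metric.ball 0 (2 * R))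
  lipschitz_proj : LipschitzWith 1 proj
  proj_apply : ∀ u ∈ Metric.ball 0 (2 * R), proj (toFun u) = u
  mem_frontier : ∀ u ∈ Metric.ball 0 (2 * R), toFun u ∈ frontier Ω
  tangent : ∀ u ∈ Metric.ball 0 (2 * R), ∀ w,
    ⟪outerNormal Ω (toFun u), fderiv ℝ toFun u w⟫ = 0

namespace IsCollar

variable {ρ : Euc d → ℝ} {N : Euc d → Euc d} {r a : ℝ}

theorem exists_boundaryChart (h : IsCollar Ω ρ N r a) {x₀ : Euc d} (hx₀ : x₀ ∈ frontier Ω) :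
    ∃ (c : BoundaryChart Ω) (V : Set (Euc d)), IsOpen V ∧ x₀ ∈ V ∧
      V ∩ frontier Ω ⊆ c.toFun '' Metric.closedBall 0 (c.R / 2) := by
  have hN1 := h.norm_normal x₀ hx₀
  have hN0 : N x₀ ≠ 0 := norm_ne_zero_iff.1 (by rw [hN1]; exact one_ne_zero)
  -- The nonzero normal forces d ≥ 1, so the subtraction is not truncated.
  have hd : Module.finrank ℝ (Euc d) = (d - 1) + 1 := by
    have : 0 < Module.finrank ℝ (Euc d) := Module.finrank_pos_iff_exists_ne_zero.2 ⟨_, hN0⟩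
    rw [finrank_euclideanSpace_fin] at this ⊢
    omega
  have : Fact (Module.finrank ℝ (Euc d) = (d - 1) + 1) := ⟨hd⟩
  let ι : (ℝ ∙ N x₀)ᗮ ≃ₗᵢ[ℝ] Euc (d - 1) :=
    (OrthonormalBasis.fromOrthogonalSpanSingleton (𝕜 := ℝ) (d - 1) hN0).repr
  let Q : Euc d →L[ℝ] Euc (d - 1) :=
    (ι.toContinuousLinearEquiv : (ℝ ∙ N x₀)ᗮ →L[ℝ] Euc (d - 1)).comp
      ((ℝ ∙ N x₀)ᗮ).orthogonalProjectionOnto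
  have hQ1 : ∀ v, ‖Q v‖ ≤ ‖v‖ := by
    intro v
    have h1 : ‖Q v‖ = ‖((ℝ ∙ N x₀)ᗮ).orthogonalProjectionOnto v‖ := ι.norm_map _
    rw [h1]
    exact Submodule.norm_orthogonalProjectionOnto_apply_le _ v
  have hQ0 : ∀ v, Q v = 0 → v ∈ (ℝ ∙ N x₀) := by
    intro v hv
    have h1 : ((ℝ ∙ N x₀)ᗮ).orthogonalProjectionOnto v = 0 := by
      have : ι (((ℝ ∙ N x₀)ᗮ).orthogonalProjectionOnto v) = 0 := hv
      simpa using this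
    rw [Submodule.orthogonalProjectionOnto_eq_zero_iff, Submodule.orthogonal_orthogonal] at h1
    exact h1
  -- Tangential coordinates together with ρ straighten the boundary; the chart is the local inverse
  -- restricted to ρ = 0. Its left inverse is an orthogonal projection, hence 1-Lipschitz.
  let f : Euc d → Euc (d - 1) × ℝ := fun x => (Q (x - x₀), ρ x)
  let A : Euc d →L[ℝ] Euc (d - 1) × ℝ := Q.prod (fderiv ℝ ρ x₀)
  have hAinj : Function.Injective A := by
    rw [injective_iff_map_eq_zero]
    intro v hv
    have h1 : Q v = 0 := congrArg Prod.fst hv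
    have h2 : fderiv ℝ ρ x₀ v = 0 := congrArg Prod.snd hv
    obtain ⟨t, rfl⟩ := Submodule.mem_span_singleton.1 (hQ0 v h1)
    have h3 := h.le_fderiv x₀ hx₀ x₀ (by simpa using h.r_pos.le)
    have h4 := h.a_pos
    rw [map_smul, smul_eq_mul, mul_eq_zero] at h2
    rcases h2 with h2 | h2
    · rw [h2, zero_smul]
    · linarith
  have hdim : Module.finrank ℝ (Euc d) = Module.finrank ℝ (Euc (d - 1) × ℝ) := by
    rw [Module.finrank_prod, hd, finrank_euclideanSpace_fin, Module.finrank_self]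
  let A' : Euc d ≃L[ℝ] (Euc (d - 1) × ℝ) :=
    (LinearMap.linearEquivOfInjective (A : Euc d →ₗ[ℝ] Euc (d - 1) × ℝ) hAinj hdim).toContinuousLinearEquiv
  have hA' : (A' : Euc d →L[ℝ] Euc (d - 1) × ℝ) = A := by
    ext1 v
    rfl
  have hf : ContDiff ℝ 1 f :=
    (Q.contDiff.comp (contDiff_id.sub contDiff_const)).prodMk (h.contDiff_rho.of_le (by norm_num))
  have hρd : Differentiable ℝ ρ := h.contDiff_rho.differentiable (by simp)
  have hfd : HasFDerivAt f (A' : Euc d →L[ℝ] Euc (d - 1) × ℝ) x₀ := by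
    rw [hA']
    have h1 : HasFDerivAt (fun x => Q (x - x₀)) Q x₀ := by
      have := Q.hasFDerivAt.comp x₀ ((hasFDerivAt_id x₀).sub_const x₀)
      rwa [ContinuousLinearMap.comp_id] at this
    exact h1.prodMk (hρd x₀).hasFDerivAt
  have hfx₀ : f x₀ = (0, 0) := by simp [f, h.rho_eq_zero hx₀]
  let e := hf.contDiffAt.toOpenPartialHomeomorph f hfd one_ne_zero
  have he : ∀ x, e x = f x := fun x => rfl
  have hsrc : x₀ ∈ e.source := hf.contDiffAt.mem_toOpenPartialHomeomorph_source hfd one_ne_zero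
  have htgt : ((0, 0) : Euc (d - 1) × ℝ) ∈ e.target := by
    have := hf.contDiffAt.image_mem_toOpenPartialHomeomorph_target hfd one_ne_zero
    rwa [hfx₀] at this
  have hsymm0 : e.symm (0, 0) = x₀ := by
    rw [← hfx₀, ← he]
    exact e.left_inv hsrc
  have hsymm : ContDiffAt ℝ 1 e.symm ((0, 0) : Euc (d - 1) × ℝ) := by
    have := hf.contDiffAt.to_localInverse hfd one_ne_zero
    rw [hfx₀] at this
    exact this
  let γ : Euc (d - 1) → Euc d := fun u => e.symm (u, 0)
  have hincl : ContDiff ℝ 1 (fun u : Euc (d - 1) => ((u, 0) : Euc (d - 1) × ℝ)) :=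
    contDiff_id.prodMk contDiff_const
  have hγ0 : ContDiffAt ℝ 1 γ 0 :=
    ContDiffAt.comp (0 : Euc (d - 1)) (g := e.symm)
      (f := fun u : Euc (d - 1) => ((u, 0) : Euc (d - 1) × ℝ)) hsymm hincl.contDiffAt
  have hγx₀ : γ 0 = x₀ := hsymm0
  obtain ⟨K, s, hs, hlip⟩ := hγ0.exists_lipschitzOnWith
  have hev : ∀ᶠ u in 𝓝 (0 : Euc (d - 1)), ContDiffAt ℝ 1 γ u ∧ u ∈ s ∧ ‖γ u - x₀‖ ≤ 2 * r ∧
      (u, (0 : ℝ)) ∈ e.target := by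
    refine (hγ0.eventually (by simp)).and ((eventually_mem_set.2 hs).and (Eventually.and ?_ ?_))
    · have h1 : Tendsto (fun u => ‖γ u - x₀‖) (𝓝 0) (𝓝 0) := by
        have := (hγ0.continuousAt.sub_const x₀).norm
        simpa [ContinuousAt, hγx₀] using this
      filter_upwards [h1.eventually (gt_mem_nhds (by linarith [h.r_pos] : (0 : ℝ) < 2 * r))] with u hu
        using hu.le
    · exact (hincl.continuous.continuousAt (x := 0)).eventually (e.open_target.mem_nhds htgt)
  obtain ⟨ε, hε, hball⟩ := Metric.eventually_nhds_iff_ball.1 hev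
  have h2R : 2 * (ε / 2) = ε := by ring
  have hfγ : ∀ u ∈ Metric.ball (0 : Euc (d - 1)) ε, f (γ u) = (u, 0) := fun u hu => by
    rw [← he]
    exact e.right_inv (hball u hu).2.2.2
  have hρ0 : ∀ u ∈ Metric.ball (0 : Euc (d - 1)) ε, ρ (γ u) = 0 := fun u hu =>
    congrArg Prod.snd (hfγ u hu)
  have hfr : ∀ u ∈ Metric.ball (0 : Euc (d - 1)) ε, γ u ∈ frontier Ω := fun u hu =>
    (h.mem_frontier_iff x₀ hx₀ _ (hball u hu).2.2.1).2 (hρ0 u hu)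
  -- With R = ε / 2, a ball of radius ε / 4 around x₀ projects into the ball of radius R / 2.
  refine ⟨⟨γ, fun x => Q (x - x₀), ε / 2, K, by positivity, ?_, ?_, ?_, ?_, ?_, ?_⟩,
    e.source ∩ Metric.ball x₀ (ε / 4), e.open_source.inter Metric.isOpen_ball,
    ⟨hsrc, Metric.mem_ball_self (by positivity)⟩, ?_⟩
  · rw [h2R]
    exact fun u hu => (hball u hu).1.contDiffWithinAt
  · rw [h2R]
    exact hlip.mono fun u hu => (hball u hu).2.1
  · refine LipschitzWith.of_dist_le_mul fun x y => ?_
    have e : Q (x - x₀) - Q (y - x₀) = Q (x - y) := by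
      have := Q.map_sub (x - x₀) (y - x₀)
      rw [sub_sub_sub_cancel_right] at this
      exact this.symm
    have h1 := hQ1 (x - y)
    rw [← e, ← dist_eq_norm, ← dist_eq_norm] at h1
    rwa [NNReal.coe_one, one_mul]
  · rw [h2R]
    exact fun u hu => congrArg Prod.fst (hfγ u hu)
  · rwa [h2R]
  · rw [h2R]
    intro u hu w
    have hγd : DifferentiableAt ℝ γ u := (hball u hu).1.differentiableAt (by simp)
    have h1 : HasFDerivAt (fun v => ρ (γ v)) ((fderiv ℝ ρ (γ u)).comp (fderiv ℝ γ u)) u :=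
      (hρd _).hasFDerivAt.comp u hγd.hasFDerivAt
    have h2 : (fun v => ρ (γ v)) =ᶠ[𝓝 u] fun _ => 0 := by
      filter_upwards [Metric.isOpen_ball.mem_nhds hu] with v hv using hρ0 v hv
    have h3 := h2.fderiv_eq (𝕜 := ℝ)
    rw [h1.fderiv] at h3
    -- Differentiating ρ ∘ γ = 0 shows that the chart's derivative is tangent to the boundary.
    have h4 : fderiv ℝ ρ (γ u) (fderiv ℝ γ u w) = 0 := by
      have := DFunLike.congr_fun h3 w
      simpa using this
    rw [fderiv_apply_eq_inner_gradient, h.gradient_eq (hfr u hu), inner_smul_left] at h4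
    rw [h.outerNormal_eq _ (hfr u hu)]
    have h5 : ‖gradient ρ (γ u)‖ ≠ 0 := norm_ne_zero_iff.2 (h.defining _ (hfr u hu)).2.2.1
    simpa [h5] using h4
  · rintro x ⟨⟨hx1, hx2⟩, hx3⟩
    have h1 : f x = (Q (x - x₀), 0) := by simp [f, h.rho_eq_zero hx3]
    refine ⟨Q (x - x₀), ?_, ?_⟩
    · rw [mem_closedBall_zero_iff]
      have := hQ1 (x - x₀)
      have h3 : ‖x - x₀‖ < ε / 4 := by
        rw [← dist_eq_norm]
        exact hx2
      linarith
    · change e.symm (Q (x - x₀), 0) = x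
      rw [← h1, ← he]
      exact e.left_inv hx1

/-- The boundary is covered by finitely many charts, uniformly. -/
theorem exists_finite_charts (h : IsCollar Ω ρ N r a) :
    ∃ S : Finset (BoundaryChart Ω), ∃ δ > 0, ∀ x ∈ frontier Ω, ∃ χ ∈ S,
      Metric.ball x δ ∩ frontier Ω ⊆ χ.toFun '' Metric.closedBall 0 (χ.R / 2) := by
  classical
  choose c V hV hxV hcV using fun x (hx : x ∈ frontier Ω) => h.exists_boundaryChart hx
  obtain ⟨t, hcov⟩ := h.isCompact_frontier.elim_nhds_subcover' V
    (fun x hx => (hV x hx).mem_nhds (hxV x hx))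
  -- A Lebesgue number of the cover: boundary points closer than δ lie in a common chart.
  obtain ⟨δ, hδ, hleb⟩ := lebesgue_number_lemma_of_metric (c := fun i : t => V i i.1.2)
    h.isCompact_frontier (fun i => hV i i.1.2) (fun x hx => by
      obtain ⟨i, hi, hxi⟩ := mem_iUnion₂.1 (hcov hx)
      exact mem_iUnion.2 ⟨⟨i, hi⟩, hxi⟩)
  refine ⟨t.image fun x : frontier Ω => c x x.2, δ, hδ, fun x hx => ?_⟩
  obtain ⟨i, hi⟩ := hleb x hx
  exact ⟨c i i.1.2, Finset.mem_image.2 ⟨i.1, i.2, rfl⟩, fun y hy => hcV i i.1.2 ⟨hi hy.1, hy.2⟩⟩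

end IsCollar

namespace BoundaryChart

variable (c : BoundaryChart Ω)

/-- The piece of the boundary parametrized by a chart. -/
def patch : Set (Euc d) := c.toFun '' Metric.closedBall 0 c.R

theorem closedBall_subset : Metric.closedBall (0 : Euc (d - 1)) c.R ⊆ Metric.ball 0 (2 * c.R) :=
  Metric.closedBall_subset_ball (by linarith [c.R_pos])

theorem isCompact_patch : IsCompact c.patch :=
  (isCompact_closedBall _ _).image_of_continuousOn
    (c.contDiffOn.continuousOn.mono c.closedBall_subset)

theorem patch_subset : c.patch ⊆ frontier Ω := by
  rintro _ ⟨u, hu, rfl⟩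
  exact c.mem_frontier u (c.closedBall_subset hu)

/-- A Lipschitz map expands Hausdorff measure by at most a power of its constant. Together with the
reverse bound below, this two-sided comparison replaces the area formula. -/
theorem euclideanHausdorffMeasure_image_le {s : Set (Euc (d - 1))}
    (hs : s ⊆ Metric.closedBall 0 c.R) :
    (μHE[d - 1] : Measure (Euc d)) (c.toFun '' s) ≤ (c.L : ℝ≥0∞) ^ (d - 1) * volume s := by
  rw [← EuclideanSpace.euclideanHausdorffMeasure_eq_volume,
    Measure.euclideanHausdorffMeasure_def, Measure.euclideanHausdorffMeasure_def]
  simp only [Measure.smul_apply]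
  have := (c.lipschitzOn.mono (hs.trans c.closedBall_subset)).hausdorffMeasure_image_le
    (d := ((d - 1 : ℕ) : ℝ)) (Nat.cast_nonneg _)
  rw [ENNReal.rpow_natCast] at this
  rw [ENNReal.smul_def, ENNReal.smul_def, smul_eq_mul, smul_eq_mul, mul_left_comm]
  gcongr

/-- The left inverse of the chart is 1-Lipschitz, so the chart cannot decrease measure. -/
theorem volume_le_euclideanHausdorffMeasure_image {s : Set (Euc (d - 1))}
    (hs : s ⊆ Metric.closedBall 0 c.R) :
    volume s ≤ (μHE[d - 1] : Measure (Euc d)) (c.toFun '' s) := by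
  rw [← EuclideanSpace.euclideanHausdorffMeasure_eq_volume,
    Measure.euclideanHausdorffMeasure_def, Measure.euclideanHausdorffMeasure_def]
  simp only [Measure.smul_apply]
  have h1 := c.lipschitz_proj.hausdorffMeasure_image_le (d := ((d - 1 : ℕ) : ℝ))
    (Nat.cast_nonneg _) (c.toFun '' s)
  have h2 : c.proj '' (c.toFun '' s) = s := by
    rw [image_image]
    refine (image_congr fun u hu => ?_).trans (image_id _)
    exact c.proj_apply u (c.closedBall_subset (hs hu))
  rw [h2, ENNReal.coe_one, ENNReal.one_rpow, one_mul] at h1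
  gcongr

theorem aemeasurable : AEMeasurable c.toFun (volume.restrict (Metric.closedBall 0 c.R)) :=
  (c.contDiffOn.continuousOn.mono c.closedBall_subset).aemeasurable measurableSet_closedBall

theorem surf_restrict_apply {s : Set (Euc d)} (hs : MeasurableSet s) :
    (surf Ω).restrict c.patch s =
      (μHE[d - 1] : Measure (Euc d)) (c.toFun '' (c.toFun ⁻¹' s ∩ Metric.closedBall 0 c.R)) := by
  have h1 : c.toFun '' (c.toFun ⁻¹' s ∩ Metric.closedBall 0 c.R) = s ∩ c.patch := by
    rw [patch, image_preimage_inter]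
  rw [h1, Measure.restrict_apply hs, surf,
    Measure.restrict_apply (hs.inter c.isCompact_patch.isClosed.measurableSet),
    inter_eq_left.2 (inter_subset_right.trans c.patch_subset)]

theorem surf_restrict_le : (surf Ω).restrict c.patch ≤
    (c.L : ℝ≥0∞) ^ (d - 1) • (volume.restrict (Metric.closedBall 0 c.R)).map c.toFun := by
  refine Measure.le_iff.2 fun s hs => ?_
  rw [c.surf_restrict_apply hs, Measure.smul_apply, Measure.map_apply_of_aemeasurable
    c.aemeasurable hs, Measure.restrict_apply' measurableSet_closedBall, smul_eq_mul]
  exact c.euclideanHausdorffMeasure_image_le inter_subset_right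

theorem map_volume_le : (volume.restrict (Metric.closedBall 0 c.R)).map c.toFun ≤
    (surf Ω).restrict c.patch := by
  refine Measure.le_iff.2 fun s hs => ?_
  rw [c.surf_restrict_apply hs, Measure.map_apply_of_aemeasurable
    c.aemeasurable hs, Measure.restrict_apply' measurableSet_closedBall]
  exact c.volume_le_euclideanHausdorffMeasure_image inter_subset_right

theorem surf_patch_lt_top : surf Ω c.patch < ⊤ := by
  have h1 := c.surf_restrict_le univ
  rw [Measure.restrict_apply_univ, Measure.smul_apply, Measure.map_apply_of_aemeasurable
    c.aemeasurable MeasurableSet.univ, preimage_univ, Measure.restrict_apply_univ] at h1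
  exact h1.trans_lt (ENNReal.mul_lt_top (ENNReal.pow_lt_top ENNReal.coe_lt_top)
    measure_closedBall_lt_top)

theorem setLIntegral_le_patch {f : Euc d → ℝ≥0∞} (hf : Measurable f) :
    ∫⁻ u in Metric.closedBall 0 c.R, f (c.toFun u) ≤ ∫⁻ x in c.patch, f x ∂(surf Ω) := by
  rw [← lintegral_map' hf.aemeasurable c.aemeasurable]
  exact lintegral_mono' c.map_volume_le le_rfl

/-- The surface measure of small balls is bounded below. -/
theorem le_surf_ball {u : Euc (d - 1)} (hu : u ∈ Metric.closedBall 0 (c.R / 2)) {δ : ℝ}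
    (hδ0 : 0 < δ) (hδ : δ ≤ c.R / 2) :
    ENNReal.ofReal (δ ^ (d - 1)) * volume (Metric.ball (0 : Euc (d - 1)) 1) ≤
      surf Ω (Metric.closedBall (c.toFun u) (c.L * δ)) := by
  have hu' : ‖u‖ ≤ c.R / 2 := by simpa using hu
  have hR := c.R_pos
  have hsub : Metric.ball u δ ⊆ Metric.closedBall 0 c.R := by
    intro v hv
    rw [mem_closedBall_zero_iff]
    rw [Metric.mem_ball, dist_eq_norm] at hv
    have := norm_le_norm_add_norm_sub' v u
    linarith
  have h1 := c.volume_le_euclideanHausdorffMeasure_image hsub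
  rw [Measure.addHaar_ball_of_pos _ _ hδ0, finrank_euclideanSpace_fin] at h1
  refine h1.trans ?_
  rw [surf, Measure.restrict_apply Metric.isClosed_closedBall.measurableSet]
  refine measure_mono ?_
  rintro _ ⟨v, hv, rfl⟩
  refine ⟨?_, c.mem_frontier v (c.closedBall_subset (hsub hv))⟩
  rw [Metric.mem_closedBall]
  refine (c.lipschitzOn.dist_le_mul v (c.closedBall_subset (hsub hv)) u
    (Metric.mem_ball.2 ?_)).trans ?_
  · rw [dist_zero_right]
    linarith
  · gcongr
    exact (Metric.mem_ball.1 hv).le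

end BoundaryChart

end BoundaryCharts

/-! ### Gagliardo seminorm on a Euclidean ball -/

section GagliardoBall

/-- Cauchy–Schwarz for the lower integral. -/
theorem sq_lintegral_le {α : Type*} [MeasurableSpace α] {μ : Measure α} {f : α → ℝ≥0∞}
    (hf : AEMeasurable f μ) : (∫⁻ x, f x ∂μ) ^ 2 ≤ μ univ * ∫⁻ x, f x ^ 2 ∂μ := by
  have h := ENNReal.lintegral_mul_le_Lp_mul_Lq μ Real.HolderConjugate.two_two hf
    (g := fun _ => 1) aemeasurable_const
  simp only [Pi.mul_apply, mul_one, lintegral_const, ENNReal.rpow_two, one_pow, one_mul] at h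
  have hsq : ∀ x : ℝ≥0∞, (x ^ (1 / 2 : ℝ)) ^ 2 = x := fun x => by
    rw [← ENNReal.rpow_natCast, ← ENNReal.rpow_mul]
    norm_num
  calc (∫⁻ x, f x ∂μ) ^ 2
      ≤ ((∫⁻ x, f x ^ 2 ∂μ) ^ (1 / 2 : ℝ) * μ univ ^ (1 / 2 : ℝ)) ^ 2 := by gcongr
    _ = μ univ * ∫⁻ x, f x ^ 2 ∂μ := by rw [mul_pow, hsq, hsq, mul_comm]

/-- The fundamental theorem of calculus on the segment, followed by Cauchy–Schwarz in t. -/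
theorem enorm_sub_sq_le_lintegral_fderiv {E : Type*} [NormedAddCommGroup E] [NormedSpace ℝ E]
    {F : E → ℝ} {O : Set E} (hO : IsOpen O) (hF : ContDiffOn ℝ 1 F O) {u v : E}
    (huv : segment ℝ u v ⊆ O) :
    ‖F v - F u‖ₑ ^ 2 ≤ ‖v - u‖ₑ ^ 2 *
      ∫⁻ t in Icc (0 : ℝ) 1, ‖fderiv ℝ F (u + t • (v - u))‖ₑ ^ 2 := by
  have hmem : ∀ t ∈ Icc (0 : ℝ) 1, u + t • (v - u) ∈ O := fun t ht =>
    huv (by rw [segment_eq_image']; exact ⟨t, ht, rfl⟩)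
  have hcf : ContinuousOn (fun t : ℝ => fderiv ℝ F (u + t • (v - u))) (Icc 0 1) :=
    (hF.continuousOn_fderiv_of_isOpen hO le_rfl).comp
      (by fun_prop) hmem
  have hd : ∀ t ∈ uIcc (0 : ℝ) 1, HasDerivAt (fun t : ℝ => F (u + t • (v - u)))
      (fderiv ℝ F (u + t • (v - u)) (v - u)) t := by
    intro t ht
    rw [uIcc_of_le zero_le_one] at ht
    have h1 : HasDerivAt (fun t : ℝ => u + t • (v - u)) (v - u) t := by
      simpa using ((hasDerivAt_id t).smul_const (v - u)).const_add u
    have h2 : DifferentiableAt ℝ F (u + t • (v - u)) :=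
      (hF.contDiffAt (hO.mem_nhds (hmem t ht))).differentiableAt (by simp)
    exact h2.hasFDerivAt.comp_hasDerivAt t h1
  have hint : IntervalIntegrable (fun t : ℝ => fderiv ℝ F (u + t • (v - u)) (v - u)) volume 0 1 := by
    refine ContinuousOn.intervalIntegrable ?_
    rw [uIcc_of_le zero_le_one]
    exact hcf.clm_apply continuousOn_const
  have hftc := intervalIntegral.integral_eq_sub_of_hasDerivAt hd hint
  simp only [one_smul, zero_smul, add_zero, add_sub_cancel] at hftc
  rw [intervalIntegral.integral_of_le zero_le_one, ← integral_Icc_eq_integral_Ioc] at hftc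
  have h1 : ‖F v - F u‖ₑ ≤
      ∫⁻ t in Icc (0 : ℝ) 1, ‖fderiv ℝ F (u + t • (v - u))‖ₑ * ‖v - u‖ₑ := by
    rw [← hftc]
    refine (enorm_integral_le_lintegral_enorm _).trans (lintegral_mono fun t => ?_)
    exact ContinuousLinearMap.le_opENorm _ _
  rw [lintegral_mul_const' _ _ enorm_ne_top] at h1
  calc ‖F v - F u‖ₑ ^ 2
      ≤ ((∫⁻ t in Icc (0 : ℝ) 1, ‖fderiv ℝ F (u + t • (v - u))‖ₑ) * ‖v - u‖ₑ) ^ 2 := by gcongr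
    _ ≤ _ := by
        rw [mul_pow, mul_comm]
        gcongr
        refine (sq_lintegral_le (hcf.aestronglyMeasurable measurableSet_Icc).enorm).trans_eq ?_
        simp

/-- In polar coordinates the integrand becomes y^{1 - 2s}, integrable at 0 precisely because s < 1.
-/
theorem lintegral_closedBall_kernel_lt_top {n : ℕ} {s R : ℝ} (hs1 : s < 1) :
    ∫⁻ z in Metric.closedBall (0 : Euc n) R, ‖‖z‖ / ‖z‖ ^ ((n : ℝ) / 2 + s)‖ₑ ^ 2 < ⊤ := by
  rcases Nat.eq_zero_or_pos n with rfl | hn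
  · have h0 : ∀ z : Euc 0, ‖z‖ = 0 := fun z => by rw [Subsingleton.elim z 0, norm_zero]
    simp only [h0]
    simp
  have : Nontrivial (Euc n) := Module.nontrivial_of_finrank_pos (R := ℝ) (by simpa using hn)
  have h1 : IntegrableOn (fun z : Euc n => ‖z‖ ^ (2 - ((n : ℝ) + 2 * s)))
      (Metric.ball 0 (|R| + 1)) := by
    rw [integrableOn_fun_norm_addHaar volume (f := fun y : ℝ => y ^ (2 - ((n : ℝ) + 2 * s)))]
    have h2 : IntegrableOn (fun y : ℝ => y ^ (1 - 2 * s)) (Ioo 0 (|R| + 1)) :=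
      (intervalIntegral.integrableOn_Ioo_rpow_iff (by positivity)).2 (by linarith)
    refine h2.congr_fun (fun y hy => ?_) measurableSet_Ioo
    have hy0 : 0 < y := hy.1
    simp only [finrank_euclideanSpace_fin, smul_eq_mul]
    rw [← Real.rpow_natCast, ← Real.rpow_add hy0, Nat.cast_sub hn]
    congr 1
    push_cast
    ring
  refine lt_of_le_of_lt ?_ h1.2
  refine (lintegral_mono_set (Metric.closedBall_subset_ball
    (by linarith [le_abs_self R] : R < |R| + 1))).trans (lintegral_mono fun z => ?_)
  rcases eq_or_ne z 0 with rfl | hz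
  · simp
  have hz0 : 0 < ‖z‖ := norm_pos_iff.2 hz
  rw [← enorm_pow]
  refine le_of_eq ?_
  congr 1
  nth_rewrite 1 [← Real.rpow_one ‖z‖]
  rw [← Real.rpow_sub hz0, ← Real.rpow_natCast, ← Real.rpow_mul hz0.le]
  congr 1
  push_cast
  ring

/-- On a ball, the Gagliardo seminorm is controlled by the `L²` norm of the derivative. -/
theorem exists_lintegral_gagliardo_ball_le (n : ℕ) {s R : ℝ} (hs1 : s < 1) (hR : 0 < R) :
    ∃ C : ℝ≥0∞, C < ⊤ ∧ ∀ F : Euc n → ℝ, ContDiffOn ℝ 1 F (Metric.ball 0 (2 * R)) →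
      ∫⁻ u in Metric.closedBall 0 R, ∫⁻ v in Metric.closedBall 0 R,
        ‖(F u - F v) / ‖u - v‖ ^ ((n : ℝ) / 2 + s)‖ₑ ^ 2 ≤
          C * ∫⁻ u in Metric.closedBall 0 R, ‖fderiv ℝ F u‖ₑ ^ 2 := by
  set B : Set (Euc n) := Metric.closedBall 0 R with hB
  have hBm : MeasurableSet B := measurableSet_closedBall
  have hBO : B ⊆ Metric.ball 0 (2 * R) := Metric.closedBall_subset_ball (by linarith)
  let e : ℝ := (n : ℝ) / 2 + s
  -- The kernel is cut off at radius 2R, which contains all differences of points of the ball, and G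
  -- below is cut off to the ball; the integrals can then be extended to the whole space.
  let k : Euc n → ℝ≥0∞ :=
    (Metric.closedBall (0 : Euc n) (2 * R)).indicator fun z => ‖‖z‖ / ‖z‖ ^ e‖ₑ ^ 2
  have hkm : Measurable k := Measurable.indicator (by fun_prop) measurableSet_closedBall
  refine ⟨∫⁻ z, k z, ?_, fun F hF => ?_⟩
  · rw [lintegral_indicator measurableSet_closedBall]
    exact lintegral_closedBall_kernel_lt_top hs1
  let G : Euc n → ℝ≥0∞ := B.indicator fun u => ‖fderiv ℝ F u‖ₑ ^ 2
  have hGm : Measurable G :=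
    Measurable.indicator ((measurable_fderiv ℝ F).enorm.pow_const 2) hBm
  have hpt : ∀ u ∈ B, ∀ v ∈ B, ‖(F u - F v) / ‖u - v‖ ^ e‖ₑ ^ 2 ≤
      k (v - u) * ∫⁻ t in Icc (0 : ℝ) 1, G (u + t • (v - u)) := by
    intro u hu v hv
    have hseg : segment ℝ u v ⊆ B := (convex_closedBall _ _).segment_subset hu hv
    have h1 := enorm_sub_sq_le_lintegral_fderiv Metric.isOpen_ball hF (hseg.trans hBO)
    have h2 : ∫⁻ t in Icc (0 : ℝ) 1, ‖fderiv ℝ F (u + t • (v - u))‖ₑ ^ 2 =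
        ∫⁻ t in Icc (0 : ℝ) 1, G (u + t • (v - u)) := by
      refine setLIntegral_congr_fun measurableSet_Icc fun t ht => ?_
      have : u + t • (v - u) ∈ B := hseg (by rw [segment_eq_image']; exact ⟨t, ht, rfl⟩)
      simp only [G, indicator_of_mem this]
    have h3 : v - u ∈ Metric.closedBall (0 : Euc n) (2 * R) := by
      rw [mem_closedBall_zero_iff]
      have hu' : ‖u‖ ≤ R := mem_closedBall_zero_iff.1 hu
      have hv' : ‖v‖ ≤ R := mem_closedBall_zero_iff.1 hv
      exact (norm_sub_le v u).trans (by linarith)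
    rw [h2] at h1
    simp only [k, indicator_of_mem h3]
    rw [norm_sub_rev u v, ← enorm_neg, ← neg_div, neg_sub, div_eq_mul_inv, div_eq_mul_inv,
      enorm_mul, enorm_mul, mul_pow, mul_pow, enorm_norm, mul_right_comm]
    gcongr
  -- After the substitution z = v - u and Fubini, translation invariance makes the integral in u
  -- independent of t and z, and the kernel factors out.
  calc ∫⁻ u in B, ∫⁻ v in B, ‖(F u - F v) / ‖u - v‖ ^ e‖ₑ ^ 2
      ≤ ∫⁻ u in B, ∫⁻ v in B, k (v - u) * ∫⁻ t in Icc (0 : ℝ) 1, G (u + t • (v - u)) := by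
        refine setLIntegral_mono' hBm fun u hu => setLIntegral_mono' hBm fun v hv => hpt u hu v hv
    _ ≤ ∫⁻ u, ∫⁻ v, k (v - u) * ∫⁻ t in Icc (0 : ℝ) 1, G (u + t • (v - u)) :=
        lintegral_mono' Measure.restrict_le_self fun u => lintegral_mono' Measure.restrict_le_self
          le_rfl
    _ = ∫⁻ u, ∫⁻ z, k z * ∫⁻ t in Icc (0 : ℝ) 1, G (u + t • z) := by
        refine lintegral_congr fun u => ?_
        exact lintegral_sub_right_eq_self
          (fun z => k z * ∫⁻ t in Icc (0 : ℝ) 1, G (u + t • z)) u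
    _ = ∫⁻ z, ∫⁻ u, k z * ∫⁻ t in Icc (0 : ℝ) 1, G (u + t • z) := by
        refine lintegral_lintegral_swap (Measurable.aemeasurable ?_)
        refine (hkm.comp measurable_snd).mul ?_
        exact Measurable.lintegral_prod_right'
          (f := fun p : (Euc n × Euc n) × ℝ => G (p.1.1 + p.2 • p.1.2)) (hGm.comp (by fun_prop))
    _ = ∫⁻ z, k z * ∫⁻ u, G u := by
        refine lintegral_congr fun z => ?_
        rw [lintegral_const_mul _ (Measurable.lintegral_prod_right'
          (f := fun p : Euc n × ℝ => G (p.1 + p.2 • z)) (hGm.comp (by fun_prop)))]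
        congr 1
        rw [lintegral_lintegral_swap (f := fun (u : Euc n) (t : ℝ) => G (u + t • z))
          (hGm.comp (g := G) (f := fun p : Euc n × ℝ => p.1 + p.2 • z)
            (by fun_prop)).aemeasurable]
        simp only [lintegral_add_right_eq_self]
        simp
    _ = (∫⁻ z, k z) * ∫⁻ u in B, ‖fderiv ℝ F u‖ₑ ^ 2 := by
        rw [lintegral_mul_const _ hkm, lintegral_indicator hBm]

end GagliardoBall

/-! ### Finiteness and lower density of the surface measure, tangential gradients in charts -/

section SurfaceEstimates

variable {d : ℕ} {Ω : Set (Euc d)}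

theorem frontier_subset_biUnion_patch {S : Finset (BoundaryChart Ω)} {δ : ℝ} (hδ : 0 < δ)
    (hS : ∀ x ∈ frontier Ω, ∃ χ ∈ S,
      Metric.ball x δ ∩ frontier Ω ⊆ χ.toFun '' Metric.closedBall 0 (χ.R / 2)) :
    frontier Ω ⊆ ⋃ χ ∈ S, χ.patch := by
  intro x hx
  obtain ⟨χ, hχ, hsub⟩ := hS x hx
  refine mem_iUnion₂.2 ⟨χ, hχ, ?_⟩
  refine image_mono (Metric.closedBall_subset_closedBall ?_) (hsub ⟨Metric.mem_ball_self hδ, hx⟩)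
  linarith [χ.R_pos]

theorem ae_mem_frontier (hK : IsClosed (frontier Ω)) : ∀ᵐ x ∂(surf Ω), x ∈ frontier Ω :=
  ae_restrict_mem hK.measurableSet

namespace IsCollar

variable {ρ : Euc d → ℝ} {N : Euc d → Euc d} {r a : ℝ}

theorem isFiniteMeasure_surf (h : IsCollar Ω ρ N r a) : IsFiniteMeasure (surf Ω) := by
  obtain ⟨S, δ, hδ, hS⟩ := h.exists_finite_charts
  refine ⟨?_⟩
  have h1 : surf Ω univ = surf Ω (frontier Ω) := by simp [surf]
  rw [h1]
  refine (measure_mono (frontier_subset_biUnion_patch hδ hS)).trans_lt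
    ((measure_biUnion_finset_le S _).trans_lt ?_)
  exact ENNReal.sum_lt_top.2 fun χ _ => χ.surf_patch_lt_top

/-- Small balls centered on the boundary have surface measure at least `c δ ^ (d - 1)`. -/
theorem exists_le_surf_closedBall (h : IsCollar Ω ρ N r a) :
    ∃ c > 0, ∃ δ₀ > 0, ∀ x ∈ frontier Ω, ∀ δ, 0 < δ → δ ≤ δ₀ →
      ENNReal.ofReal (c * δ ^ (d - 1)) ≤ surf Ω (Metric.closedBall x δ) := by
  obtain ⟨S, δ, hδ, hS⟩ := h.exists_finite_charts
  have hball : 0 < volume.real (Metric.ball (0 : Euc (d - 1)) 1) :=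
    ENNReal.toReal_pos (Metric.measure_ball_pos volume _ one_pos).ne' measure_ball_lt_top.ne
  set b := volume.real (Metric.ball (0 : Euc (d - 1)) 1) with hb
  have hev : ∀ χ ∈ S, ∀ᶠ c in 𝓝[>] (0 : ℝ), c ≤ b / ((χ.L : ℝ) + 1) ^ (d - 1) := by
    intro χ _
    have : (0 : ℝ) < b / ((χ.L : ℝ) + 1) ^ (d - 1) := by positivity
    exact ((gt_mem_nhds this).filter_mono nhdsWithin_le_nhds).mono fun c hc => hc.le
  have hev' : ∀ χ ∈ S, ∀ᶠ c in 𝓝[>] (0 : ℝ), c / ((χ.L : ℝ) + 1) ≤ χ.R / 2 := by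
    intro χ _
    have hL : (0 : ℝ) < (χ.L : ℝ) + 1 := by positivity
    have hR := χ.R_pos
    have : (0 : ℝ) < χ.R / 2 * ((χ.L : ℝ) + 1) := by positivity
    refine ((gt_mem_nhds this).filter_mono nhdsWithin_le_nhds).mono fun c hc => ?_
    rw [div_le_iff₀ hL]
    exact hc.le
  obtain ⟨c, hc, hc0⟩ := (((Finset.eventually_all S).2 hev).and self_mem_nhdsWithin).exists
  obtain ⟨δ₀, hδ₀, hδ₀0⟩ := (((Finset.eventually_all S).2 hev').and self_mem_nhdsWithin).exists
  refine ⟨c, hc0, δ₀, hδ₀0, fun x hx ε hε hεδ => ?_⟩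
  obtain ⟨χ, hχ, hsub⟩ := hS x hx
  obtain ⟨u, hu, rfl⟩ := hsub ⟨Metric.mem_ball_self hδ, hx⟩
  have hL : (0 : ℝ) < (χ.L : ℝ) + 1 := by positivity
  -- The parameter radius is shrunk so that its image stays in the ball of radius ε; L + 1 avoids
  -- dividing by zero.
  have h1 := χ.le_surf_ball hu (δ := ε / ((χ.L : ℝ) + 1)) (by positivity)
    ((div_le_div_of_nonneg_right hεδ hL.le).trans (hδ₀ χ hχ))
  have h2 : (χ.L : ℝ) * (ε / ((χ.L : ℝ) + 1)) ≤ ε := by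
    rw [← mul_div_assoc, div_le_iff₀ hL]
    nlinarith
  refine le_trans ?_ (h1.trans (measure_mono (Metric.closedBall_subset_closedBall h2)))
  rw [← ENNReal.ofReal_toReal (measure_ball_lt_top (μ := volume) (x := (0 : Euc (d - 1)))
    (r := 1)).ne, ← ENNReal.ofReal_mul (by positivity)]
  refine ENNReal.ofReal_le_ofReal ?_
  have h3 := hc χ hχ
  rw [div_pow, div_mul_eq_mul_div, mul_comm, le_div_iff₀ (by positivity)]
  rw [le_div_iff₀ (by positivity)] at h3
  rw [mul_assoc]
  exact mul_le_mul_of_nonneg_left h3 (by positivity)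

theorem one_le_dim (h : IsCollar Ω ρ N r a) (hne : (frontier Ω).Nonempty) : 1 ≤ d := by
  obtain ⟨x, hx⟩ := hne
  rcases Nat.eq_zero_or_pos d with rfl | hd
  · have := h.norm_normal x hx
    rw [Subsingleton.elim (N x) 0, norm_zero] at this
    exact absurd this zero_ne_one
  · exact hd

theorem surf_eq_zero (hemp : frontier Ω = ∅) : surf Ω = 0 := by
  rw [surf, hemp, Measure.restrict_empty]

/-- The tangential gradient of a `C¹` function agrees on the boundary with a continuous field. -/
theorem exists_continuous_eq_tangentialGradient (h : IsCollar Ω ρ N r a) {f : Euc d → ℝ}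
    (hf : ContDiff ℝ 1 f) :
    ∃ G : Euc d → Euc d, Continuous G ∧ EqOn (tangentialGradient Ω f) G (frontier Ω) := by
  refine ⟨fun x => gradient f x - ⟪gradient f x, N x⟫ • N x, ?_, fun x hx => ?_⟩
  · have h1 : Continuous (gradient f) := (contDiff_gradient (n := 0) (by simpa using hf)).continuous
    have h2 := h.contDiff_normal.continuous
    fun_prop
  · simp only [tangentialGradient, h.outerNormal_eq x hx]

theorem memLp_of_continuous (h : IsCollar Ω ρ N r a) {E : Type*} [NormedAddCommGroup E]
    [SecondCountableTopology E] [MeasurableSpace E] [BorelSpace E] {f G : Euc d → E}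
    (hG : Continuous G) (hfG : EqOn f G (frontier Ω)) : MemLp f 2 (surf Ω) := by
  have := h.isFiniteMeasure_surf
  have hae : f =ᵐ[surf Ω] G := by
    filter_upwards [ae_mem_frontier h.isCompact_frontier.isClosed] with x hx using hfG hx
  rw [memLp_congr_ae hae]
  obtain ⟨C, hC⟩ := h.isCompact_frontier.exists_bound_of_continuousOn hG.continuousOn
  refine MemLp.of_bound hG.aestronglyMeasurable C ?_
  filter_upwards [ae_mem_frontier h.isCompact_frontier.isClosed] with x hx using hC x hx

end IsCollar

/-- The chain rule in a boundary chart. -/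
theorem BoundaryChart.enorm_fderiv_comp_le (χ : BoundaryChart Ω) {f : Euc d → ℝ}
    (hf : ContDiff ℝ 1 f) {u : Euc (d - 1)} (hu : u ∈ Metric.ball 0 (2 * χ.R)) :
    ‖fderiv ℝ (fun v => f (χ.toFun v)) u‖ₑ ≤
      (χ.L : ℝ≥0∞) * ‖tangentialGradient Ω f (χ.toFun u)‖ₑ := by
  have hnhds := Metric.isOpen_ball.mem_nhds hu
  have hγ : DifferentiableAt ℝ χ.toFun u :=
    (χ.contDiffOn.contDiffAt hnhds).differentiableAt (by simp)
  have h1 : HasFDerivAt (fun v => f (χ.toFun v))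
      ((fderiv ℝ f (χ.toFun u)).comp (fderiv ℝ χ.toFun u)) u :=
    (hf.differentiable (by simp) _).hasFDerivAt.comp u hγ.hasFDerivAt
  have h2 : ‖fderiv ℝ χ.toFun u‖ ≤ χ.L :=
    norm_fderiv_le_of_lipschitzOn ℝ hnhds χ.lipschitzOn
  have h3 : ‖fderiv ℝ (fun v => f (χ.toFun v)) u‖ ≤
      (χ.L : ℝ) * ‖tangentialGradient Ω f (χ.toFun u)‖ := by
    refine ContinuousLinearMap.opNorm_le_bound _ (by positivity) fun w => ?_
    rw [h1.fderiv]
    -- The chart's derivative is tangent, so the normal part of ∇f does not contribute.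
    have h4 : (fderiv ℝ f (χ.toFun u)).comp (fderiv ℝ χ.toFun u) w =
        ⟪tangentialGradient Ω f (χ.toFun u), fderiv ℝ χ.toFun u w⟫ := by
      rw [ContinuousLinearMap.comp_apply, fderiv_apply_eq_inner_gradient, tangentialGradient,
        inner_sub_left, real_inner_smul_left, χ.tangent u hu w, mul_zero, sub_zero]
    rw [h4]
    refine (norm_inner_le_norm _ _).trans ?_
    have h5 := (fderiv ℝ χ.toFun u).le_of_opNorm_le h2 w
    calc _ ≤ ‖tangentialGradient Ω f (χ.toFun u)‖ * ((χ.L : ℝ) * ‖w‖) := by gcongr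
      _ = _ := by ring
  rw [← ofReal_norm, ← ofReal_norm]
  refine (ENNReal.ofReal_le_ofReal h3).trans ?_
  rw [ENNReal.ofReal_mul (by positivity), ENNReal.ofReal_coe_nnreal]

end SurfaceEstimates

/-! ### Gagliardo estimates for C¹ functions on the boundary and smooth approximation -/

section SmoothFunctions

variable {d : ℕ} {Ω : Set (Euc d)}

theorem eLpNorm_two_sq {α E : Type*} [MeasurableSpace α] [NormedAddCommGroup E] (μ : Measure α)
    (f : α → E) : eLpNorm f 2 μ ^ 2 = ∫⁻ x, ‖f x‖ₑ ^ 2 ∂μ := by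
  have := eLpNorm_nnreal_pow_eq_lintegral (f := f) (μ := μ) (p := 2) two_ne_zero
  simpa using this

theorem Real.enorm_sq (x : ℝ) : ‖x‖ₑ ^ 2 = ENNReal.ofReal (x ^ 2) := by
  rw [Real.enorm_eq_ofReal_abs, ← ENNReal.ofReal_pow (abs_nonneg x), sq_abs]

theorem measurable_gagliardoQuotient {s : ℝ} {f : Euc d → ℝ} (hf : Measurable f) :
    Measurable (gagliardoQuotient s f) := by
  unfold gagliardoQuotient
  fun_prop

/-- On one chart, the Gagliardo seminorm is controlled by the tangential gradient. -/
theorem BoundaryChart.exists_lintegral_gagliardo_le (χ : BoundaryChart Ω) (hd : 1 ≤ d)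
    {ρ : Euc d → ℝ} {N : Euc d → Euc d} {r a : ℝ} (h : IsCollar Ω ρ N r a) {s : ℝ} (hs0 : 0 < s)
    (hs1 : s < 1) :
    ∃ C : ℝ≥0∞, C < ⊤ ∧ ∀ f : Euc d → ℝ, ContDiff ℝ 1 f →
      ∫⁻ x in χ.patch, ∫⁻ y in χ.patch, ‖gagliardoQuotient s f (x, y)‖ₑ ^ 2 ∂(surf Ω) ∂(surf Ω) ≤
        C * ∫⁻ x, ‖tangentialGradient Ω f x‖ₑ ^ 2 ∂(surf Ω) := by
  obtain ⟨C, hC, hCF⟩ := exists_lintegral_gagliardo_ball_le (d - 1) hs1 χ.R_pos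
  have hdn : ((d : ℝ) - 1) / 2 + s = ((d - 1 : ℕ) : ℝ) / 2 + s := by rw [Nat.cast_sub hd, Nat.cast_one]
  set e : ℝ := ((d - 1 : ℕ) : ℝ) / 2 + s with he
  have he0 : 0 < e := by positivity
  set B : Set (Euc (d - 1)) := Metric.closedBall 0 χ.R with hB
  set Λ : ℝ≥0∞ := (χ.L : ℝ≥0∞) ^ (d - 1) with hΛ
  have hΛt : Λ < ⊤ := ENNReal.pow_lt_top ENNReal.coe_lt_top
  refine ⟨Λ * (Λ * (C * (χ.L : ℝ≥0∞) ^ 2)), ?_, fun f hf => ?_⟩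
  · exact ENNReal.mul_lt_top hΛt (ENNReal.mul_lt_top hΛt (ENNReal.mul_lt_top hC
      (ENNReal.pow_lt_top ENNReal.coe_lt_top)))
  let ν : Measure (Euc d) := (volume.restrict B).map χ.toFun
  have : IsFiniteMeasure (volume.restrict B) := ⟨by
    rw [Measure.restrict_apply_univ]; exact measure_closedBall_lt_top⟩
  have : IsFiniteMeasure ν := inferInstance
  let q : Euc d → Euc d → ℝ≥0∞ := fun x y => ‖gagliardoQuotient s f (x, y)‖ₑ ^ 2
  have hq : Measurable (fun p : Euc d × Euc d => q p.1 p.2) :=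
    (measurable_gagliardoQuotient hf.continuous.measurable).enorm.pow_const 2
  let F : Euc (d - 1) → ℝ := fun u => f (χ.toFun u)
  have hF : ContDiffOn ℝ 1 F (Metric.ball 0 (2 * χ.R)) := hf.comp_contDiffOn χ.contDiffOn
  -- The chart does not decrease distances, so the surface quotient is dominated by the one in the
  -- parameter ball.
  have hpt : ∀ u ∈ B, ∀ v ∈ B,
      q (χ.toFun u) (χ.toFun v) ≤ ‖(F u - F v) / ‖u - v‖ ^ e‖ₑ ^ 2 := by
    intro u hu v hv
    simp only [q, gagliardoQuotient, hdn, F]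
    rcases eq_or_ne u v with rfl | huv
    · simp
    have h1 : ‖u - v‖ ≤ ‖χ.toFun u - χ.toFun v‖ := by
      have := χ.lipschitz_proj.dist_le_mul (χ.toFun u) (χ.toFun v)
      rw [χ.proj_apply u (χ.closedBall_subset hu), χ.proj_apply v (χ.closedBall_subset hv)] at this
      simpa [dist_eq_norm] using this
    have h2 : 0 < ‖u - v‖ := norm_pos_iff.2 (sub_ne_zero.2 huv)
    have h3 : ‖u - v‖ ^ e ≤ ‖χ.toFun u - χ.toFun v‖ ^ e := Real.rpow_le_rpow h2.le h1 he0.le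
    have h4 : 0 < ‖u - v‖ ^ e := Real.rpow_pos_of_pos h2 e
    rw [Real.enorm_sq, Real.enorm_sq, div_pow, div_pow]
    gcongr
  obtain ⟨G, hG, hGeq⟩ := h.exists_continuous_eq_tangentialGradient hf
  calc ∫⁻ x in χ.patch, ∫⁻ y in χ.patch, q x y ∂(surf Ω) ∂(surf Ω)
      ≤ ∫⁻ x, ∫⁻ y, q x y ∂(Λ • ν) ∂(Λ • ν) :=
        lintegral_mono' χ.surf_restrict_le fun x => lintegral_mono' χ.surf_restrict_le le_rfl
    _ = Λ * (Λ * ∫⁻ x, ∫⁻ y, q x y ∂ν ∂ν) := by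
        simp only [lintegral_smul_measure, smul_eq_mul]
        rw [lintegral_const_mul _ hq.lintegral_prod_right']
    _ = Λ * (Λ * ∫⁻ u in B, ∫⁻ v in B, q (χ.toFun u) (χ.toFun v)) := by
        rw [lintegral_map' hq.lintegral_prod_right'.aemeasurable χ.aemeasurable]
        congr 2
        refine lintegral_congr fun u => ?_
        exact lintegral_map' (hq.comp measurable_prodMk_left).aemeasurable χ.aemeasurable
    _ ≤ Λ * (Λ * ∫⁻ u in B, ∫⁻ v in B, ‖(F u - F v) / ‖u - v‖ ^ e‖ₑ ^ 2) := by
        gcongr Λ * (Λ * ?_)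
        exact setLIntegral_mono' measurableSet_closedBall fun u hu =>
          setLIntegral_mono' measurableSet_closedBall fun v hv => hpt u hu v hv
    _ ≤ Λ * (Λ * (C * ∫⁻ u in B, ‖fderiv ℝ F u‖ₑ ^ 2)) := by
        gcongr
        exact hCF F hF
    _ ≤ Λ * (Λ * (C * ∫⁻ u in B, (χ.L : ℝ≥0∞) ^ 2 * ‖G (χ.toFun u)‖ₑ ^ 2)) := by
        gcongr Λ * (Λ * (C * ?_))
        refine setLIntegral_mono' measurableSet_closedBall fun u hu => ?_
        have h1 := χ.enorm_fderiv_comp_le hf (χ.closedBall_subset hu)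
        rw [hGeq (χ.mem_frontier u (χ.closedBall_subset hu))] at h1
        rw [← mul_pow]
        gcongr
    _ = Λ * (Λ * (C * (χ.L : ℝ≥0∞) ^ 2)) * ∫⁻ u in B, ‖G (χ.toFun u)‖ₑ ^ 2 := by
        rw [lintegral_const_mul' _ _ (ENNReal.pow_ne_top ENNReal.coe_ne_top)]
        ring
    _ ≤ Λ * (Λ * (C * (χ.L : ℝ≥0∞) ^ 2)) * ∫⁻ x in χ.patch, ‖G x‖ₑ ^ 2 ∂(surf Ω) := by
        gcongr
        exact χ.setLIntegral_le_patch (f := fun x => ‖G x‖ₑ ^ 2) (by fun_prop)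
    _ ≤ Λ * (Λ * (C * (χ.L : ℝ≥0∞) ^ 2)) * ∫⁻ x, ‖tangentialGradient Ω f x‖ₑ ^ 2 ∂(surf Ω) := by
        gcongr Λ * (Λ * (C * (χ.L : ℝ≥0∞) ^ 2)) * ?_
        refine (setLIntegral_le_lintegral _ _).trans_eq (lintegral_congr_ae ?_)
        filter_upwards [ae_mem_frontier h.isCompact_frontier.isClosed] with x hx
        rw [hGeq hx]

/-- Away from the diagonal the denominator is bounded below, and (a - b)² ≤ 2(a² + b²). -/
theorem enorm_gagliardoQuotient_sq_le {s δ : ℝ} (hδ : 0 < δ) (hs : 0 ≤ ((d : ℝ) - 1) / 2 + s)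
    (f : Euc d → ℝ) {p : Euc d × Euc d} (hp : δ ≤ ‖p.1 - p.2‖) :
    ‖gagliardoQuotient s f p‖ₑ ^ 2 ≤
      ENNReal.ofReal (2 / (δ ^ (((d : ℝ) - 1) / 2 + s)) ^ 2) * (‖f p.1‖ₑ ^ 2 + ‖f p.2‖ₑ ^ 2) := by
  have h1 : δ ^ (((d : ℝ) - 1) / 2 + s) ≤ ‖p.1 - p.2‖ ^ (((d : ℝ) - 1) / 2 + s) :=
    Real.rpow_le_rpow hδ.le hp hs
  have h2 : 0 < δ ^ (((d : ℝ) - 1) / 2 + s) := Real.rpow_pos_of_pos hδ _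
  simp only [gagliardoQuotient, Real.enorm_sq]
  rw [← ENNReal.ofReal_add (by positivity) (by positivity), ← ENNReal.ofReal_mul (by positivity)]
  refine ENNReal.ofReal_le_ofReal ?_
  rw [div_pow, div_mul_eq_mul_div]
  have h3 : (f p.1 - f p.2) ^ 2 ≤ 2 * (f p.1 ^ 2 + f p.2 ^ 2) := by
    nlinarith [sq_nonneg (f p.1 + f p.2)]
  gcongr

theorem lintegral_prod_enorm_sq_add {μ : Measure (Euc d)} [SFinite μ] {f : Euc d → ℝ}
    (hf : Measurable f) (K : ℝ≥0∞) :
    ∫⁻ p, K * (‖f p.1‖ₑ ^ 2 + ‖f p.2‖ₑ ^ 2) ∂(μ.prod μ) =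
      K * (2 * μ univ) * ∫⁻ x, ‖f x‖ₑ ^ 2 ∂μ := by
  rw [lintegral_const_mul _ (by fun_prop), lintegral_prod _ (by fun_prop)]
  have h1 : ∀ x, ∫⁻ y, (‖f x‖ₑ ^ 2 + ‖f y‖ₑ ^ 2) ∂μ =
      ‖f x‖ₑ ^ 2 * μ univ + ∫⁻ x, ‖f x‖ₑ ^ 2 ∂μ := by
    intro x
    rw [lintegral_add_left measurable_const, lintegral_const]
  simp only [h1]
  rw [lintegral_add_right _ measurable_const, lintegral_mul_const _ (by fun_prop), lintegral_const]
  ring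

theorem ae_prod_mem_frontier (hK : IsClosed (frontier Ω)) :
    ∀ᵐ p ∂((surf Ω).prod (surf Ω)), p.1 ∈ frontier Ω ∧ p.2 ∈ frontier Ω :=
  ((Measure.quasiMeasurePreserving_fst (μ := surf Ω) (ν := surf Ω)).ae (ae_mem_frontier hK)).and
    ((Measure.quasiMeasurePreserving_snd (μ := surf Ω) (ν := surf Ω)).ae (ae_mem_frontier hK))

/-- `H¹(∂Ω) ⊂ H^s(∂Ω)`, on `C¹` functions. -/
theorem IsCollar.exists_eLpNorm_gagliardo_le {ρ : Euc d → ℝ} {N : Euc d → Euc d} {r a : ℝ}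
    (h : IsCollar Ω ρ N r a) {s : ℝ} (hs0 : 0 < s) (hs1 : s < 1) :
    ∃ C : ℝ≥0∞, C < ⊤ ∧ ∀ f : Euc d → ℝ, ContDiff ℝ 1 f →
      eLpNorm (gagliardoQuotient s f) 2 ((surf Ω).prod (surf Ω)) ^ 2 ≤
        C * (eLpNorm f 2 (surf Ω) ^ 2 + eLpNorm (tangentialGradient Ω f) 2 (surf Ω) ^ 2) := by
  rcases (frontier Ω).eq_empty_or_nonempty with hemp | hne
  · exact ⟨0, ENNReal.zero_lt_top, fun f _ => by simp [surf_eq_zero hemp]⟩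
  have hd := h.one_le_dim hne
  have hfin := h.isFiniteMeasure_surf
  obtain ⟨S, δ, hδ, hS⟩ := h.exists_finite_charts
  have hC := fun χ : BoundaryChart Ω => χ.exists_lintegral_gagliardo_le hd h hs0 hs1
  choose C hCt hC using hC
  set e : ℝ := ((d : ℝ) - 1) / 2 + s with he
  have he0 : 0 < e := by
    have : (1 : ℝ) ≤ d := by exact_mod_cast hd
    have : 0 ≤ ((d : ℝ) - 1) / 2 := by linarith
    positivity
  set K : ℝ≥0∞ := ENNReal.ofReal (2 / (δ ^ e) ^ 2) with hK
  refine ⟨∑ χ ∈ S, C χ + K * (2 * surf Ω univ), ?_, fun f hf => ?_⟩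
  · exact ENNReal.add_lt_top.2 ⟨ENNReal.sum_lt_top.2 fun χ _ => hCt χ,
      ENNReal.mul_lt_top ENNReal.ofReal_lt_top (ENNReal.mul_lt_top (by norm_num)
        (measure_lt_top _ _))⟩
  let q : Euc d × Euc d → ℝ≥0∞ := fun p => ‖gagliardoQuotient s f p‖ₑ ^ 2
  have hq : Measurable q :=
    (measurable_gagliardoQuotient hf.continuous.measurable).enorm.pow_const 2
  have hPm : ∀ χ : BoundaryChart Ω, MeasurableSet χ.patch := fun χ =>
    χ.isCompact_patch.isClosed.measurableSet
  have hfm := hf.continuous.measurable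
  -- Pairs closer than δ share a patch and are handled in its chart; the remaining pairs are
  -- controlled by the L² norm alone.
  have hpt : ∀ p : Euc d × Euc d, p.1 ∈ frontier Ω → p.2 ∈ frontier Ω →
      q p ≤ ∑ χ ∈ S, (χ.patch ×ˢ χ.patch).indicator q p + K * (‖f p.1‖ₑ ^ 2 + ‖f p.2‖ₑ ^ 2) := by
    rintro ⟨x, y⟩ hx hy
    by_cases hxy : dist y x < δ
    · obtain ⟨χ, hχ, hsub⟩ := hS x hx
      have hsub' := hsub.trans (image_mono (Metric.closedBall_subset_closedBall
        (by linarith [χ.R_pos] : χ.R / 2 ≤ χ.R)))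
      have hmem : (x, y) ∈ χ.patch ×ˢ χ.patch :=
        ⟨hsub' ⟨Metric.mem_ball_self hδ, hx⟩, hsub' ⟨hxy, hy⟩⟩
      calc q (x, y) = (χ.patch ×ˢ χ.patch).indicator q (x, y) := (indicator_of_mem hmem q).symm
        _ ≤ ∑ χ ∈ S, (χ.patch ×ˢ χ.patch).indicator q (x, y) :=
          Finset.single_le_sum (f := fun χ : BoundaryChart Ω =>
            (χ.patch ×ˢ χ.patch).indicator q (x, y)) (fun _ _ => zero_le) hχ
        _ ≤ _ := le_self_add
    · refine le_trans ?_ le_add_self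
      have hxy' : δ ≤ ‖x - y‖ := by
        rw [← dist_eq_norm, dist_comm]
        exact not_lt.1 hxy
      exact enorm_gagliardoQuotient_sq_le hδ he0.le f (p := (x, y)) hxy'
  have hae := ae_prod_mem_frontier h.isCompact_frontier.isClosed
  rw [eLpNorm_two_sq, eLpNorm_two_sq, eLpNorm_two_sq]
  set A := ∫⁻ x, ‖f x‖ₑ ^ 2 ∂(surf Ω) with hA
  set D := ∫⁻ x, ‖tangentialGradient Ω f x‖ₑ ^ 2 ∂(surf Ω) with hD
  have hchart : ∀ χ : BoundaryChart Ω,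
      ∫⁻ p, (χ.patch ×ˢ χ.patch).indicator q p ∂((surf Ω).prod (surf Ω)) ≤ C χ * D := by
    intro χ
    rw [lintegral_indicator ((hPm χ).prod (hPm χ)), ← Measure.prod_restrict,
      lintegral_prod _ hq.aemeasurable]
    exact hC χ f hf
  have hfar : ∫⁻ p, K * (‖f p.1‖ₑ ^ 2 + ‖f p.2‖ₑ ^ 2) ∂((surf Ω).prod (surf Ω)) =
      K * (2 * surf Ω univ) * A :=
    lintegral_prod_enorm_sq_add hfm K
  calc ∫⁻ p, q p ∂((surf Ω).prod (surf Ω))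
      ≤ ∫⁻ p, (∑ χ ∈ S, (χ.patch ×ˢ χ.patch).indicator q p +
          K * (‖f p.1‖ₑ ^ 2 + ‖f p.2‖ₑ ^ 2)) ∂((surf Ω).prod (surf Ω)) :=
        lintegral_mono_ae (hae.mono fun p hp => hpt p hp.1 hp.2)
    _ = ∑ χ ∈ S, ∫⁻ p, (χ.patch ×ˢ χ.patch).indicator q p ∂((surf Ω).prod (surf Ω)) +
          K * (2 * surf Ω univ) * A := by
        rw [lintegral_add_right _ (by fun_prop), hfar, lintegral_finsetSum]
        exact fun χ _ => hq.indicator ((hPm χ).prod (hPm χ))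
    _ ≤ (∑ χ ∈ S, C χ) * D + K * (2 * surf Ω univ) * A := by
        rw [Finset.sum_mul]
        gcongr with χ _
        exact hchart χ
    _ ≤ (∑ χ ∈ S, C χ + K * (2 * surf Ω univ)) * (A + D) := by
        rw [add_mul]
        gcongr
        · exact le_add_self
        · exact le_self_add

/-- Smooth functions are dense in `C¹`, locally uniformly. -/
theorem exists_smooth_approx {f : Euc d → ℝ} (hf : ContDiff ℝ 1 f) {K : Set (Euc d)}
    (hK : IsCompact K) {ε : ℝ} (hε : 0 < ε) :
    ∃ g : Euc d → ℝ, ContDiff ℝ ∞ g ∧ ∀ x ∈ K, |g x - f x| ≤ ε ∧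
      ‖fderiv ℝ g x - fderiv ℝ f x‖ ≤ ε := by
  obtain ⟨χ, hχ, hχc, -, hχ1, -⟩ := exists_smooth_cutoff hK isOpen_univ (subset_univ K)
  let F : Euc d → ℝ := fun x => χ x * f x
  have hF : ContDiff ℝ 1 F := (hχ.of_le (by simp)).mul hf
  have hFc : HasCompactSupport F := hχc.mul_right
  have hFf : ∀ x ∈ K, F =ᶠ[𝓝 x] f := by
    intro x hx
    filter_upwards [(eventually_nhdsSet_iff_forall.1 hχ1) x hx] with y hy
    simp [F, hy]
  have hFd : Continuous (fderiv ℝ F) := hF.continuous_fderiv (by simp)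
  have hu := hFc.uniformContinuous_of_continuous hF.continuous
  have hu' := (hFc.fderiv ℝ).uniformContinuous_of_continuous hFd
  obtain ⟨δ, hδ, hδF⟩ := Metric.uniformContinuous_iff.1 hu ε hε
  obtain ⟨δ', hδ', hδF'⟩ := Metric.uniformContinuous_iff.1 hu' ε hε
  -- The mollification scale lies below the moduli of uniform continuity of F and DF; convolution
  -- commutes with differentiation, so one bump serves both.
  let b : ContDiffBump (0 : Euc d) := ⟨min δ δ' / 2, min δ δ', by positivity,
    half_lt_self (by positivity)⟩
  let L := ContinuousLinearMap.lsmul ℝ ℝ (E := ℝ)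
  have hbc : HasCompactSupport (b.normed volume) := b.hasCompactSupport_normed
  have hbi : LocallyIntegrable (b.normed volume) volume :=
    b.continuous_normed.locallyIntegrable
  refine ⟨convolution (b.normed volume) F L volume, ?_, fun x hx => ⟨?_, ?_⟩⟩
  · exact hbc.contDiff_convolution_left (n := ⊤) L b.contDiff_normed
      hF.continuous.locallyIntegrable
  · rw [← (hFf x hx).eq_of_nhds, ← Real.dist_eq]
    refine b.dist_normed_convolution_le hF.continuous.aestronglyMeasurable fun y hy => ?_
    exact (hδF (lt_of_lt_of_le hy (min_le_left _ _))).le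
  · rw [← (hFf x hx).fderiv_eq, ← dist_eq_norm,
      (hFc.hasFDerivAt_convolution_right L hbi hF x).fderiv]
    refine b.dist_normed_convolution_le hFd.aestronglyMeasurable fun y hy => ?_
    exact (hδF' (lt_of_lt_of_le hy (min_le_right _ _))).le

end SmoothFunctions

/-! ### C¹ functions belong to the Sobolev spaces -/

section SobolevOfContDiff

variable {d : ℕ} {Ω : Set (Euc d)}

theorem tangentialGradient_sub {f g : Euc d → ℝ} (hf : Differentiable ℝ f)
    (hg : Differentiable ℝ g) :
    tangentialGradient Ω (f - g) = tangentialGradient Ω f - tangentialGradient Ω g := by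
  funext x
  have h : gradient (f - g) x = gradient f x - gradient g x := by
    simp only [gradient]
    rw [fderiv_sub (hf x) (hg x), map_sub]
  simp only [tangentialGradient, h, inner_sub_left, sub_smul, Pi.sub_apply]
  abel

theorem tendsto_eLpNorm_zero_of_bound {α E : Type*} [MeasurableSpace α] [NormedAddCommGroup E]
    {μ : Measure α} [IsFiniteMeasure μ] {f : ℕ → α → E} {C : ℕ → ℝ}
    (hf : ∀ k, ∀ᵐ x ∂μ, ‖f k x‖ ≤ C k) (hC : Tendsto C atTop (𝓝 0)) :
    Tendsto (fun k => eLpNorm (f k) 2 μ) atTop (𝓝 0) := by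
  have h1 : Tendsto (fun k => μ univ ^ (2 : ℝ≥0∞).toReal⁻¹ * ENNReal.ofReal (C k)) atTop (𝓝 0) := by
    have h2 := ENNReal.tendsto_ofReal hC
    rw [ENNReal.ofReal_zero] at h2
    have := ENNReal.Tendsto.const_mul (a := μ univ ^ (2 : ℝ≥0∞).toReal⁻¹) h2
      (Or.inr (ENNReal.rpow_ne_top_of_nonneg (by positivity) (measure_ne_top _ _)))
    simpa using this
  exact tendsto_of_tendsto_of_tendsto_of_le_of_le tendsto_const_nhds h1 (fun _ => zero_le)
    fun k => eLpNorm_le_of_ae_bound (hf k)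

namespace IsCollar

variable {ρ : Euc d → ℝ} {N : Euc d → Euc d} {r a : ℝ}

theorem memLp_of_contDiff (h : IsCollar Ω ρ N r a) {f : Euc d → ℝ} (hf : ContDiff ℝ 1 f) :
    MemLp f 2 (surf Ω) ∧ MemLp (tangentialGradient Ω f) 2 (surf Ω) := by
  obtain ⟨G, hG, hfG⟩ := h.exists_continuous_eq_tangentialGradient hf
  exact ⟨h.memLp_of_continuous hf.continuous fun _ _ => rfl, h.memLp_of_continuous hG hfG⟩

/-- Uniform C¹ approximation on the compact boundary becomes L² approximation because the surface
measure is finite. -/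
theorem exists_seq_smooth (h : IsCollar Ω ρ N r a) {f : Euc d → ℝ} (hf : ContDiff ℝ 1 f) :
    ∃ g : ℕ → Euc d → ℝ, (∀ k, ContDiff ℝ ∞ (g k)) ∧
      Tendsto (fun k => eLpNorm (g k - f) 2 (surf Ω)) atTop (𝓝 0) ∧
      Tendsto (fun k => eLpNorm (tangentialGradient Ω (g k - f)) 2 (surf Ω)) atTop (𝓝 0) := by
  have := h.isFiniteMeasure_surf
  choose g hg hgf using fun k : ℕ => exists_smooth_approx hf h.isCompact_frontier
    (ε := 1 / ((k : ℝ) + 1)) (by positivity)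
  have hlim := tendsto_one_div_add_atTop_nhds_zero_nat (𝕜 := ℝ)
  have hae := ae_mem_frontier h.isCompact_frontier.isClosed
  refine ⟨g, hg, tendsto_eLpNorm_zero_of_bound (fun k => ?_) hlim,
    tendsto_eLpNorm_zero_of_bound (C := fun k : ℕ => 2 * (1 / ((k : ℝ) + 1))) (fun k => ?_)
      (by simpa using hlim.const_mul 2)⟩
  · filter_upwards [hae] with x hx using (hgf k x hx).1
  · filter_upwards [hae] with x hx
    have h1 : ‖gradient (g k - f) x‖ ≤ 1 / ((k : ℝ) + 1) := by
      rw [gradient, LinearIsometryEquiv.norm_map, fderiv_sub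
        ((hg k).differentiable (by simp) x) (hf.differentiable (by simp) x)]
      exact (hgf k x hx).2
    rw [tangentialGradient, h.outerNormal_eq x hx]
    have h2 := h.norm_normal x hx
    calc _ ≤ ‖gradient (g k - f) x‖ + ‖⟪gradient (g k - f) x, N x⟫ • N x‖ := norm_sub_le _ _
      _ ≤ ‖gradient (g k - f) x‖ + ‖gradient (g k - f) x‖ := by
        gcongr
        rw [norm_smul, h2, mul_one]
        refine (norm_inner_le_norm _ _).trans ?_
        rw [h2, mul_one]
      _ ≤ _ := by linarith

theorem hasTangentialGradient (h : IsCollar Ω ρ N r a) {f : Euc d → ℝ} (hf : ContDiff ℝ 1 f) :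
    HasTangentialGradient Ω f (tangentialGradient Ω f) := by
  obtain ⟨g, hg, h1, h2⟩ := h.exists_seq_smooth hf
  refine ⟨(h.memLp_of_contDiff hf).2, g, hg,
    fun k => h.memLp_of_contDiff ((hg k).of_le (by simp)), h1, ?_⟩
  simpa only [tangentialGradient_sub ((hg _).differentiable (by simp))
    (hf.differentiable (by simp))] using h2

/-- One bound covers all three regimes in the definition of the seminorm. -/
theorem exists_sobolevSeminorm_le (h : IsCollar Ω ρ N r a) (s : ℝ) :
    ∃ C : ℝ≥0∞, C < ⊤ ∧ ∀ f : Euc d → ℝ, ContDiff ℝ 1 f → sobolevSeminorm Ω s f ^ 2 ≤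
      C * (eLpNorm f 2 (surf Ω) ^ 2 + eLpNorm (tangentialGradient Ω f) 2 (surf Ω) ^ 2) := by
  unfold sobolevSeminorm
  rcases le_or_gt s 0 with h0 | h0
  · exact ⟨0, ENNReal.zero_lt_top, fun f _ => by simp [h0]⟩
  rcases lt_or_ge s 1 with h1 | h1
  · simpa only [not_le.2 h0, h1, if_true, if_false] using h.exists_eLpNorm_gagliardo_le h0 h1
  · refine ⟨1, ENNReal.one_lt_top, fun f hf => ?_⟩
    simp only [not_le.2 h0, not_lt.2 h1, if_false, one_mul]
    refine le_trans ?_ le_add_self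
    gcongr
    exact iInf₂_le _ (h.hasTangentialGradient hf)

/-- The seminorm of g_k - f is controlled by quantities that tend to zero, which gives the
approximability by smooth functions required for membership. -/
theorem memSobolev_of_contDiff (h : IsCollar Ω ρ N r a) {s : ℝ} {f : Euc d → ℝ}
    (hf : ContDiff ℝ 1 f) : MemSobolev Ω s f := by
  obtain ⟨C, hC, hCf⟩ := h.exists_sobolevSeminorm_le s
  have hfin : ∀ {u : Euc d → ℝ}, ContDiff ℝ 1 u →
      eLpNorm u 2 (surf Ω) ^ 2 + eLpNorm (tangentialGradient Ω u) 2 (surf Ω) ^ 2 < ⊤ := fun hu =>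
    ENNReal.add_lt_top.2 ⟨ENNReal.pow_lt_top (h.memLp_of_contDiff hu).1.2,
      ENNReal.pow_lt_top (h.memLp_of_contDiff hu).2.2⟩
  refine ⟨(h.memLp_of_contDiff hf).1, ?_, fun ε hε => ?_⟩
  · have := (hCf f hf).trans_lt (ENNReal.mul_lt_top hC (hfin hf))
    by_contra hcon
    rw [not_lt_top_iff.1 hcon] at this
    simp at this
  obtain ⟨g, hg, h1, h2⟩ := h.exists_seq_smooth hf
  have hlim : Tendsto (fun k => C * (eLpNorm (g k - f) 2 (surf Ω) ^ 2 +
      eLpNorm (tangentialGradient Ω (g k - f)) 2 (surf Ω) ^ 2)) atTop (𝓝 0) := by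
    have := ENNReal.Tendsto.const_mul (a := C) ((ENNReal.Tendsto.pow (n := 2) h1).add
      (ENNReal.Tendsto.pow (n := 2) h2)) (Or.inr hC.ne)
    simpa using this
  obtain ⟨k, hk1, hk2⟩ := ((h1.eventually (gt_mem_nhds hε)).and
    (hlim.eventually (gt_mem_nhds (ENNReal.pow_pos hε 2)))).exists
  have hg1 : ContDiff ℝ 1 (g k) := (hg k).of_le (by simp)
  refine ⟨g k, hg k, (h.memLp_of_contDiff hg1).1, ?_, ?_⟩
  · rw [eLpNorm_sub_comm]
    exact hk1.le
  · have h3 : sobolevSeminorm Ω s (g k - f) ≤ ε := by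
      have := (hCf (g k - f) (hg1.sub hf)).trans hk2.le
      exact (ENNReal.pow_le_pow_left_iff two_ne_zero).1 this
    have h4 : f - g k = (-1 : ℝ) • (g k - f) := by simp
    rw [h4]
    refine (sobolevSeminorm_smul_le _).trans ?_
    simpa using h3

end IsCollar

end SobolevOfContDiff

/-! ### Sobolev spaces as Hilbert spaces -/

section HilbertModel

variable {d : ℕ} {Ω : Set (Euc d)} {s : ℝ}

theorem sobolevNorm_sq (φ : Euc d → ℝ) : sobolevNorm Ω s φ ^ 2 =
    (eLpNorm φ 2 (surf Ω)).toReal ^ 2 + (sobolevSeminorm Ω s φ).toReal ^ 2 :=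
  Real.sq_sqrt (by positivity)

theorem sobolevNorm_nonneg (φ : Euc d → ℝ) : 0 ≤ sobolevNorm Ω s φ := Real.sqrt_nonneg _

theorem memLp_gagliardoQuotient [SFinite (surf Ω)] {φ : Euc d → ℝ} (h0 : 0 < s) (h1 : s < 1)
    (hφ : MemSobolev Ω s φ) : MemLp (gagliardoQuotient s φ) 2 ((surf Ω).prod (surf Ω)) := by
  refine ⟨aestronglyMeasurable_gagliardoQuotient hφ.1.1, ?_⟩
  simpa only [sobolevSeminorm, not_le.2 h0, h1, if_true, if_false] using hφ.2.1

theorem gagliardoQuotient_add (φ ψ : Euc d → ℝ) :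
    gagliardoQuotient s (φ + ψ) = gagliardoQuotient s φ + gagliardoQuotient s ψ := by
  funext p
  simp only [gagliardoQuotient, Pi.add_apply]
  ring

theorem gagliardoQuotient_sub (φ ψ : Euc d → ℝ) :
    gagliardoQuotient s (φ - ψ) = gagliardoQuotient s φ - gagliardoQuotient s ψ := by
  funext p
  simp only [gagliardoQuotient, Pi.sub_apply]
  ring

theorem gagliardoQuotient_smul (c : ℝ) (φ : Euc d → ℝ) :
    gagliardoQuotient s (c • φ) = c • gagliardoQuotient s φ := by
  funext p
  simp only [gagliardoQuotient, Pi.smul_apply, smul_eq_mul]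
  ring

/-- Almost everywhere convergence passes to difference quotients. -/
theorem ae_tendsto_gagliardoQuotient [SFinite (surf Ω)] {f : ℕ → Euc d → ℝ} {φ : Euc d → ℝ}
    (h : ∀ᵐ x ∂(surf Ω), Tendsto (fun k => f k x) atTop (𝓝 (φ x))) :
    ∀ᵐ p ∂((surf Ω).prod (surf Ω)), Tendsto (fun k => gagliardoQuotient s (f k) p) atTop
      (𝓝 (gagliardoQuotient s φ p)) := by
  have h1 := (Measure.quasiMeasurePreserving_fst (μ := surf Ω) (ν := surf Ω)).ae h
  have h2 := (Measure.quasiMeasurePreserving_snd (μ := surf Ω) (ν := surf Ω)).ae h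
  filter_upwards [h1, h2] with p hp1 hp2
  exact (hp1.sub hp2).div_const _

/-- `H^s(∂Ω)` is a Hilbert space: the fractional case. -/
theorem exists_hilbert_model_of_lt_one [SFinite (surf Ω)] (h0 : 0 < s) (h1 : s < 1) :
    ∃ (V : Submodule ℝ (WithLp 2 (Lp ℝ 2 (surf Ω) × Lp ℝ 2 ((surf Ω).prod (surf Ω)))))
      (P : V →ₗ[ℝ] sobolevSpace Ω s), IsClosed (V : Set (WithLp 2 (Lp ℝ 2 (surf Ω) ×
        Lp ℝ 2 ((surf Ω).prod (surf Ω))))) ∧ Function.Surjective P ∧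
        ∀ w, ‖w‖ = sobolevNorm Ω s (toFun (P w)) := by
  let G : sobolevSpace Ω s → Lp ℝ 2 ((surf Ω).prod (surf Ω)) := fun φ =>
    (memLp_gagliardoQuotient h0 h1 φ.2).toLp _
  have hG : ∀ φ, G φ =ᵐ[(surf Ω).prod (surf Ω)] gagliardoQuotient s (toFun φ) := fun φ =>
    MemLp.coeFn_toLp _
  let T : sobolevSpace Ω s →ₗ[ℝ] WithLp 2 (Lp ℝ 2 (surf Ω) × Lp ℝ 2 ((surf Ω).prod (surf Ω))) :=
    { toFun := fun φ => WithLp.toLp 2 ((φ : Lp ℝ 2 (surf Ω)), G φ)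
      map_add' := by
        intro φ ψ
        rw [← WithLp.toLp_add, Prod.mk_add_mk]
        congr 2
        refine Lp.ext ?_
        refine (hG _).trans (EventuallyEq.trans ?_ (Lp.coeFn_add _ _).symm)
        refine (gagliardoQuotient_congr (Lp.coeFn_add (φ : Lp ℝ 2 (surf Ω)) ψ)).trans ?_
        rw [gagliardoQuotient_add]
        exact ((hG φ).add (hG ψ)).symm
      map_smul' := by
        intro c φ
        rw [RingHom.id_apply, ← WithLp.toLp_smul, Prod.smul_mk]
        congr 2
        refine Lp.ext ?_
        refine (hG _).trans (EventuallyEq.trans ?_ (Lp.coeFn_smul _ _).symm)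
        refine (gagliardoQuotient_congr (Lp.coeFn_smul c (φ : Lp ℝ 2 (surf Ω)))).trans ?_
        rw [gagliardoQuotient_smul]
        exact ((hG φ).const_smul c).symm }
  have hTfst : ∀ φ, (T φ).fst = φ := fun φ => rfl
  have hTsnd : ∀ φ, (T φ).snd = G φ := fun φ => rfl
  have hTinj : Function.Injective T := fun φ ψ h => Subtype.ext (congrArg (fun x => x.fst) h)
  have hTnorm : ∀ φ, ‖T φ‖ = sobolevNorm Ω s (toFun φ) := by
    intro φ
    rw [← sq_eq_sq₀ (norm_nonneg _) (sobolevNorm_nonneg _), WithLp.prod_norm_sq_eq_of_L2,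
      sobolevNorm_sq, hTfst, hTsnd, Lp.norm_def, Lp.norm_def, eLpNorm_congr_ae (hG φ)]
    simp only [sobolevSeminorm, not_le.2 h0, h1, if_true, if_false]
  refine ⟨LinearMap.range T, (LinearEquiv.ofInjective T hTinj).symm, ?_,
    LinearEquiv.surjective _, fun w => ?_⟩
  · refine IsSeqClosed.isClosed ?_
    intro x y hx hxy
    choose φ hφ using hx
    have e1 : ∀ n, (x n).fst = φ n := fun n => by rw [← hφ n, hTfst]
    have e2 : ∀ n, (x n).snd = G (φ n) := fun n => by rw [← hφ n, hTsnd]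
    have t1 : Tendsto (fun n => (φ n : Lp ℝ 2 (surf Ω))) atTop (𝓝 y.fst) := by
      have := ((WithLp.prod_continuous_ofLp 2 _ _).fst.tendsto y).comp hxy
      exact this.congr e1
    have t2 : Tendsto (fun n => G (φ n)) atTop (𝓝 y.snd) := by
      have := ((WithLp.prod_continuous_ofLp 2 _ _).snd.tendsto y).comp hxy
      exact this.congr e2
    -- Successive almost everywhere convergent subsequences identify the limit of the quotients with
    -- the quotient of the limit, so the range of T is closed once membership is known.
    obtain ⟨k, hk, hka⟩ := (tendstoInMeasure_of_tendsto_Lp t1).exists_seq_tendsto_ae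
    have t2' := t2.comp hk.tendsto_atTop
    obtain ⟨l, hl, hla⟩ := (tendstoInMeasure_of_tendsto_Lp t2').exists_seq_tendsto_ae
    have hka' : ∀ᵐ x ∂(surf Ω), Tendsto (fun n => toFun (φ (k (l n))) x) atTop (𝓝 (y.fst x)) := by
      filter_upwards [hka] with x hx using hx.comp hl.tendsto_atTop
    have hyG : y.snd =ᵐ[(surf Ω).prod (surf Ω)] gagliardoQuotient s y.fst := by
      have h2 : ∀ᵐ p ∂((surf Ω).prod (surf Ω)), ∀ n,
          G (φ (k (l n))) p = gagliardoQuotient s (toFun (φ (k (l n)))) p :=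
        ae_all_iff.2 fun n => hG _
      filter_upwards [hla, h2, ae_tendsto_gagliardoQuotient (s := s) hka'] with p hp1 hp2 hp3
      refine tendsto_nhds_unique hp1 (hp3.congr fun n => ?_)
      exact (hp2 n).symm
    have hsem : ∀ ψ : Euc d → ℝ, sobolevSeminorm Ω s ψ =
        eLpNorm (gagliardoQuotient s ψ) 2 ((surf Ω).prod (surf Ω)) := fun ψ => by
      simp only [sobolevSeminorm, not_le.2 h0, h1, if_true, if_false]
    -- Smooth approximability passes to the limit by halving ε.
    have hmem : MemSobolev Ω s y.fst := by
      refine ⟨Lp.memLp _, ?_, fun ε hε => ?_⟩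
      · rw [hsem, ← eLpNorm_congr_ae hyG]
        exact Lp.eLpNorm_lt_top _
      · have hε2 := ENNReal.half_pos hε.ne'
        have u1 := (Lp.tendsto_Lp_iff_tendsto_eLpNorm' _ _).1 t1
        have u2 := (Lp.tendsto_Lp_iff_tendsto_eLpNorm' _ _).1 t2
        obtain ⟨n, hn1, hn2⟩ := ((u1.eventually (gt_mem_nhds hε2)).and
          (u2.eventually (gt_mem_nhds hε2))).exists
        obtain ⟨f, hf, hf2, hf3, hf4⟩ := (φ n).2.2.2 (ε / 2) hε2
        have e : (y.fst : Euc d → ℝ) - f = (y.fst - toFun (φ n)) + (toFun (φ n) - f) := by abel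
        have m1 : AEStronglyMeasurable ((y.fst : Euc d → ℝ) - toFun (φ n)) (surf Ω) :=
          ((Lp.memLp y.fst).sub (Lp.memLp (φ n : Lp ℝ 2 (surf Ω)))).1
        have m2 : AEStronglyMeasurable (toFun (φ n) - f) (surf Ω) :=
          ((Lp.memLp (φ n : Lp ℝ 2 (surf Ω))).sub hf2).1
        refine ⟨f, hf, hf2, ?_, ?_⟩
        · rw [e, ← ENNReal.add_halves ε]
          refine (eLpNorm_add_le m1 m2 (by norm_num)).trans (add_le_add ?_ hf3)
          rw [eLpNorm_sub_comm]
          exact hn1.le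
        · rw [hsem] at hf4 ⊢
          rw [e, ← ENNReal.add_halves ε, gagliardoQuotient_add]
          refine (eLpNorm_add_le (aestronglyMeasurable_gagliardoQuotient m1)
            (aestronglyMeasurable_gagliardoQuotient m2) (by norm_num)).trans (add_le_add ?_ hf4)
          rw [gagliardoQuotient_sub, eLpNorm_sub_comm, ← eLpNorm_congr_ae ((hG (φ n)).sub hyG)]
          exact hn2.le
    refine ⟨⟨y.fst, hmem⟩, ?_⟩
    refine (WithLp.ofLp_injective 2) (Prod.ext rfl ?_)
    exact Lp.ext ((hG _).trans hyG.symm)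
  · obtain ⟨φ, hφ⟩ := (LinearEquiv.ofInjective T hTinj).surjective w
    rw [← hφ]
    simp only [LinearEquiv.coe_coe, LinearEquiv.symm_apply_apply]
    exact hTnorm φ

/-- The form with ε passes to L² limits directly, without diagonal sequences. -/
theorem hasTangentialGradient_iff {φ : Euc d → ℝ} {g : Euc d → Euc d} :
    HasTangentialGradient Ω φ g ↔ MemLp g 2 (surf Ω) ∧ ∀ ε : ℝ≥0∞, 0 < ε →
      ∃ f : Euc d → ℝ, ContDiff ℝ ∞ f ∧ MemLp f 2 (surf Ω) ∧
        MemLp (tangentialGradient Ω f) 2 (surf Ω) ∧ eLpNorm (f - φ) 2 (surf Ω) ≤ ε ∧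
        eLpNorm (tangentialGradient Ω f - g) 2 (surf Ω) ≤ ε := by
  constructor
  · rintro ⟨h1, f, h2, h3, h4, h5⟩
    refine ⟨h1, fun ε hε => ?_⟩
    obtain ⟨k, hk1, hk2⟩ := ((h4.eventually (gt_mem_nhds hε)).and
      (h5.eventually (gt_mem_nhds hε))).exists
    exact ⟨f k, h2 k, (h3 k).1, (h3 k).2, hk1.le, hk2.le⟩
  · rintro ⟨h1, h2⟩
    choose f hf1 hf2 hf3 hf4 hf5 using fun k : ℕ => h2 ((k : ℝ≥0∞) + 1)⁻¹ (by simp)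
    have hlim : Tendsto (fun k : ℕ => ((k : ℝ≥0∞) + 1)⁻¹) atTop (𝓝 0) := by
      have := ENNReal.tendsto_inv_nat_nhds_zero.comp (tendsto_add_atTop_nat 1)
      refine this.congr fun k => ?_
      simp
    exact ⟨h1, f, hf1, fun k => ⟨hf2 k, hf3 k⟩,
      tendsto_of_tendsto_of_tendsto_of_le_of_le tendsto_const_nhds hlim (fun _ => zero_le) hf4,
      tendsto_of_tendsto_of_tendsto_of_le_of_le tendsto_const_nhds hlim (fun _ => zero_le) hf5⟩

theorem ShapeStability.HasTangentialGradient.congr_right {φ : Euc d → ℝ} {g g' : Euc d → Euc d}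
    (hg : g =ᵐ[surf Ω] g') (h : HasTangentialGradient Ω φ g) : HasTangentialGradient Ω φ g' := by
  obtain ⟨h1, f, h2, h3, h4, h5⟩ := h
  refine ⟨(memLp_congr_ae hg).1 h1, f, h2, h3, h4, h5.congr fun k => eLpNorm_congr_ae ?_⟩
  filter_upwards [hg] with x hx
  simp [hx]

/-- If f approximates φ, then g - ∇_τ f is a tangential gradient of φ - f and bounds its seminorm;
so the functions defining the generalized gradient serve as smooth approximants. -/
theorem ShapeStability.HasTangentialGradient.memSobolev {φ : Euc d → ℝ} {g : Euc d → Euc d}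
    (hφ : MemLp φ 2 (surf Ω)) (h : HasTangentialGradient Ω φ g) : MemSobolev Ω 1 φ := by
  have hsem : ∀ (ψ : Euc d → ℝ) (g' : Euc d → Euc d), HasTangentialGradient Ω ψ g' →
      sobolevSeminorm Ω 1 ψ ≤ eLpNorm g' 2 (surf Ω) := by
    intro ψ g' hg'
    simp only [sobolevSeminorm, not_le.2 (zero_lt_one' ℝ), lt_irrefl, if_false]
    exact iInf₂_le g' hg'
  refine ⟨hφ, (hsem φ g h).trans_lt h.1.2, fun ε hε => ?_⟩
  obtain ⟨f, hf1, hf2, hf3, hf4, hf5⟩ := (hasTangentialGradient_iff.1 h).2 ε hε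
  refine ⟨f, hf1, hf2, by rwa [eLpNorm_sub_comm], ?_⟩
  have hf : HasTangentialGradient Ω f (tangentialGradient Ω f) :=
    ⟨hf3, fun _ => f, fun _ => hf1, fun _ => ⟨hf2, hf3⟩, by simp, by simp⟩
  have h1 := h.add hφ (hf2.const_smul (-1 : ℝ)) (hf.smul (-1))
  have e1 : φ + (-1 : ℝ) • f = φ - f := by simp [sub_eq_add_neg]
  have e2 : g + (-1 : ℝ) • tangentialGradient Ω f = g - tangentialGradient Ω f := by
    simp [sub_eq_add_neg]
  rw [e1, e2] at h1
  refine (hsem _ _ h1).trans ?_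
  rwa [eLpNorm_sub_comm]

/-- The closed graph of the generalized tangential gradient. -/
def gradientGraph (Ω : Set (Euc d)) :
    Submodule ℝ (WithLp 2 (Lp ℝ 2 (surf Ω) × Lp (Euc d) 2 (surf Ω))) where
  carrier := {w | HasTangentialGradient Ω w.fst w.snd}
  zero_mem' := (hasTangentialGradient_zero.congr (Lp.coeFn_zero ℝ 2 (surf Ω)).symm).congr_right
    (Lp.coeFn_zero (Euc d) 2 (surf Ω)).symm
  add_mem' {v w} hv hw := ((HasTangentialGradient.add (Lp.memLp _) (Lp.memLp _) hv hw).congr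
    (Lp.coeFn_add v.fst w.fst).symm).congr_right (Lp.coeFn_add v.snd w.snd).symm
  smul_mem' c w hw := ((HasTangentialGradient.smul c hw).congr
    (Lp.coeFn_smul c w.fst).symm).congr_right (Lp.coeFn_smul c w.snd).symm

theorem isClosed_gradientGraph : IsClosed (gradientGraph Ω : Set (WithLp 2 (Lp ℝ 2 (surf Ω) ×
    Lp (Euc d) 2 (surf Ω)))) := by
  refine IsSeqClosed.isClosed ?_
  intro x y hx hxy
  have t1 : Tendsto (fun n => (x n).fst) atTop (𝓝 y.fst) :=
    ((WithLp.prod_continuous_ofLp 2 _ _).fst.tendsto y).comp hxy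
  have t2 : Tendsto (fun n => (x n).snd) atTop (𝓝 y.snd) :=
    ((WithLp.prod_continuous_ofLp 2 _ _).snd.tendsto y).comp hxy
  have u1 := (Lp.tendsto_Lp_iff_tendsto_eLpNorm' _ _).1 t1
  have u2 := (Lp.tendsto_Lp_iff_tendsto_eLpNorm' _ _).1 t2
  refine hasTangentialGradient_iff.2 ⟨Lp.memLp _, fun ε hε => ?_⟩
  have hε2 := ENNReal.half_pos hε.ne'
  obtain ⟨n, hn1, hn2⟩ := ((u1.eventually (gt_mem_nhds hε2)).and
    (u2.eventually (gt_mem_nhds hε2))).exists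
  obtain ⟨f, hf1, hf2, hf3, hf4, hf5⟩ := (hasTangentialGradient_iff.1 (hx n)).2 (ε / 2) hε2
  refine ⟨f, hf1, hf2, hf3, ?_, ?_⟩
  · have e : f - (y.fst : Euc d → ℝ) = (f - (x n).fst) + ((x n).fst - y.fst) := by abel
    rw [e, ← ENNReal.add_halves ε]
    exact (eLpNorm_add_le (hf2.sub (Lp.memLp _)).1 ((Lp.memLp _).sub (Lp.memLp _)).1
      (by norm_num)).trans (add_le_add hf4 hn1.le)
  · have e : tangentialGradient Ω f - (y.snd : Euc d → Euc d) =
      (tangentialGradient Ω f - (x n).snd) + ((x n).snd - y.snd) := by abel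
    rw [e, ← ENNReal.add_halves ε]
    exact (eLpNorm_add_le (hf3.sub (Lp.memLp _)).1 ((Lp.memLp _).sub (Lp.memLp _)).1
      (by norm_num)).trans (add_le_add hf5 hn2.le)

/-- `H¹(∂Ω)` is a Hilbert space: it is isometric to the set of elements of the closed graph of the
tangential gradient that have the least norm among those over the same function. -/
theorem exists_hilbert_model_one :
    ∃ (V : Submodule ℝ (WithLp 2 (Lp ℝ 2 (surf Ω) × Lp (Euc d) 2 (surf Ω))))
      (P : V →ₗ[ℝ] sobolevSpace Ω 1), IsClosed (V : Set (WithLp 2 (Lp ℝ 2 (surf Ω) ×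
        Lp (Euc d) 2 (surf Ω)))) ∧ Function.Surjective P ∧
        ∀ w, ‖w‖ = sobolevNorm Ω 1 (toFun (P w)) := by
  let X := WithLp 2 (Lp ℝ 2 (surf Ω) × Lp (Euc d) 2 (surf Ω))
  let fstL : X →L[ℝ] Lp ℝ 2 (surf Ω) := WithLp.fstL 2 ℝ _ _
  -- The pairs (0, g), a possible ambiguity of the generalized gradient. Passing to the orthogonal
  -- complement of Z keeps one representative over each function without proving that Z is trivial.
  let Z : Submodule ℝ X := gradientGraph Ω ⊓ LinearMap.ker (fstL : X →ₗ[ℝ] Lp ℝ 2 (surf Ω))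
  have hZc : IsClosed (Z : Set X) := isClosed_gradientGraph.inter fstL.isClosed_ker
  have : CompleteSpace Z := hZc.completeSpace_coe
  let V : Submodule ℝ X := gradientGraph Ω ⊓ Zᗮ
  let P : V →ₗ[ℝ] sobolevSpace Ω 1 :=
    { toFun := fun w => ⟨(w : X).fst, HasTangentialGradient.memSobolev (Lp.memLp _) w.2.1⟩
      map_add' := fun _ _ => rfl
      map_smul' := fun _ _ => rfl }
  refine ⟨V, P, isClosed_gradientGraph.inter (Submodule.isClosed_orthogonal Z), fun φ => ?_,
    fun w => ?_⟩
  · have hlt : (⨅ (g : Euc d → Euc d) (_ : HasTangentialGradient Ω (toFun φ) g),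
        eLpNorm g 2 (surf Ω)) < ⊤ := by
      simpa only [sobolevSeminorm, not_le.2 (zero_lt_one' ℝ), lt_irrefl, if_false] using φ.2.2.1
    obtain ⟨g, hg⟩ := iInf_lt_iff.1 hlt
    obtain ⟨hg, -⟩ := iInf_lt_iff.1 hg
    let v : X := WithLp.toLp 2 ((φ : Lp ℝ 2 (surf Ω)), hg.1.toLp g)
    have hv : v ∈ gradientGraph Ω := hg.congr_right (MemLp.coeFn_toLp hg.1).symm
    have hz : (Z.starProjection v) ∈ Z := Submodule.starProjection_apply_mem Z v
    refine ⟨⟨v - Z.starProjection v, Submodule.sub_mem _ hv hz.1,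
      Submodule.sub_starProjection_mem_orthogonal v⟩, ?_⟩
    apply Subtype.ext
    have h1 : (Z.starProjection v).fst = 0 := hz.2
    change (v - Z.starProjection v).fst = φ
    rw [WithLp.sub_fst, h1, sub_zero]
    rfl
  · rw [← sq_eq_sq₀ (norm_nonneg _) (sobolevNorm_nonneg _), sobolevNorm_sq]
    have h1 : ‖w‖ ^ 2 = ‖(w : X).fst‖ ^ 2 + ‖(w : X).snd‖ ^ 2 := WithLp.prod_norm_sq_eq_of_L2 (w : X)
    rw [h1, Lp.norm_def, Lp.norm_def]
    congr 3
    simp only [sobolevSeminorm, not_le.2 (zero_lt_one' ℝ), lt_irrefl, if_false]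
    refine le_antisymm (le_iInf₂ fun g hg => ?_)
      (iInf₂_le (((w : X).snd : Lp (Euc d) 2 (surf Ω)) : Euc d → Euc d) w.2.1)
    let v : X := WithLp.toLp 2 ((w : X).fst, hg.1.toLp g)
    have hv : v ∈ gradientGraph Ω := hg.congr_right (MemLp.coeFn_toLp hg.1).symm
    have hz : v - w ∈ Z := by
      refine ⟨Submodule.sub_mem _ hv w.2.1, ?_⟩
      change (v - (w : X)).fst = 0
      rw [WithLp.sub_fst]
      exact sub_self _
    -- Any other gradient over the same function differs from w by an element of Z, so by
    -- orthogonality its norm is no smaller; w attains the infimum in the seminorm.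
    have h2 : ⟪v - (w : X), (w : X)⟫ = 0 := w.2.2 _ hz
    rw [WithLp.prod_inner_apply] at h2
    have h3 : (v - (w : X)).fst = 0 := hz.2
    have h4 : (v - (w : X)).snd = hg.1.toLp g - (w : X).snd := rfl
    have h5 : ⟪hg.1.toLp g - (w : X).snd, (w : X).snd⟫ = 0 := by
      have h6 : ⟪(v - (w : X)).fst, (w : X).fst⟫ + ⟪(v - (w : X)).snd, (w : X).snd⟫ = 0 := h2
      rwa [h3, h4, inner_zero_left, zero_add] at h6
    have h7 : ‖(w : X).snd‖ ≤ ‖hg.1.toLp g‖ := by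
      rw [inner_sub_left, real_inner_self_eq_norm_sq, sub_eq_zero] at h5
      have := real_inner_le_norm (hg.1.toLp g) (w : X).snd
      rw [h5] at this
      rcases (norm_nonneg (w : X).snd).eq_or_lt with h0 | h0
      · rw [← h0]
        exact norm_nonneg _
      · nlinarith
    rw [Lp.norm_def, Lp.norm_def, eLpNorm_congr_ae (MemLp.coeFn_toLp hg.1)] at h7
    exact (ENNReal.toReal_le_toReal (Lp.eLpNorm_ne_top _) hg.1.2.ne).1 h7

end HilbertModel

/-! ### Embeddings and interpolation inequalities -/

section Compactness

variable {d : ℕ} {Ω : Set (Euc d)}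

/-- The quotient of order s is |x - y|^{s' - s} times that of order s', hence small near the
diagonal. -/
theorem enorm_gagliardoQuotient_sq_le_of_lt {s s' δ : ℝ} (hs : s ≤ s') (f : Euc d → ℝ)
    {p : Euc d × Euc d} (hp : ‖p.1 - p.2‖ ≤ δ) :
    ‖gagliardoQuotient s f p‖ₑ ^ 2 ≤
      ENNReal.ofReal ((δ ^ (s' - s)) ^ 2) * ‖gagliardoQuotient s' f p‖ₑ ^ 2 := by
  rcases eq_or_ne p.1 p.2 with h | h
  · simp [gagliardoQuotient, h]
  have h0 : 0 < ‖p.1 - p.2‖ := norm_pos_iff.2 (sub_ne_zero.2 h)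
  have h1 : ‖p.1 - p.2‖ ^ (s' - s) ≤ δ ^ (s' - s) :=
    Real.rpow_le_rpow h0.le hp (sub_nonneg.2 hs)
  have h2 : gagliardoQuotient s f p = ‖p.1 - p.2‖ ^ (s' - s) * gagliardoQuotient s' f p := by
    have e : ((d : ℝ) - 1) / 2 + s' = (((d : ℝ) - 1) / 2 + s) + (s' - s) := by ring
    have h3 : ‖p.1 - p.2‖ ^ (s' - s) ≠ 0 := (Real.rpow_pos_of_pos h0 _).ne'
    have h4 : ‖p.1 - p.2‖ ^ (((d : ℝ) - 1) / 2 + s) ≠ 0 := (Real.rpow_pos_of_pos h0 _).ne'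
    rw [gagliardoQuotient, gagliardoQuotient, e, Real.rpow_add h0 (((d : ℝ) - 1) / 2 + s)]
    generalize ‖p.1 - p.2‖ ^ (s' - s) = x at h3 ⊢
    generalize ‖p.1 - p.2‖ ^ (((d : ℝ) - 1) / 2 + s) = y at h4 ⊢
    field_simp
  rw [h2, enorm_mul, mul_pow, Real.enorm_sq]
  gcongr

/-- Interpolation between `L²` and `H^{s'}`. -/
theorem eLpNorm_gagliardo_sq_le [IsFiniteMeasure (surf Ω)] {s s' δ : ℝ} (hδ : 0 < δ) (hs : s ≤ s')
    (he : 0 ≤ ((d : ℝ) - 1) / 2 + s) {f : Euc d → ℝ} (hf : Measurable f) :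
    eLpNorm (gagliardoQuotient s f) 2 ((surf Ω).prod (surf Ω)) ^ 2 ≤
      ENNReal.ofReal ((δ ^ (s' - s)) ^ 2) *
        eLpNorm (gagliardoQuotient s' f) 2 ((surf Ω).prod (surf Ω)) ^ 2 +
      ENNReal.ofReal (2 / (δ ^ (((d : ℝ) - 1) / 2 + s)) ^ 2) * (2 * surf Ω univ) *
        eLpNorm f 2 (surf Ω) ^ 2 := by
  rw [eLpNorm_two_sq, eLpNorm_two_sq, eLpNorm_two_sq, ← lintegral_prod_enorm_sq_add hf,
    ← lintegral_const_mul _ ((measurable_gagliardoQuotient hf).enorm.pow_const 2),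
    ← lintegral_add_left
      (((measurable_gagliardoQuotient hf).enorm.pow_const 2).const_mul _)]
  refine lintegral_mono fun p => ?_
  rcases le_total ‖p.1 - p.2‖ δ with h | h
  · exact (enorm_gagliardoQuotient_sq_le_of_lt hs f h).trans le_self_add
  · exact (enorm_gagliardoQuotient_sq_le hδ he f h).trans le_add_self

/-- The seminorm of order 1 is an infimum over generalized gradients, so estimates hold first for
each value above it and are then passed to the limit. -/
theorem ennreal_le_of_forall_lt {S : ℝ≥0∞} (hS : S < ⊤) {A a C : ℝ≥0∞} (hC : C < ⊤)
    (h : ∀ x > S, A ≤ C * (a + x ^ 2)) : A ≤ C * (a + S ^ 2) := by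
  have hne : (𝓝[>] S).NeBot := nhdsGT_neBot_of_exists_gt ⟨⊤, hS⟩
  have hlim : Tendsto (fun x : ℝ≥0∞ => C * (a + x ^ 2)) (𝓝[>] S) (𝓝 (C * (a + S ^ 2))) := by
    refine ENNReal.Tendsto.const_mul (Tendsto.mono_left ?_ nhdsWithin_le_nhds) (Or.inr hC.ne)
    exact (tendsto_const_nhds.add (ENNReal.Tendsto.pow tendsto_id))
  exact ge_of_tendsto hlim (eventually_nhdsWithin_of_forall h)

namespace IsCollar

variable {ρ : Euc d → ℝ} {N : Euc d → Euc d} {r a : ℝ}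

/-- `H¹(∂Ω) ⊂ H^s(∂Ω)`. -/
theorem exists_eLpNorm_gagliardo_le_of_hasTangentialGradient (h : IsCollar Ω ρ N r a) {s : ℝ}
    (hs0 : 0 < s) (hs1 : s < 1) :
    ∃ C : ℝ≥0∞, C < ⊤ ∧ ∀ (φ : Euc d → ℝ) (g : Euc d → Euc d), MemLp φ 2 (surf Ω) →
      HasTangentialGradient Ω φ g →
      eLpNorm (gagliardoQuotient s φ) 2 ((surf Ω).prod (surf Ω)) ^ 2 ≤
        C * (eLpNorm φ 2 (surf Ω) ^ 2 + eLpNorm g 2 (surf Ω) ^ 2) := by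
  have hfin := h.isFiniteMeasure_surf
  obtain ⟨C, hC, hCf⟩ := h.exists_eLpNorm_gagliardo_le hs0 hs1
  refine ⟨C, hC, fun φ g hφ hg => ?_⟩
  obtain ⟨hg2, f, hf, hfm, hfφ, hfg⟩ := hg
  set α := fun k => eLpNorm (f k - φ) 2 (surf Ω) with hα
  set β := fun k => eLpNorm (tangentialGradient Ω (f k) - g) 2 (surf Ω) with hβ
  obtain ⟨k, hk, hka⟩ := (tendstoInMeasure_of_tendsto_eLpNorm two_ne_zero
    (fun n => (hfm n).1.1) hφ.1 hfφ).exists_seq_tendsto_ae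
  have hbound : ∀ n, eLpNorm (gagliardoQuotient s (f n)) 2 ((surf Ω).prod (surf Ω)) ≤
      (C * ((α n + eLpNorm φ 2 (surf Ω)) ^ 2 + (β n + eLpNorm g 2 (surf Ω)) ^ 2)) ^ (1 / 2 : ℝ) := by
    intro n
    have h1 : eLpNorm (f n) 2 (surf Ω) ≤ α n + eLpNorm φ 2 (surf Ω) := by
      have := eLpNorm_add_le ((hfm n).1.sub hφ).1 hφ.1 (one_le_two (α := ℝ≥0∞))
      rwa [sub_add_cancel] at this
    have h2 : eLpNorm (tangentialGradient Ω (f n)) 2 (surf Ω) ≤ β n + eLpNorm g 2 (surf Ω) := by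
      have := eLpNorm_add_le ((hfm n).2.sub hg2).1 hg2.1 (one_le_two (α := ℝ≥0∞))
      rwa [sub_add_cancel] at this
    have h3 := hCf (f n) ((hf n).of_le (by simp))
    have h4 : ∀ x : ℝ≥0∞, (x ^ 2) ^ (1 / 2 : ℝ) = x := fun x => by
      rw [← ENNReal.rpow_natCast, ← ENNReal.rpow_mul]
      norm_num
    rw [← h4 (eLpNorm (gagliardoQuotient s (f n)) 2 _)]
    refine ENNReal.rpow_le_rpow (h3.trans ?_) (by norm_num)
    gcongr
  have hlim : Tendsto (fun n => (C * ((α n + eLpNorm φ 2 (surf Ω)) ^ 2 +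
      (β n + eLpNorm g 2 (surf Ω)) ^ 2)) ^ (1 / 2 : ℝ)) atTop
      (𝓝 ((C * (eLpNorm φ 2 (surf Ω) ^ 2 + eLpNorm g 2 (surf Ω) ^ 2)) ^ (1 / 2 : ℝ))) := by
    refine (ENNReal.continuous_rpow_const.tendsto _).comp ?_
    refine ENNReal.Tendsto.const_mul ?_ (Or.inr hC.ne)
    have t1 := ENNReal.Tendsto.pow (n := 2) (hfφ.add_const (eLpNorm φ 2 (surf Ω)))
    have t2 := ENNReal.Tendsto.pow (n := 2) (hfg.add_const (eLpNorm g 2 (surf Ω)))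
    rw [zero_add] at t1 t2
    exact t1.add t2
  -- The estimate for smooth functions carries over by Fatou along an almost everywhere convergent
  -- subsequence.
  have hfatou := Lp.eLpNorm_lim_le_liminf_eLpNorm (p := 2)
    (fun n => aestronglyMeasurable_gagliardoQuotient (s := s) (hfm (k n)).1.1)
    (gagliardoQuotient s φ) (ae_tendsto_gagliardoQuotient hka)
  have h1 : eLpNorm (gagliardoQuotient s φ) 2 ((surf Ω).prod (surf Ω)) ≤
      (C * (eLpNorm φ 2 (surf Ω) ^ 2 + eLpNorm g 2 (surf Ω) ^ 2)) ^ (1 / 2 : ℝ) := by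
    rw [← (hlim.comp hk.tendsto_atTop).liminf_eq]
    exact hfatou.trans (liminf_le_liminf (Eventually.of_forall fun n => hbound (k n)))
  calc _ ≤ ((C * (eLpNorm φ 2 (surf Ω) ^ 2 + eLpNorm g 2 (surf Ω) ^ 2)) ^ (1 / 2 : ℝ)) ^ 2 := by
        gcongr
    _ = _ := by
        rw [← ENNReal.rpow_natCast, ← ENNReal.rpow_mul]
        norm_num

/-- `H^{s₂}(∂Ω) ⊂ H^s(∂Ω)` for some `s₁ < s < 1`. -/
theorem exists_fractional_embedding (h : IsCollar Ω ρ N r a) {s₁ s₂ : ℝ} (hs₁ : 0 ≤ s₁)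
    (hs₁₂ : s₁ < s₂) (hs₂ : s₂ ≤ 1) :
    ∃ s, s₁ < s ∧ s < 1 ∧ ∃ C : ℝ, 0 ≤ C ∧ ∀ φ : Euc d → ℝ, MemSobolev Ω s₂ φ →
      eLpNorm (gagliardoQuotient s φ) 2 ((surf Ω).prod (surf Ω)) ^ 2 ≤
        ENNReal.ofReal (C * sobolevNorm Ω s₂ φ ^ 2) := by
  rcases hs₂.lt_or_eq with hlt | rfl
  · refine ⟨s₂, hs₁₂, hlt, 1, zero_le_one, fun φ hφ => ?_⟩
    have e : sobolevSeminorm Ω s₂ φ =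
        eLpNorm (gagliardoQuotient s₂ φ) 2 ((surf Ω).prod (surf Ω)) := by
      simp only [sobolevSeminorm, not_le.2 (hs₁.trans_lt hs₁₂), hlt, if_true, if_false]
    rw [← e, one_mul, sobolevNorm_sq, ← ENNReal.ofReal_toReal hφ.2.1.ne,
      ← ENNReal.ofReal_pow ENNReal.toReal_nonneg, ENNReal.ofReal_toReal hφ.2.1.ne]
    exact ENNReal.ofReal_le_ofReal (le_add_of_nonneg_left (sq_nonneg _))
  -- At s₂ = 1 there is no Gagliardo quotient to work with, so an intermediate fractional order is
  -- inserted.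
  · refine ⟨(s₁ + 1) / 2, by linarith, by linarith, ?_⟩
    obtain ⟨C, hC, hCf⟩ := h.exists_eLpNorm_gagliardo_le_of_hasTangentialGradient
      (s := (s₁ + 1) / 2) (by linarith) (by linarith)
    refine ⟨C.toReal, ENNReal.toReal_nonneg, fun φ hφ => ?_⟩
    have key : eLpNorm (gagliardoQuotient ((s₁ + 1) / 2) φ) 2 ((surf Ω).prod (surf Ω)) ^ 2 ≤
        C * (eLpNorm φ 2 (surf Ω) ^ 2 + sobolevSeminorm Ω 1 φ ^ 2) := by
      refine ennreal_le_of_forall_lt hφ.2.1 hC fun x hx => ?_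
      simp only [sobolevSeminorm, not_le.2 (zero_lt_one' ℝ), lt_irrefl, if_false, gt_iff_lt,
        iInf_lt_iff] at hx
      obtain ⟨g, hg, hgx⟩ := hx
      refine (hCf φ g hφ.1 hg).trans ?_
      gcongr
    refine key.trans_eq ?_
    rw [sobolevNorm_sq, ENNReal.ofReal_mul ENNReal.toReal_nonneg, ENNReal.ofReal_toReal hC.ne,
      ENNReal.ofReal_add (by positivity) (by positivity),
      ENNReal.ofReal_pow ENNReal.toReal_nonneg, ENNReal.ofReal_pow ENNReal.toReal_nonneg,
      ENNReal.ofReal_toReal hφ.1.2.ne, ENNReal.ofReal_toReal hφ.2.1.ne]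

theorem sobolevNorm_eq_zero (hemp : frontier Ω = ∅) (s : ℝ) (φ : Euc d → ℝ) :
    sobolevNorm Ω s φ = 0 := by
  have h0 := surf_eq_zero hemp
  have h1 : φ =ᵐ[surf Ω] 0 := by
    rw [h0]
    exact ae_zero.le (by simp)
  have h2 := sobolevNorm_sq (Ω := Ω) (s := s) φ
  rw [sobolevSeminorm_congr h1, sobolevSeminorm_zero, h0] at h2
  simpa using h2

/-- The compactness of `H^{s₂}(∂Ω) ⊂ H^{s₁}(∂Ω)`, as an inequality. -/
theorem exists_interpolation (h : IsCollar Ω ρ N r a) {s₁ s₂ : ℝ} (hs₁ : 0 ≤ s₁)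
    (hs₁₂ : s₁ < s₂) (hs₂ : s₂ ≤ 1) {ε : ℝ} (hε : 0 < ε) :
    ∃ K, ∀ φ : Lp ℝ 2 (surf Ω), MemSobolev Ω s₂ φ →
      sobolevNorm Ω s₁ φ ^ 2 ≤ ε * sobolevNorm Ω s₂ φ ^ 2 + K * ‖φ‖ ^ 2 := by
  rcases (frontier Ω).eq_empty_or_nonempty with hemp | hne
  · exact ⟨0, fun φ _ => by simp [sobolevNorm_eq_zero hemp]⟩
  rcases hs₁.eq_or_lt with rfl | hs₁0
  · refine ⟨1, fun φ _ => ?_⟩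
    rw [sobolevNorm_sq (s := 0)]
    simp only [sobolevSeminorm, le_refl, if_true, Lp.norm_def, ENNReal.toReal_zero]
    have := sq_nonneg (sobolevNorm Ω s₂ φ)
    nlinarith
  have hfin := h.isFiniteMeasure_surf
  have hd : (1 : ℝ) ≤ d := by exact_mod_cast h.one_le_dim hne
  obtain ⟨s, hs, hs1, C, hC, hCf⟩ := h.exists_fractional_embedding hs₁ hs₁₂ hs₂
  have hlim : Tendsto (fun δ : ℝ => (δ ^ (s - s₁)) ^ 2 * C) (𝓝[>] 0) (𝓝 0) := by
    have h1 : ContinuousAt (fun δ : ℝ => (δ ^ (s - s₁)) ^ 2 * C) 0 :=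
      ((Real.continuousAt_rpow_const 0 (s - s₁) (Or.inr (by linarith))).pow 2).mul_const C
    have h2 := h1.tendsto.mono_left (nhdsWithin_le_nhds (s := Ioi (0 : ℝ)))
    simpa [Real.zero_rpow (sub_ne_zero.2 hs.ne')] using h2
  -- Splitting at distance δ, the near part costs δ^{2(s - s₁)} C < ε times the squared H^{s₂} norm,
  -- and the far part only the L² norm.
  obtain ⟨δ, hδε, hδ⟩ := ((hlim.eventually (gt_mem_nhds hε)).and self_mem_nhdsWithin).exists
  have hδ : 0 < δ := hδ
  set Q : ℝ≥0∞ := ENNReal.ofReal (2 / (δ ^ (((d : ℝ) - 1) / 2 + s₁)) ^ 2) * (2 * surf Ω univ) with hQ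
  have hQt : Q < ⊤ := ENNReal.mul_lt_top ENNReal.ofReal_lt_top
    (ENNReal.mul_lt_top (by norm_num) (measure_lt_top _ _))
  refine ⟨1 + Q.toReal, fun φ hφ => ?_⟩
  have h1 := eLpNorm_gagliardo_sq_le (Ω := Ω) hδ hs.le (by linarith)
    (Lp.stronglyMeasurable φ).measurable
  have e : sobolevSeminorm Ω s₁ φ =
      eLpNorm (gagliardoQuotient s₁ φ) 2 ((surf Ω).prod (surf Ω)) := by
    simp only [sobolevSeminorm, not_le.2 hs₁0, hs₁₂.trans_le hs₂, if_true, if_false]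
  have h2 : sobolevSeminorm Ω s₁ φ ^ 2 ≤ ENNReal.ofReal ((δ ^ (s - s₁)) ^ 2 *
      (C * sobolevNorm Ω s₂ φ ^ 2) + Q.toReal * ‖φ‖ ^ 2) := by
    rw [e]
    refine h1.trans ?_
    rw [ENNReal.ofReal_add (by positivity) (by positivity), ENNReal.ofReal_mul (by positivity),
      ENNReal.ofReal_mul (p := Q.toReal) (by positivity), ENNReal.ofReal_toReal hQt.ne, Lp.norm_def,
      ENNReal.ofReal_pow ENNReal.toReal_nonneg, ENNReal.ofReal_toReal (Lp.eLpNorm_ne_top φ)]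
    gcongr
    exact hCf φ hφ
  have h3 := ENNReal.toReal_mono ENNReal.ofReal_ne_top h2
  rw [ENNReal.toReal_ofReal (by positivity), ENNReal.toReal_pow] at h3
  rw [sobolevNorm_sq (s := s₁), ← Lp.norm_def]
  have h4 := mul_le_mul_of_nonneg_right hδε.le (sq_nonneg (sobolevNorm Ω s₂ φ))
  nlinarith

end IsCollar

end Compactness

/-! ### Local averages: L² smallness up to finitely many functionals -/

section Averages

variable {d : ℕ} {Ω : Set (Euc d)}

/-- The `L²` norm on a small piece `A` is controlled by an average over a nearby set `B` and the
Gagliardo seminorm. -/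
theorem setLIntegral_enorm_sq_le {μ : Measure (Euc d)} [IsFiniteMeasure μ] {s D : ℝ}
    (he : 0 ≤ ((d : ℝ) - 1) / 2 + s) {f : Euc d → ℝ} (hf : Measurable f) (hfi : Integrable f μ)
    {A B : Set (Euc d)} (hA : MeasurableSet A) (hB : MeasurableSet B) (hBμ : μ B ≠ 0)
    (hAB : ∀ x ∈ A, ∀ y ∈ B, ‖x - y‖ ≤ D) :
    ∫⁻ x in A, ‖f x‖ₑ ^ 2 ∂μ ≤
      2 * ((μ B)⁻¹ * ENNReal.ofReal ((D ^ (((d : ℝ) - 1) / 2 + s)) ^ 2)) *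
        ∫⁻ x in A, ∫⁻ y, ‖gagliardoQuotient s f (x, y)‖ₑ ^ 2 ∂μ ∂μ +
      2 * ‖(μ.real B)⁻¹ * ∫ y in B, f y ∂μ‖ₑ ^ 2 * μ A := by
  set e : ℝ := ((d : ℝ) - 1) / 2 + s with hedef
  set m : ℝ := (μ.real B)⁻¹ * ∫ y in B, f y ∂μ with hm
  have hBr : μ.real B ≠ 0 := ENNReal.toReal_ne_zero.2 ⟨hBμ, measure_ne_top _ _⟩
  have hq : Measurable (fun p : Euc d × Euc d => ‖gagliardoQuotient s f p‖ₑ ^ 2) :=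
    (measurable_gagliardoQuotient hf).enorm.pow_const 2
  have hdist : ∀ x ∈ A, ∀ y ∈ B,
      ‖f x - f y‖ₑ ^ 2 ≤ ENNReal.ofReal ((D ^ e) ^ 2) * ‖gagliardoQuotient s f (x, y)‖ₑ ^ 2 := by
    intro x hx y hy
    rcases eq_or_ne x y with rfl | hxy
    · simp
    have h0 : 0 < ‖x - y‖ := norm_pos_iff.2 (sub_ne_zero.2 hxy)
    have h1 : ‖x - y‖ ^ e ≤ D ^ e := Real.rpow_le_rpow h0.le (hAB x hx y hy) he
    have h2 : f x - f y = ‖x - y‖ ^ e * gagliardoQuotient s f (x, y) := by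
      rw [gagliardoQuotient, ← hedef, mul_div_cancel₀ _ (Real.rpow_pos_of_pos h0 e).ne']
    rw [h2, enorm_mul, mul_pow, Real.enorm_sq (‖x - y‖ ^ e)]
    gcongr
  have hpt : ∀ x ∈ A, ‖f x‖ₑ ^ 2 ≤
      2 * ((μ B)⁻¹ * ENNReal.ofReal ((D ^ e) ^ 2)) *
        ∫⁻ y, ‖gagliardoQuotient s f (x, y)‖ₑ ^ 2 ∂μ + 2 * ‖m‖ₑ ^ 2 := by
    intro x hx
    -- The deviation from the mean is an average of differences, each of which is a Gagliardo
    -- quotient times a bounded power of the distance.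
    have h1 : f x - m = (μ.real B)⁻¹ * ∫ y in B, (f x - f y) ∂μ := by
      rw [integral_sub (integrable_const _) hfi.integrableOn, setIntegral_const, smul_eq_mul, hm,
        mul_sub, inv_mul_cancel_left₀ hBr]
    have h2 : ‖f x - m‖ₑ ≤ (μ B)⁻¹ * ∫⁻ y in B, ‖f x - f y‖ₑ ∂μ := by
      rw [h1, enorm_mul]
      gcongr
      · rw [Real.enorm_eq_ofReal (by positivity), ENNReal.ofReal_inv_of_pos (by positivity),
          ofReal_measureReal]
      · exact enorm_integral_le_lintegral_enorm _
    have h3 : ‖f x - m‖ₑ ^ 2 ≤ (μ B)⁻¹ * ENNReal.ofReal ((D ^ e) ^ 2) *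
        ∫⁻ y, ‖gagliardoQuotient s f (x, y)‖ₑ ^ 2 ∂μ := by
      have hmeas : Measurable fun y => ‖f x - f y‖ₑ := by fun_prop
      have h4 := sq_lintegral_le (μ := μ.restrict B) hmeas.aemeasurable
      rw [Measure.restrict_apply_univ] at h4
      calc ‖f x - m‖ₑ ^ 2 ≤ ((μ B)⁻¹ * ∫⁻ y in B, ‖f x - f y‖ₑ ∂μ) ^ 2 := by gcongr
        _ ≤ (μ B)⁻¹ ^ 2 * (μ B * ∫⁻ y in B, ‖f x - f y‖ₑ ^ 2 ∂μ) := by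
          rw [mul_pow]
          gcongr
        _ = (μ B)⁻¹ * ∫⁻ y in B, ‖f x - f y‖ₑ ^ 2 ∂μ := by
          rw [sq, ← mul_assoc, mul_assoc (μ B)⁻¹, ENNReal.inv_mul_cancel hBμ (measure_ne_top _ _),
            mul_one]
        _ ≤ (μ B)⁻¹ * ∫⁻ y in B, ENNReal.ofReal ((D ^ e) ^ 2) *
              ‖gagliardoQuotient s f (x, y)‖ₑ ^ 2 ∂μ := by
          gcongr (μ B)⁻¹ * ?_
          exact setLIntegral_mono' hB fun y hy => hdist x hx y hy
        _ ≤ (μ B)⁻¹ * ∫⁻ y, ENNReal.ofReal ((D ^ e) ^ 2) *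
              ‖gagliardoQuotient s f (x, y)‖ₑ ^ 2 ∂μ := by
          gcongr (μ B)⁻¹ * ?_
          exact setLIntegral_le_lintegral _ _
        _ = _ := by
          rw [lintegral_const_mul' _ _ ENNReal.ofReal_ne_top, mul_assoc]
    have h5 : ‖f x‖ₑ ^ 2 ≤ 2 * ‖f x - m‖ₑ ^ 2 + 2 * ‖m‖ₑ ^ 2 := by
      simp only [Real.enorm_sq]
      rw [← ENNReal.ofReal_ofNat 2, ← ENNReal.ofReal_mul (by norm_num),
        ← ENNReal.ofReal_mul (by norm_num), ← ENNReal.ofReal_add (by positivity) (by positivity)]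
      refine ENNReal.ofReal_le_ofReal ?_
      nlinarith [sq_nonneg (f x - m - m)]
    refine h5.trans ?_
    rw [mul_assoc]
    gcongr
  have hint : Measurable fun x => ∫⁻ y, ‖gagliardoQuotient s f (x, y)‖ₑ ^ 2 ∂μ :=
    hq.lintegral_prod_right'
  calc ∫⁻ x in A, ‖f x‖ₑ ^ 2 ∂μ
      ≤ ∫⁻ x in A, (2 * ((μ B)⁻¹ * ENNReal.ofReal ((D ^ e) ^ 2)) *
        ∫⁻ y, ‖gagliardoQuotient s f (x, y)‖ₑ ^ 2 ∂μ + 2 * ‖m‖ₑ ^ 2) ∂μ :=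
        setLIntegral_mono' hA hpt
    _ = _ := by
        rw [lintegral_add_right _ measurable_const, lintegral_const_mul _ hint,
          setLIntegral_const]

/-- The mean over B is an L² pairing with an indicator, hence a bounded functional; a scalar factor
absorbs 2 μ(A). -/
theorem exists_average_functional {μ : Measure (Euc d)} [IsFiniteMeasure μ] {s D κ : ℝ}
    (he : 0 ≤ ((d : ℝ) - 1) / 2 + s) {A B : Set (Euc d)} (hA : MeasurableSet A)
    (hB : MeasurableSet B) (hBμ : 0 < μ.real B) (hAB : ∀ x ∈ A, ∀ y ∈ B, ‖x - y‖ ≤ D)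
    (hκ : 2 * ((μ.real B)⁻¹ * (D ^ (((d : ℝ) - 1) / 2 + s)) ^ 2) ≤ κ) :
    ∃ F : Lp ℝ 2 μ →L[ℝ] ℝ, ∀ φ : Lp ℝ 2 μ, ∫⁻ x in A, ‖φ x‖ₑ ^ 2 ∂μ ≤
      ENNReal.ofReal κ * ∫⁻ x in A, ∫⁻ y, ‖gagliardoQuotient s φ (x, y)‖ₑ ^ 2 ∂μ ∂μ +
        ENNReal.ofReal (F φ ^ 2) := by
  have hB0 : μ B ≠ 0 := fun h0 => by simp [Measure.real, h0] at hBμ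
  refine ⟨(Real.sqrt (2 * μ.real A) * (μ.real B)⁻¹) •
    innerSL ℝ (indicatorConstLp 2 hB (measure_ne_top μ B) (1 : ℝ)), fun φ => ?_⟩
  have hφi : Integrable φ μ := (Lp.memLp φ).integrable one_le_two
  refine (setLIntegral_enorm_sq_le he (Lp.stronglyMeasurable φ).measurable hφi hA hB hB0
    hAB).trans ?_
  have hinner : innerSL ℝ (indicatorConstLp 2 hB (measure_ne_top μ B) (1 : ℝ)) φ =
      ∫ y in B, φ y ∂μ := L2.inner_indicatorConstLp_one (𝕜 := ℝ) hB _ φ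
  gcongr ?_ * _ + ?_
  · refine le_trans (le_of_eq ?_) (ENNReal.ofReal_le_ofReal hκ)
    rw [ENNReal.ofReal_mul (by norm_num), ENNReal.ofReal_mul (by positivity),
      ENNReal.ofReal_inv_of_pos hBμ, ofReal_measureReal, ENNReal.ofReal_ofNat]
  · have h2 : (2 : ℝ≥0∞) = ENNReal.ofReal 2 := (ENNReal.ofReal_ofNat 2).symm
    rw [smul_apply, hinner, smul_eq_mul, Real.enorm_sq, ← ofReal_measureReal (μ := μ) (s := A)]
    have ha : 0 ≤ μ.real A := measureReal_nonneg
    generalize ∫ y in B, φ y ∂μ = I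
    generalize μ.real A = a at ha ⊢
    generalize μ.real B = b
    rw [h2, ← ENNReal.ofReal_mul (by norm_num),
      ← ENNReal.ofReal_mul (by positivity)]
    refine ENNReal.ofReal_le_ofReal (le_of_eq ?_)
    rw [mul_pow, mul_pow, mul_pow, Real.sq_sqrt (by positivity)]
    ring

/-- Up to finitely many functionals, the `L²` norm is small compared to the Gagliardo seminorm. -/
theorem IsCollar.exists_finite_functionals {ρ : Euc d → ℝ} {N : Euc d → Euc d} {r a : ℝ}
    (h : IsCollar Ω ρ N r a) {s : ℝ} (hs : 0 < s) {ε : ℝ} (hε : 0 < ε) :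
    ∃ (k : ℕ) (F : Fin k → Lp ℝ 2 (surf Ω) →L[ℝ] ℝ), ∀ φ : Lp ℝ 2 (surf Ω),
      eLpNorm φ 2 (surf Ω) ^ 2 ≤ ENNReal.ofReal ε *
        eLpNorm (gagliardoQuotient s φ) 2 ((surf Ω).prod (surf Ω)) ^ 2 +
          ENNReal.ofReal (∑ i, F i φ ^ 2) := by
  have hfin := h.isFiniteMeasure_surf
  rcases (frontier Ω).eq_empty_or_nonempty with hemp | hne
  · exact ⟨0, Fin.elim0, fun φ => by simp [surf_eq_zero hemp]⟩
  have hd := h.one_le_dim hne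
  have hd' : (1 : ℝ) ≤ d := by exact_mod_cast hd
  have he : 0 ≤ ((d : ℝ) - 1) / 2 + s := by
    have : 0 ≤ ((d : ℝ) - 1) / 2 := by linarith
    positivity
  obtain ⟨c, hc, δ₀, hδ₀, hball⟩ := h.exists_le_surf_closedBall
  -- The kernel contributes (2δ)^{d - 1 + 2s} and the averaging set has measure at least c δ^{d -
  -- 1}; the powers d - 1 cancel and leave δ^{2s}, which tends to 0 since s > 0.
  have hlim : Tendsto (fun δ : ℝ => 2 * (c⁻¹ * (2 ^ (((d : ℝ) - 1) / 2 + s)) ^ 2) * (δ ^ s) ^ 2)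
      (𝓝[>] 0) (𝓝 0) := by
    have h1 : ContinuousAt (fun δ : ℝ =>
        2 * (c⁻¹ * ((2 : ℝ) ^ (((d : ℝ) - 1) / 2 + s)) ^ 2) * (δ ^ s) ^ 2) 0 :=
      ((Real.continuousAt_rpow_const 0 s (Or.inr hs.le)).pow 2).const_mul _
    have h2 := h1.tendsto.mono_left (nhdsWithin_le_nhds (s := Ioi (0 : ℝ)))
    simpa [Real.zero_rpow hs.ne'] using h2
  obtain ⟨δ, ⟨hδε, hδδ₀⟩, hδ⟩ := (((hlim.eventually (gt_mem_nhds hε)).and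
    ((gt_mem_nhds hδ₀).filter_mono nhdsWithin_le_nhds)).and self_mem_nhdsWithin).exists
  have hδ : 0 < δ := hδ
  have hδδ₀ : δ < δ₀ := hδδ₀
  have hpiece : ∀ x ∈ frontier Ω, ∀ A ⊆ Metric.closedBall x δ, MeasurableSet A →
      ∃ F : Lp ℝ 2 (surf Ω) →L[ℝ] ℝ, ∀ φ : Lp ℝ 2 (surf Ω), ∫⁻ x in A, ‖φ x‖ₑ ^ 2 ∂(surf Ω) ≤
        ENNReal.ofReal ε * ∫⁻ x in A, ∫⁻ y, ‖gagliardoQuotient s φ (x, y)‖ₑ ^ 2 ∂(surf Ω) ∂(surf Ω)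
          + ENNReal.ofReal (F φ ^ 2) := by
    intro x hx A hA hAm
    have h1 : c * δ ^ (d - 1) ≤ (surf Ω).real (Metric.closedBall x δ) :=
      (ENNReal.ofReal_le_iff_le_toReal (measure_ne_top _ _)).1 (hball x hx δ hδ hδδ₀.le)
    have h0 : 0 < c * δ ^ (d - 1) := by positivity
    refine exists_average_functional he hAm measurableSet_closedBall (h0.trans_le h1)
      (D := 2 * δ) (fun y hy z hz => ?_) ?_
    · rw [← dist_eq_norm]
      have h2 := Metric.mem_closedBall.1 (hA hy)
      have h3 := Metric.mem_closedBall'.1 hz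
      linarith [dist_triangle y x z]
    · refine le_trans ?_ hδε.le
      have h2 : (δ ^ (((d : ℝ) - 1) / 2 + s)) ^ 2 = δ ^ (d - 1) * (δ ^ s) ^ 2 := by
        rw [← Real.rpow_natCast, ← Real.rpow_natCast, ← Real.rpow_natCast, ← Real.rpow_mul hδ.le,
          ← Real.rpow_mul hδ.le, ← Real.rpow_add hδ, Nat.cast_sub hd]
        congr 1
        push_cast
        ring
      rw [Real.mul_rpow zero_le_two hδ.le, mul_pow, h2, mul_assoc]
      gcongr 2 * ?_
      calc ((surf Ω).real (Metric.closedBall x δ))⁻¹ *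
            ((2 ^ (((d : ℝ) - 1) / 2 + s)) ^ 2 * (δ ^ (d - 1) * (δ ^ s) ^ 2))
          ≤ (c * δ ^ (d - 1))⁻¹ *
            ((2 ^ (((d : ℝ) - 1) / 2 + s)) ^ 2 * (δ ^ (d - 1) * (δ ^ s) ^ 2)) := by gcongr
        _ = _ := by
          have : δ ^ (d - 1) ≠ 0 := by positivity
          field_simp
  -- Each new ball enters only through its part outside the previous union. The pieces are disjoint,
  -- so the Gagliardo integrals add up without multiplicity and the factor ε does not grow with the
  -- number of balls.
  have hind : ∀ t : Finset (Euc d), (∀ x ∈ t, x ∈ frontier Ω) →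
      ∃ (k : ℕ) (F : Fin k → Lp ℝ 2 (surf Ω) →L[ℝ] ℝ), ∀ φ : Lp ℝ 2 (surf Ω),
        ∫⁻ x in ⋃ z ∈ t, Metric.closedBall z δ, ‖φ x‖ₑ ^ 2 ∂(surf Ω) ≤
          ENNReal.ofReal ε * ∫⁻ x in ⋃ z ∈ t, Metric.closedBall z δ,
            ∫⁻ y, ‖gagliardoQuotient s φ (x, y)‖ₑ ^ 2 ∂(surf Ω) ∂(surf Ω) +
          ENNReal.ofReal (∑ i, F i φ ^ 2) := by
    intro t
    induction t using Finset.induction_on with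
    | empty => exact fun _ => ⟨0, Fin.elim0, fun φ => by simp⟩
    | insert z t hz ih =>
      intro ht
      obtain ⟨k, F, hF⟩ := ih fun x hx => ht x (Finset.mem_insert_of_mem hx)
      set U := ⋃ z ∈ t, Metric.closedBall z δ with hU
      have hUm : MeasurableSet U := Finset.measurableSet_biUnion t fun _ _ => measurableSet_closedBall
      have hAm : MeasurableSet (Metric.closedBall z δ \ U) := measurableSet_closedBall.diff hUm
      obtain ⟨G, hG⟩ := hpiece z (ht z (Finset.mem_insert_self z t)) _ sdiff_subset hAm
      refine ⟨k + 1, Fin.cons G F, fun φ => ?_⟩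
      have hUU : ⋃ w ∈ insert z t, Metric.closedBall w δ = (Metric.closedBall z δ \ U) ∪ U := by
        rw [Finset.set_biUnion_insert, sdiff_union_self]
      rw [hUU, lintegral_union hUm disjoint_sdiff_left, lintegral_union hUm disjoint_sdiff_left,
        Fin.sum_univ_succ, ENNReal.ofReal_add (sq_nonneg _)
          (Finset.sum_nonneg fun _ _ => sq_nonneg _), mul_add]
      simp only [Fin.cons_zero, Fin.cons_succ]
      refine (add_le_add (hG φ) (hF φ)).trans_eq ?_
      ring
  obtain ⟨t, ht, hcov⟩ := h.isCompact_frontier.elim_nhds_subcover (fun x => Metric.closedBall x δ)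
    (fun x _ => Metric.closedBall_mem_nhds x hδ)
  obtain ⟨k, F, hF⟩ := hind t ht
  refine ⟨k, F, fun φ => ?_⟩
  have hres : (surf Ω).restrict (⋃ z ∈ t, Metric.closedBall z δ) = surf Ω :=
    Measure.restrict_eq_self_of_ae_mem
      ((ae_mem_frontier h.isCompact_frontier.isClosed).mono fun x hx => hcov hx)
  have h1 := hF φ
  rw [hres] at h1
  rw [eLpNorm_two_sq, eLpNorm_two_sq, lintegral_prod _ ((measurable_gagliardoQuotient
    (Lp.stronglyMeasurable φ).measurable).enorm.pow_const 2).aemeasurable]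
  exact h1

end Averages

/-! ### Coercivity of the hessian and the main theorem -/

section Stability

variable {d : ℕ} {Ω : Set (Euc d)}

theorem sobolevNorm_congr {s : ℝ} {φ ψ : Euc d → ℝ} (h : φ =ᵐ[surf Ω] ψ) :
    sobolevNorm Ω s φ = sobolevNorm Ω s ψ := by
  rw [sobolevNorm, sobolevNorm, eLpNorm_congr_ae h, sobolevSeminorm_congr h]

theorem sobolevNorm_zero {s : ℝ} : sobolevNorm Ω s 0 = 0 := by
  simp [sobolevNorm, sobolevSeminorm_zero]

namespace IsCollar

variable {ρ : Euc d → ℝ} {N : Euc d → Euc d} {r a : ℝ}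

/-- A `C¹` function, as an element of `H^s(∂Ω)`. -/
theorem exists_sobolevSpace_eq (h : IsCollar Ω ρ N r a) (s : ℝ) {f : Euc d → ℝ}
    (hf : ContDiff ℝ 1 f) : ∃ φ : sobolevSpace Ω s, toFun φ =ᵐ[surf Ω] f := by
  have h1 := (h.memLp_of_contDiff hf).1
  have h2 : h1.toLp f =ᵐ[surf Ω] f := MemLp.coeFn_toLp h1
  exact ⟨⟨h1.toLp f, (h.memSobolev_of_contDiff hf).congr h2.symm⟩, h2⟩

/-- As a submodule of L², `sobolevSpace` carries only the L² norm. The abstract theorem is therefore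
applied to the forms pulled back to the model H. -/
theorem coercive_of_hilbert_model (h : IsCollar Ω ρ N r a) {s₁ s₂ : ℝ} (hs₁ : 0 ≤ s₁)
    (hs₁₂ : s₁ < s₂) (hs₂ : s₂ ≤ 1) {H : Type*} [NormedAddCommGroup H] [InnerProductSpace ℝ H]
    [CompleteSpace H] (P : H →ₗ[ℝ] sobolevSpace Ω s₂) (hP : Function.Surjective P)
    (hnorm : ∀ w, ‖w‖ = sobolevNorm Ω s₂ (toFun (P w)))
    (ℓm ℓr : LinearMap.BilinForm ℝ (sobolevSpace Ω s₂)) (hlsc : IsLSC ℓm) {c₁ : ℝ} (hc₁ : 0 < c₁)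
    (hcoercive : ∀ φ : sobolevSpace Ω s₂,
      (∃ f : Euc d → ℝ, ContDiff ℝ ∞ f ∧ toFun φ =ᵐ[surf Ω] f) →
        c₁ * (sobolevSeminorm Ω s₂ (toFun φ)).toReal ^ 2 ≤ ℓm φ φ)
    (hcont : IsContinuousIn s₁ ℓr)
    (hstable : ∀ φ : sobolevSpace Ω s₂, φ ≠ 0 → 0 < (ℓm + ℓr) φ φ) :
    ∃ c > 0, ∀ φ : sobolevSpace Ω s₂, c * sobolevNorm Ω s₂ (toFun φ) ^ 2 ≤ (ℓm + ℓr) φ φ := by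
  have hsq : ∀ w, ‖w‖ ^ 2 = ‖(P w : Lp ℝ 2 (surf Ω))‖ ^ 2 +
      (sobolevSeminorm Ω s₂ (toFun (P w))).toReal ^ 2 := fun w => by
    rw [hnorm, sobolevNorm_sq, Lp.norm_def]
  let ι : H →L[ℝ] Lp ℝ 2 (surf Ω) :=
    LinearMap.mkContinuous ((sobolevSpace Ω s₂).subtype ∘ₗ P) 1 fun w => by
      rw [one_mul]
      refine (sq_le_sq₀ (norm_nonneg _) (norm_nonneg _)).1 ?_
      rw [hsq]
      exact le_add_of_nonneg_right (sq_nonneg _)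
  have hι : ∀ w, ι w = (P w : Lp ℝ 2 (surf Ω)) := fun w => rfl
  have hsub : ∀ v w, sobolevNorm Ω s₂ (toFun (P v - P w)) = ‖v - w‖ := fun v w => by
    rw [hnorm, map_sub]
  suffices hcP : ∃ c > 0, ∀ w, c * ‖w‖ ^ 2 ≤ (ℓm.comp P P + ℓr.comp P P) w w by
    obtain ⟨c, hc, hcP⟩ := hcP
    refine ⟨c, hc, fun φ => ?_⟩
    obtain ⟨w, rfl⟩ := hP φ
    rw [← hnorm]
    exact hcP w
  refine coercive_of_lsc_add_compact ι (ℓm.comp P P) (ℓr.comp P P) ?_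
    {w | ∃ f : Euc d → ℝ, ContDiff ℝ ∞ f ∧ toFun (P w) =ᵐ[surf Ω] f} ?_ c₁ hc₁ ?_ ?_ ?_ ?_
  · intro x ε hε
    obtain ⟨δ, hδ, hδx⟩ := hlsc (P x) ε hε
    exact ⟨δ, hδ, fun y hy => hδx (P y) (by rwa [hsub])⟩
  -- Density of smooth functions is built into `MemSobolev`; ε / 2 in each component gives total
  -- norm at most ε / √2 < ε.
  · refine Metric.dense_iff.2 fun w ε hε => ?_
    have hε2 : 0 < ENNReal.ofReal (ε / 2) := ENNReal.ofReal_pos.2 (by positivity)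
    obtain ⟨f, hf, hf2, h1, h2⟩ := (P w).2.2.2 _ hε2
    obtain ⟨F, hF⟩ := h.exists_sobolevSpace_eq s₂ (hf.of_le (by simp) : ContDiff ℝ 1 f)
    obtain ⟨v, rfl⟩ := hP F
    refine ⟨v, ?_, f, hf, hF⟩
    have h3 : toFun (P w - P v) =ᵐ[surf Ω] toFun (P w) - f := by
      refine (Lp.coeFn_sub (P w : Lp ℝ 2 (surf Ω)) (P v)).trans ?_
      filter_upwards [hF] with x hx
      simp [← hx]
    rw [Metric.mem_ball', dist_eq_norm, ← hsub, sobolevNorm_congr h3]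
    have h4 := ENNReal.toReal_le_of_le_ofReal (by positivity) h1
    have h5 := ENNReal.toReal_le_of_le_ofReal (by positivity) h2
    refine lt_of_pow_lt_pow_left₀ 2 hε.le ?_
    rw [sobolevNorm_sq]
    have h6 := pow_le_pow_left₀ ENNReal.toReal_nonneg h4 2
    have h7 := pow_le_pow_left₀ ENNReal.toReal_nonneg h5 2
    have h8 : 0 < ε ^ 2 := by positivity
    nlinarith
  · intro x hx
    rw [hsq, hι, add_sub_cancel_left]
    exact hcoercive (P x) hx
  · intro ε hε
    obtain ⟨C, hC⟩ := hcont
    obtain ⟨K, hK⟩ := h.exists_interpolation hs₁ hs₁₂ hs₂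
      (div_pos hε (by positivity : (0 : ℝ) < |C| + 1))
    refine ⟨|C| * K, fun x => ?_⟩
    rw [hnorm, hι]
    have h1 := hC (P x) (P x)
    have h2 := mul_le_mul_of_nonneg_left (hK (P x) (P x).2) (abs_nonneg C)
    have h3 : C * sobolevNorm Ω s₁ (toFun (P x)) * sobolevNorm Ω s₁ (toFun (P x)) ≤
        |C| * sobolevNorm Ω s₁ (toFun (P x)) ^ 2 := by
      rw [mul_assoc, ← sq]
      gcongr
      exact le_abs_self C
    have h4 : |C| * (ε / (|C| + 1)) ≤ ε := by
      rw [mul_div_assoc', div_le_iff₀ (by positivity)]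
      nlinarith [abs_nonneg C]
    have h5 := mul_le_mul_of_nonneg_right h4 (sq_nonneg (sobolevNorm Ω s₂ (toFun (P x))))
    calc |ℓr (P x) (P x)| ≤ _ := h1.trans (h3.trans h2)
      _ ≤ _ := by
        rw [mul_add, ← mul_assoc, ← mul_assoc]
        gcongr
  · intro ε hε
    obtain ⟨s, hs, -, C, hC, hCf⟩ := h.exists_fractional_embedding hs₁ hs₁₂ hs₂
    obtain ⟨k, F, hF⟩ := h.exists_finite_functionals (hs₁.trans_lt hs)
      (div_pos hε (by positivity : 0 < C + 1))
    refine ⟨k, fun i => (F i).comp ι, fun x => ?_⟩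
    have hpos : 0 ≤ ∑ i, F i (P x : Lp ℝ 2 (surf Ω)) ^ 2 := Finset.sum_nonneg fun _ _ => sq_nonneg _
    have h1 : eLpNorm (toFun (P x)) 2 (surf Ω) ^ 2 ≤ ENNReal.ofReal
        (ε / (C + 1) * (C * sobolevNorm Ω s₂ (toFun (P x)) ^ 2) +
          ∑ i, F i (P x : Lp ℝ 2 (surf Ω)) ^ 2) := by
      rw [ENNReal.ofReal_add (by positivity) hpos, ENNReal.ofReal_mul (by positivity)]
      refine (hF (P x)).trans ?_
      gcongr
      exact hCf _ (P x).2
    have h2 := ENNReal.toReal_mono ENNReal.ofReal_ne_top h1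
    rw [ENNReal.toReal_ofReal (by positivity), ENNReal.toReal_pow] at h2
    rw [hι, Lp.norm_def, hnorm]
    refine h2.trans ?_
    gcongr ?_ + _
    rw [← mul_assoc]
    gcongr
    rw [div_mul_eq_mul_div, div_le_iff₀ (by positivity)]
    nlinarith
  · intro x hx
    -- P preserves norms, hence is injective.
    refine hstable (P x) fun h0 => hx ?_
    rw [← norm_eq_zero, hnorm, h0, ← sobolevNorm_zero (Ω := Ω) (s := s₂)]
    exact sobolevNorm_congr (Lp.coeFn_zero ℝ 2 (surf Ω))

/-- A shape hessian with the structure of a main part and a compact part is coercive as soon as it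
is positive. -/
theorem exists_coercive (h : IsCollar Ω ρ N r a) {s₁ s₂ : ℝ} (hs₁ : 0 ≤ s₁)
    (hs₁₂ : s₁ < s₂) (hs₂ : s₂ ≤ 1)
    (ℓm ℓr : LinearMap.BilinForm ℝ (sobolevSpace Ω s₂)) (hlsc : IsLSC ℓm) {c₁ : ℝ} (hc₁ : 0 < c₁)
    (hcoercive : ∀ φ : sobolevSpace Ω s₂,
      (∃ f : Euc d → ℝ, ContDiff ℝ ∞ f ∧ toFun φ =ᵐ[surf Ω] f) →
        c₁ * (sobolevSeminorm Ω s₂ (toFun φ)).toReal ^ 2 ≤ ℓm φ φ)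
    (hcont : IsContinuousIn s₁ ℓr)
    (hstable : ∀ φ : sobolevSpace Ω s₂, φ ≠ 0 → 0 < (ℓm + ℓr) φ φ) :
    ∃ c > 0, ∀ φ : sobolevSpace Ω s₂, c * sobolevNorm Ω s₂ (toFun φ) ^ 2 ≤ (ℓm + ℓr) φ φ := by
  have hfin := h.isFiniteMeasure_surf
  rcases hs₂.lt_or_eq with hlt | rfl
  · obtain ⟨V, P, hV, hP, hn⟩ := exists_hilbert_model_of_lt_one (Ω := Ω) (hs₁.trans_lt hs₁₂) hlt
    have : CompleteSpace V := hV.completeSpace_coe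
    exact h.coercive_of_hilbert_model hs₁ hs₁₂ hs₂ P hP hn ℓm ℓr hlsc hc₁ hcoercive hcont hstable
  · obtain ⟨V, P, hV, hP, hn⟩ := exists_hilbert_model_one (Ω := Ω)
    have : CompleteSpace V := hV.completeSpace_coe
    exact h.coercive_of_hilbert_model hs₁ hs₁₂ hs₂ P hP hn ℓm ℓr hlsc hc₁ hcoercive hcont hstable

end IsCollar

end Stability

theorem theorem1 (d : ℕ) (Ω : Set (Euc d)) (hΩ : IsBoundedDomain 5 Ω)
    (J : Set (Euc d) → ℝ)
    -- `J` is twice Fréchet differentiable on a neighbourhood of `Ω` for `d_Θ`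
    (hJ : ∃ ρ > 0, ∀ Ω' : Set (Euc d), dTheta Ω Ω' < ρ → IsTwiceShapeDifferentiableAt J Ω')
    -- structural hypotheses
    (s₁ s₂ : ℝ) (hs₁ : 0 ≤ s₁) (hs₁₂ : s₁ < s₂) (hs₂ : s₂ ≤ 1)
    (ℓ₂ ℓm ℓr : LinearMap.BilinForm ℝ (sobolevSpace Ω s₂))
    (hℓ₂ : IsShapeHessian J Ω ℓ₂) (hsplit : ℓ₂ = ℓm + ℓr)
    (hlsc : IsLSC ℓm)
    (c₁ : ℝ) (hc₁ : 0 < c₁)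
    (hcoercive : ∀ φ : sobolevSpace Ω s₂,
      (∃ f : Euc d → ℝ, ContDiff ℝ (⊤ : ℕ∞) f ∧ toFun φ =ᵐ[surf Ω] f) →
        c₁ * (sobolevSeminorm Ω s₂ (toFun φ)).toReal ^ 2 ≤ ℓm φ φ)
    (hcont : IsContinuousIn s₁ ℓr)
    (hC : ConditionC J Ω s₂)
    -- optimality conditions
    (hcrit : IsCritical J Ω)
    (hstable : ∀ φ : sobolevSpace Ω s₂, φ ≠ 0 → 0 < ℓ₂ φ φ) :
    ∃ r > 0, ∃ η > 0, ∃ c > 0, ∀ Ω' : Set (Euc d), dTheta Ω Ω' ≤ ENNReal.ofReal η →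
      ∃ h : Euc d → ℝ, IsNormalGraph Ω Ω' r h ∧
        (∀ h' : Euc d → ℝ, IsNormalGraph Ω Ω' r h' → EqOn h' h (frontier Ω)) ∧
        MemSobolev Ω s₂ h ∧
        J Ω' ≥ J Ω + c * sobolevNorm Ω s₂ h ^ 2 := by
  obtain ⟨ρ, N, r, a, h⟩ := exists_isCollar hΩ
  subst hsplit
  obtain ⟨c, hc, hcoer⟩ := h.exists_coercive hs₁ hs₁₂ hs₂ ℓm ℓr hlsc hc₁ hcoercive hcont hstable
  obtain ⟨η₁, hη₁, m, hm, hCm⟩ := hC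
  obtain ⟨M, hM, η₂, hη₂, hgraph⟩ := h.exists_normal_graph
  obtain ⟨η₃, hη₃, htaylor⟩ := exists_shape_taylor hJ hcrit
  -- Below η₄ the modulus of condition C uses up at most half of the coercivity constant.
  obtain ⟨η₄, hη₄, hmc⟩ := mem_nhdsGT_iff_exists_Ioo_subset.1
    (hm.eventually (gt_mem_nhds (half_pos hc)))
  have hη₄ : 0 < η₄ := hη₄
  obtain ⟨η, ⟨⟨⟨hη1, hη2⟩, hη3⟩, hη4⟩, hη⟩ :=
    ((((eventually_const_mul_lt (A := M * 2) hη₁).and (eventually_const_mul_lt (A := 2) hη₂)).and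
      (eventually_const_mul_lt (A := M * 2) hη₃)).and
      (eventually_const_mul_lt (A := M * 2) hη₄)).and self_mem_nhdsWithin |>.exists
  have hη : 0 < η := hη
  -- The constant is (c - c/2) / 2, the last factor 1/2 coming from Taylor's formula.
  refine ⟨r, h.r_pos, η, hη, c / 4, by positivity, fun Ω' hΩ' => ?_⟩
  -- The infimum defining the distance need not be attained; a strict bound by 2η provides an actual
  -- pair of fields.
  have hlt : dTheta Ω Ω' < ENNReal.ofReal (2 * η) :=
    hΩ'.trans_lt ((ENNReal.ofReal_lt_ofReal_iff (by positivity)).2 (by linarith))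
  simp only [dTheta, iInf_lt_iff] at hlt
  obtain ⟨θ, ψ, hl, hr, rfl, hnorm⟩ := hlt
  rw [ENNReal.ofReal_lt_ofReal_iff (by positivity)] at hnorm
  have hθ := norm_nonneg θ
  have hψ := norm_nonneg ψ
  obtain ⟨ζ, g, hg, hζg, hζ, hgr, hiff, hfr, himg⟩ :=
    hgraph θ ψ hl hr (by linarith) (by linarith)
  have hζη : ‖ζ‖ ≤ M * 2 * η := hζ.trans (by
    rw [mul_assoc]
    gcongr
    linarith)
  have hg1 : ContDiff ℝ 1 g := hg.of_le (by norm_num)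
  have htr : ∀ x ∈ frontier Ω, normalTrace Ω ζ x = g x := fun x hx => by
    rw [normalTrace, h.outerNormal_eq x hx, hζg, real_inner_smul_left, real_inner_self_eq_norm_sq,
      h.norm_normal x hx, one_pow, mul_one]
  have hnf : IsNormalField Ω ζ := fun x hx => by
    rw [htr x hx, h.outerNormal_eq x hx, hζg]
  have htr' : normalTrace Ω ζ =ᵐ[surf Ω] g := by
    filter_upwards [ae_mem_frontier h.isCompact_frontier.isClosed] with x hx using htr x hx
  refine ⟨g, ⟨fun x _ => hgr x, ?_⟩, fun h' hh' x hx => ?_, h.memSobolev_of_contDiff hg1, ?_⟩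
  · rw [hfr]
    exact image_congr fun x hx => by rw [h.outerNormal_eq x hx]
  -- On each normal segment of half-length r there is exactly one point of the new boundary, so a
  -- competing graph must agree with g.
  · refine (hiff x hx (h' x) (hh'.1 x hx)).1 ?_
    rw [hh'.2]
    exact ⟨x, hx, by simp only [h.outerNormal_eq x hx]⟩
  rw [← himg]
  -- The modulus of condition C is controlled only at positive arguments, so the zero field is
  -- treated apart; the shape is then unchanged and g vanishes almost everywhere on the boundary.
  rcases eq_or_ne ζ 0 with hζ0 | hζ0
  · have h0 : g =ᵐ[surf Ω] 0 := by
      filter_upwards [htr'] with x hx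
      rw [← hx, hζ0, normalTrace, Theta.zero_apply, inner_zero_left]
      rfl
    rw [hζ0, deform_zero, sobolevNorm_congr h0, sobolevNorm_zero]
    simp
  obtain ⟨φ, hφ⟩ := h.exists_sobolevSpace_eq s₂ hg1
  have hζpos : 0 < ‖ζ‖ := norm_pos_iff.2 hζ0
  have hhess := hℓ₂ ζ ζ hnf hnf φ φ (hφ.trans htr'.symm) (hφ.trans htr'.symm)
  have h1 := htaylor ζ (by linarith) _ (hCm ζ (by linarith) hnf)
  have h2 := hcoer φ
  rw [sobolevNorm_congr hφ, ← hhess] at h2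
  rw [sobolevNorm_congr htr'] at h1
  have h3 : m ‖ζ‖ < c / 2 := hmc ⟨hζpos, by linarith⟩
  have h4 := mul_le_mul_of_nonneg_right h3.le (sq_nonneg (sobolevNorm Ω s₂ g))
  rw [ge_iff_le]
  linarith
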